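/- **Setting.** Let $Q$ be a finite acyclic quiver with vertices $0,1,\dots,\rho$ ($\rho\ge 1$), unique source $0$, and $n_{ij}$ arrows $i\to j$ ($n_{ij}=0$ unless $i<j$), with a dimension vector $r$, $r_0=1$. Put $s_i=\sum_j n_{ji}r_j$, $s_i'=\sum_j n_{ij}r_j$, let $\tilde s_i$ be the number of paths from $0$ to $i$, and assume $0<r_i<s_i$ for all $i\ge1$. The quiver is *Y-shaped* if vertex $1$ has at most two outgoing arrows, every vertex $i>1$ has at most one outgoing arrow, every vertex has at most one incoming arrow that does not start at $0$, and every $j>1$ is reachable from $1$. Then $\{2,\dots,\rho\}=S_1'\sqcup S_2'$, where $S_1'$ consists of the vertices whose path from $1$ uses a chosen first arrow out of $1$ (so $S_2'=\emptyset$ if there is at most one arrow out of $1$). The quiver flag variety $M_Q$ is *Fano* if and only if $s_i'<s_i$ for all $i\ge 1$ (its anticanonical bundle is $\bigotimes_i \det(W_i)^{s_i-s_i'}$, with $W_i$ the tautological bundles, and its ample cone is the open positive orthant in the basis $\det W_i$); assume this. **The variety $Y(Q)$.** For each $v\ge1$ take variables $x^{(v)}_{jk}$, $1\le j\le s_v-r_v$,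 $1\le k\le\tilde s_v$. For $i\ge1$ let $A_i$ be the $(\tilde s_i-r_i)\times\tilde s_i$ matrix whose rows are the rows $(x^{(v)}_{j1},\dots,x^{(v)}_{j\tilde s_v})$ of all vertices $v\geq 1$ on the path from $1$ to $i$, padded by zeros on the left if $i\in S_1'$ and on the right if $i\in\{1\}\cup S_2'$. The rows, top to bottom, are grouped by $v$, with larger $v$ first if $i\in S_1'$ and smaller $v$ first if $i\in\{1\}\cup S_2'$, and inside a group by $j$. Use the lexicographic monomial order in which the variables of $v\in S_1'$ come first (larger $v$ before smaller $v$), then those of vertex $1$, then those of $v\in S_2'$ (smaller $v$ before larger $v$), and, for fixed $v$, $x^{(v)}_{11}>x^{(v)}_{12}>\cdots$ (row by row). Let $N_i+1$ be the number of maximal minors of $A_i$. Then $Y(Q)$ is the closure, in $\prod_{i=1}^{\rho}\mathbb P^{N_i}$, of the image of the torus with coordinates $x^{(v)}_{jk}$ under the map whose homogeneous coordinates in the $i$-th factor are the initial terms of the maximal minors of $A_i$ (with $0$ for a minor that vanishes identically). This is the toric variety of the SAGBI degeneration of $M_Q$. **The variety $X(Q)$.** Let $d_i=\tilde s_i-r_i$.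 For $j=1,2$ let the diagram $\Delta_j$ be the union, over $i\in S_j'\cup\{1\}$, of the rectangles $[d_i-(s_i-r_i),d_i]\times[0,r_i]$, divided into unit squares. The *ladder diagram* is the union of $\Delta_1$ and the image of $\Delta_2$ under the half-turn $(x,y)\mapsto(d_1-x,\,r_1-y)$. The vertices of the *ladder quiver* $L(Q)$ are: the origin $(0,0)$; the external vertices $v_i=(d_i,r_i)$, $i\geq 1$; the points $(d_p,\min(r_p,r_i))$ for every arrow $p\to i$ of $Q$ with $p\ne0$ (where for $i\in S_2'$ the half-turn is applied to these points and to $v_i$); and all lattice points in the interior of the ladder diagram. Its arrows are the lattice paths along the sides of the squares that go only to the right and up, from one vertex to another, and pass through no vertex in between. Give all vertices dimension $1$; let $K$ be the torus whose character lattice has basis $e_P$ indexed by the vertices $P\ne(0,0)$, and put $e_{(0,0)}=0$. Let $K$ act on $\mathbb C^{L(Q)_1}$ (coordinates indexed by the arrows), an arrow $a:P\to P'$ having weight $D_a=e_{P'}-e_P$. Then $X(Q)=\mathbb C^{L(Q)_1}/\!/_w K=\operatorname{Proj}\bigoplus_{k\ge0}\mathbb C[y_a]_{kw}$ is the GIT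 quotient with stability condition $w=\sum_a D_a$. **Theorem.** For every Fano Y-shaped quiver $Q$ (with dimension vector), $Y(Q)$ and $X(Q)$ are isomorphic as varieties (schemes) over $\mathbb C$. -/

import Mathlib

open CategoryTheory AlgebraicGeometry

/-! ## Quiver flag data and Y-shaped quivers -/

/-- The data of a quiver flag variety `M(Q, r)`: a finite acyclic quiver with vertex set
`{0, 1, …, ρ}`, `ρ = m + 1 ≥ 1`, with unique source `0`, and a dimension vector `r` with `r 0 = 1`.
`n i j` is the number of arrows from `i` to `j`.  The variety is a tower of Grassmannian bundles
with fibres the Grassmannians of `r i`-dimensional quotients of `s i`-dimensional spaces, and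
`0 < r i < s i` says that none of them is a point, so that the classes `det W_i`,
`i = 1, …, ρ`, of the tautological bundles form a basis of the Picard group. -/
structure QuiverFlagData where
  m : ℕ
  n : Fin (m + 2) → Fin (m + 2) → ℕ
  r : Fin (m + 2) → ℕ
  acyclic : ∀ i j, n i j ≠ 0 → i < j
  unique_source : ∀ j, j ≠ 0 → ∃ i, n i j ≠ 0
  r_zero : r 0 = 1
  r_pos : ∀ i, 0 < r i
  r_lt : ∀ i, i ≠ 0 → r i < ∑ j, n j i * r j

namespace QuiverFlagData

variable (Q : QuiverFlagData)

/-- The vertices `{0, 1, …, ρ}` of the quiver. -/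
abbrev V : Type := Fin (Q.m + 2)

/-- `s i = ∑_{a : t(a) = i} r_{s(a)}`. -/
def s (i : Q.V) : ℕ := ∑ j, Q.n j i * Q.r j

/-- `sOut i = ∑_{a : s(a) = i} r_{t(a)}` (usually written `s'_i`). -/
def sOut (i : Q.V) : ℕ := ∑ j, Q.n i j * Q.r j

/-- `sTilde i` is the number of paths in the quiver from `0` to `i`, which is `dim H⁰(M_Q, W_i)`. -/
def sTilde (i : Q.V) : ℕ :=
  (if i = 0 then 1 else 0) + ∑ j : {j : Q.V // j < i}, Q.n j i * sTilde j
termination_by i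
decreasing_by exact j.2

/-- There is a directed path (possibly of length zero) from `i` to `j`. -/
def Reach (i j : Q.V) : Prop := Relation.ReflTransGen (fun a b => Q.n a b ≠ 0) i j

end QuiverFlagData

/-- A Y-shaped quiver (with dimension vector).  Vertex `1` has at most two arrows out, all other
non-source vertices have at most one arrow out; every vertex has at most one arrow in that does not
start at the source `0`; every vertex `j > 1` can be reached from `1`.  The vertices `{2, …, ρ}` are
split into the two branches `S₁` and `S₂`; here `S₁` consists of the vertices whose path from `1`
passes through the (chosen) first arrow `1 → c` out of vertex `1`.  It is empty only if there is no
arrow out of vertex `1`, and it is all of `{2, …, ρ}` if there is just one. -/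
structure YShapedQuiver extends QuiverFlagData where
  arrows_from_one : ∑ j, n 1 j ≤ 2
  arrows_from : ∀ i, 1 < i → ∑ j, n i j ≤ 1
  arrows_into : ∀ j, ∑ i with i ≠ 0, n i j ≤ 1
  connected : ∀ j, 1 < j → toQuiverFlagData.Reach 1 j
  S₁ : Set (Fin (m + 2))
  S₁_spec : (S₁ = ∅ ∧ ∀ j, n 1 j = 0) ∨
    ∃ c, n 1 c ≠ 0 ∧ S₁ = {i | toQuiverFlagData.Reach c i}

namespace YShapedQuiver

variable (Q : YShapedQuiver)

/-- The second branch: the vertices in `{2, …, ρ}` that are not on the first branch. -/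
def S₂ : Set Q.V := {i | 1 < i ∧ i ∉ Q.S₁}

/-- `M_Q` is Fano.  The anticanonical bundle of `M_Q` is `⨂_{i ≥ 1} det(W_i)^(s i - s'_i)`, and for a
Y-shaped quiver with `0 < r i < s i` the ample cone is the open positive orthant in the basis
`det W_1, …, det W_ρ`, so that `M_Q` is Fano if and only if `s'_i < s i` for all `i ≥ 1`. -/
def IsFano : Prop := ∀ i : Q.V, i ≠ 0 → Q.sOut i < Q.s i

/-! ## The matrices `A_i` and their minors -/

/-- A block of new rows of size `s i - r i` is introduced for every vertex `i ≠ 0`. -/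
structure NewRow where
  v : Q.V
  hv : v ≠ 0
  row : Fin (Q.s v - Q.r v)

variable {Q} in
/-- The position of a vertex in the priority order: branch `S₁` from its far end, then vertex `1`,
then branch `S₂` towards its far end. -/
noncomputable def rank (i : Q.V) : ℤ :=
  open scoped Classical in if i ∈ Q.S₁ then -(i.val : ℤ) else (i.val : ℤ)

variable {Q} in
theorem rank_injective : Function.Injective (rank (Q := Q)) := by
  intro i j h
  unfold rank at h
  apply Fin.ext
  split_ifs at h <;> omega

variable {Q} in
/-- Rows are ordered by the priority of their vertex, then by their index. -/
noncomputable def NewRow.key (p : Q.NewRow) : ℤ ×ₗ ℕ := toLex (rank p.v, p.row.val)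

variable {Q} in
theorem NewRow.key_injective : Function.Injective (NewRow.key (Q := Q)) := by
  rintro ⟨v, hv, a⟩ ⟨v', hv', a'⟩ h
  have h1 := congrArg (fun z => (ofLex z).1) h
  have h2 := congrArg (fun z => (ofLex z).2) h
  simp only [NewRow.key, ofLex_toLex] at h1 h2
  obtain rfl := rank_injective h1
  obtain rfl := Fin.ext h2
  rfl

noncomputable instance : LinearOrder Q.NewRow := LinearOrder.lift' NewRow.key NewRow.key_injective

instance : Finite Q.NewRow :=
  Finite.of_injective
    (fun p : Q.NewRow => (⟨p.v, p.row⟩ : Σ i : Q.V, Fin (Q.s i - Q.r i))) (by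
      rintro ⟨v, hv, a⟩ ⟨v', hv', a'⟩ h
      simp only [Sigma.mk.injEq] at h
      obtain ⟨rfl, h⟩ := h
      obtain rfl := eq_of_heq h
      rfl)

/-- The coordinates `x^{(v)}_{j,k}`, `1 ≤ j ≤ s v - r v`, `1 ≤ k ≤ sTilde v` (both counted from `0`
here). -/
structure Coord where
  newRow : Q.NewRow
  col : Fin (Q.sTilde newRow.v)

variable {Q} in
/-- Coordinates are ordered by the priority of their vertex, and then lexicographically by their
matrix position. -/
noncomputable def Coord.key (x : Q.Coord) : (ℤ ×ₗ ℕ) ×ₗ ℕ := toLex (x.newRow.key, x.col.val)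

variable {Q} in
theorem Coord.key_injective : Function.Injective (Coord.key (Q := Q)) := by
  rintro ⟨p, a⟩ ⟨p', a'⟩ h
  have h1 := congrArg (fun z => (ofLex z).1) h
  have h2 := congrArg (fun z => (ofLex z).2) h
  simp only [Coord.key, ofLex_toLex] at h1 h2
  obtain rfl := NewRow.key_injective h1
  obtain rfl := Fin.ext h2
  rfl

/-- In this linear order, the smaller coordinate is the one that takes priority. -/
noncomputable instance : LinearOrder Q.Coord := LinearOrder.lift' Coord.key Coord.key_injective

instance : Finite Q.Coord :=
  Finite.of_injective
    (fun x : Q.Coord => (⟨x.newRow, x.col⟩ : Σ p : Q.NewRow, Fin (Q.sTilde p.v))) (by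
      rintro ⟨p, a⟩ ⟨p', a'⟩ h
      simp only [Sigma.mk.injEq] at h
      obtain ⟨rfl, h⟩ := h
      obtain rfl := eq_of_heq h
      rfl)

/-- The rows of the matrix `A_i`: the new rows of all non-source vertices `v` on the way to `i`, in
the order of their priority. -/
abbrev Row (i : Q.V) : Type := {p : Q.NewRow // Q.Reach p.v i}

noncomputable instance (i : Q.V) : Fintype (Q.Row i) := Fintype.ofFinite _

/-- The matrix `A_i`, with `sTilde i - r i` rows and `sTilde i` columns.  The rows belonging to `v`
contain the coordinates `x^{(v)}_{j,k}`.  They occupy the last `sTilde v` columns if `i` is on the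
branch `S₁` (the columns of the arrows from the source come first), and the first `sTilde v` columns
if `i` is vertex `1` or on the branch `S₂` (the columns of the arrows from the source come last).  All
other entries are zero. -/
noncomputable def A (i : Q.V) : Matrix (Q.Row i) (Fin (Q.sTilde i)) (MvPolynomial Q.Coord ℂ) :=
  open scoped Classical in
  fun p k =>
    if i ∈ Q.S₁ then
      if h : Q.sTilde i ≤ k.val + Q.sTilde p.1.v then
        MvPolynomial.X ⟨p.1, ⟨k.val + Q.sTilde p.1.v - Q.sTilde i, by omega⟩⟩
      else 0
    else
      if h : k.val < Q.sTilde p.1.v then MvPolynomial.X ⟨p.1, ⟨k.val, h⟩⟩ else 0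

/-- The maximal minors of `A_i` are indexed by the strictly increasing choices of columns. -/
abbrev Plucker (i : Q.V) : Type := Q.Row i ↪o Fin (Q.sTilde i)

/-- The maximal minor of `A_i` with columns `σ`. -/
noncomputable def minor (i : Q.V) (σ : Q.Plucker i) : MvPolynomial Q.Coord ℂ :=
  ((Q.A i).submatrix id σ).det

/-- The initial term of a maximal minor of `A_i`, for the lexicographic monomial order of the
coordinates. -/
noncomputable def initialTerm (i : Q.V) (σ : Q.Plucker i) : MvPolynomial Q.Coord ℂ :=
  (MonomialOrder.lex (σ := Q.Coord)).leadingTerm (Q.minor i σ)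

/-! ### Every `A_i` has a nonzero maximal minor -/

section Nonvanishing

variable {Q}

/-- The vertices other than the source. -/
def nonSource (Q : YShapedQuiver) : Finset Q.V := Finset.univ.filter (fun j => j ≠ 0)

theorem sum_split (f : Q.V → ℕ) : ∑ j, f j = f 0 + ∑ j ∈ Q.nonSource, f j := by
  rw [← Finset.add_sum_erase Finset.univ f (Finset.mem_univ 0)]
  congr 1
  apply Finset.sum_congr _ (fun _ _ => rfl)
  ext j
  simp [nonSource]

theorem sTilde_zero : Q.sTilde 0 = 1 := by
  rw [QuiverFlagData.sTilde]
  simp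

theorem sTilde_eq {i : Q.V} (hi : i ≠ 0) : Q.sTilde i = ∑ j, Q.n j i * Q.sTilde j := by
  rw [QuiverFlagData.sTilde, if_neg hi, zero_add]
  rw [← Finset.sum_subtype (Finset.univ.filter (· < i)) (by simp)
    (fun j => Q.n j i * Q.sTilde j)]
  apply Finset.sum_subset (Finset.subset_univ _)
  intro j _ hj
  have : Q.n j i = 0 := by
    by_contra h
    exact hj (by simpa using Q.acyclic j i h)
  simp [this]

theorem parent_sum {p i : Q.V} (hp : p ≠ 0) (h : Q.n p i ≠ 0) (f : Q.V → ℕ) :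
    ∑ j, Q.n j i * f j = Q.n 0 i * f 0 + f p := by
  rw [sum_split]
  congr 1
  have hle : ∑ x ∈ Q.nonSource, Q.n x i ≤ 1 := Q.arrows_into i
  have hpm : p ∈ Q.nonSource := by simp [nonSource, hp]
  have hsp : Q.n p i + ∑ j ∈ Q.nonSource.erase p, Q.n j i = ∑ j ∈ Q.nonSource, Q.n j i :=
    Finset.add_sum_erase _ (fun j => Q.n j i) hpm
  have h0 : ∑ j ∈ Q.nonSource.erase p, Q.n j i = 0 := by omega
  have h1 : Q.n p i = 1 := by omega
  rw [← Finset.add_sum_erase _ (fun j => Q.n j i * f j) hpm, h1, one_mul]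
  rw [Finset.sum_eq_zero_iff] at h0
  rw [Finset.sum_eq_zero (fun j hj => by rw [h0 j hj, zero_mul]), add_zero]

theorem parent_unique {p q i : Q.V} (hp : p ≠ 0) (hq : q ≠ 0) (h : Q.n p i ≠ 0)
    (h' : Q.n q i ≠ 0) : p = q := by
  by_contra hne
  have h1 := parent_sum hp h (fun j => if j = q then 1 else 0)
  have h2 := parent_sum hq h' (fun j => if j = q then 1 else 0)
  rw [h1] at h2
  simp [hne, hq.symm] at h2

theorem r_le_sTilde (i : Q.V) : Q.r i ≤ Q.sTilde i := by
  induction i using WellFoundedLT.induction with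
  | ind i ih =>
    by_cases hi : i = 0
    · subst hi
      rw [Q.r_zero, sTilde_zero]
    · refine (Q.r_lt i hi).le.trans ?_
      rw [sTilde_eq hi]
      apply Finset.sum_le_sum
      intro j _
      by_cases h : Q.n j i = 0
      · simp [h]
      · exact Nat.mul_le_mul_left _ (ih j (Q.acyclic j i h))

theorem s_le_sTilde {i : Q.V} (hi : i ≠ 0) : Q.s i ≤ Q.sTilde i := by
  rw [sTilde_eq hi]
  exact Finset.sum_le_sum fun j _ => Nat.mul_le_mul_left _ (r_le_sTilde j)

theorem r_lt_s {i : Q.V} (hi : i ≠ 0) : Q.r i < Q.s i := Q.r_lt i hi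

/-- One step towards the end of a branch: `sTilde i - r i = (sTilde p - r p) + (s i - r i)`. -/
theorem width_parent {p i : Q.V} (hp : p ≠ 0) (h : Q.n p i ≠ 0) :
    Q.sTilde i + Q.r p = Q.sTilde p + Q.s i := by
  have hi : i ≠ 0 := fun hi => by
    have := Q.acyclic p i h
    subst hi
    exact absurd this (by simp)
  rw [sTilde_eq hi, parent_sum hp h, QuiverFlagData.s, parent_sum hp h, sTilde_zero, Q.r_zero]
  omega

theorem reach_le {q i : Q.V} (h : Q.Reach q i) : q ≤ i := by
  induction h with
  | refl => exact le_rfl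
  | tail _ hb ih => exact ih.trans (Q.acyclic _ _ hb).le

theorem ne_zero_of_reach {q i : Q.V} (hq : q ≠ 0) (h : Q.Reach q i) : i ≠ 0 := by
  rintro rfl
  exact hq (le_antisymm (reach_le h) (Fin.zero_le _))

theorem width_mono {q i : Q.V} (hq : q ≠ 0) (h : Q.Reach q i) :
    Q.sTilde q + Q.r i ≤ Q.sTilde i + Q.r q := by
  induction h with
  | refl => exact le_rfl
  | @tail b c hb hbc ih =>
    have hb0 : b ≠ 0 := ne_zero_of_reach hq hb
    have h1 := width_parent hb0 hbc
    have h2 := r_lt_s (ne_zero_of_reach hb0 (Relation.ReflTransGen.single hbc))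
    omega

theorem width_strict {q i : Q.V} (hq : q ≠ 0) (h : Q.Reach q i) (hne : q ≠ i) :
    Q.sTilde q + Q.s i ≤ Q.sTilde i + Q.r q := by
  rcases Relation.ReflTransGen.cases_tail h with h | ⟨p, hp, hpi⟩
  · exact absurd h.symm hne
  · have hp0 : p ≠ 0 := ne_zero_of_reach hq hp
    have h1 := width_parent hp0 hpi
    have h2 := width_mono hq hp
    omega

theorem reach_total {p q i : Q.V} (hp : p ≠ 0) (hq : q ≠ 0) (h : Q.Reach p i)
    (h' : Q.Reach q i) : Q.Reach p q ∨ Q.Reach q p := by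
  induction h with
  | refl => exact Or.inr h'
  | @tail b c hb hbc ih =>
    rcases Relation.ReflTransGen.cases_tail h' with h' | ⟨d, hd, hdc⟩
    · subst h'
      exact Or.inl (hb.tail hbc)
    · have := parent_unique (ne_zero_of_reach hp hb) (ne_zero_of_reach hq hd) hbc hdc
      subst this
      exact ih hd

/-- Along the branch `S₁` the priority increases with the label. -/
theorem reach_of_rank_lt {i p q : Q.V} (hi : i ∈ Q.S₁) (hp : p ≠ 0) (hq : q ≠ 0)
    (h : Q.Reach p i) (h' : Q.Reach q i) (hlt : rank p < rank q) : Q.Reach q p ∧ q ≠ p := by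
  have hne : q ≠ p := by
    rintro rfl
    exact lt_irrefl _ hlt
  refine ⟨?_, hne⟩
  rcases Q.S₁_spec with ⟨hS, _⟩ | ⟨c, hc, hS⟩
  · rw [hS] at hi
    exact absurd hi (Set.notMem_empty i)
  · have key : ∀ z : Q.V, z ≠ 0 → Q.Reach z i → z ∉ Q.S₁ → z = 1 := by
      intro z hz hzi hzS
      have hc0 : c ≠ 0 := fun h0 => by
        have := Q.acyclic 1 c hc
        rw [h0] at this
        exact absurd this (by simp)
      have hci : Q.Reach c i := by
        have := hi
        rwa [hS] at this
      rcases reach_total hz hc0 hzi hci with hzc | hcz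
      · rcases Relation.ReflTransGen.cases_tail hzc with e | ⟨d, hd, hdc⟩
        · refine absurd ?_ hzS
          rw [hS, ← e]
          exact Relation.ReflTransGen.refl
        · have hd1 := parent_unique (ne_zero_of_reach hz hd) (by simp) hdc hc
          subst hd1
          have := reach_le hd
          rw [Fin.le_def, Fin.val_one] at this
          have h1 : z.val ≠ 0 := fun h => hz (Fin.ext h)
          apply Fin.ext
          rw [Fin.val_one]
          omega
      · refine absurd ?_ hzS
        rw [hS]
        exact hcz
    rcases reach_total hp hq h h' with hpq | hqp
    · have hle := reach_le hpq
      have hlt' : p < q := lt_of_le_of_ne hle hne.symm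
      exfalso
      have hqS : q ∈ Q.S₁ := by
        by_contra hqS
        have hq1 := key q hq h' hqS
        have : p.val ≠ 0 := fun h => hp (Fin.ext h)
        rw [hq1, Fin.lt_def, Fin.val_one] at hlt'
        omega
      rw [Fin.lt_def] at hlt'
      unfold rank at hlt
      rw [if_pos hqS] at hlt
      by_cases hpS : p ∈ Q.S₁
      · rw [if_pos hpS] at hlt
        omega
      · rw [if_neg hpS] at hlt
        omega
    · exact hqp

theorem reach_of_rank_lt' {i p q : Q.V} (hi : i ∉ Q.S₁) (hp : p ≠ 0) (hq : q ≠ 0)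
    (h : Q.Reach p i) (h' : Q.Reach q i) (hlt : rank p < rank q) : Q.Reach p q ∧ p ≠ q := by
  have hne : p ≠ q := by
    rintro rfl
    exact lt_irrefl _ hlt
  refine ⟨?_, hne⟩
  have key : ∀ z : Q.V, Q.Reach z i → z ∉ Q.S₁ := by
    intro z hz hzS
    rcases Q.S₁_spec with ⟨hS, _⟩ | ⟨c, hc, hS⟩
    · rw [hS] at hzS
      exact absurd hzS (Set.notMem_empty z)
    · refine hi ?_
      rw [hS] at hzS ⊢
      exact Relation.ReflTransGen.trans hzS hz
  unfold rank at hlt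
  rw [if_neg (key p h), if_neg (key q h')] at hlt
  rcases reach_total hp hq h h' with hpq | hqp
  · exact hpq
  · have := reach_le hqp
    rw [Fin.le_def] at this
    omega

theorem newRow_lt_iff (p q : Q.NewRow) :
    p < q ↔ rank p.v < rank q.v ∨ (p.v = q.v ∧ p.row.val < q.row.val) := by
  change p.key < q.key ↔ _
  rw [NewRow.key, NewRow.key, Prod.Lex.toLex_lt_toLex]
  simp [rank_injective.eq_iff]

/-- The columns `sTilde i - (sTilde v - r v) + j` (on the branch `S₁`), respectively
`sTilde v - s v + j` (otherwise), for the row `(v, j)`. -/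
theorem exists_diagonal (i : Q.V) :
    ∃ σ : Q.Plucker i, ∀ p : Q.Row i, ∃ x : Q.Coord, Q.A i p (σ p) = MvPolynomial.X x := by
  classical
  by_cases hi : i ∈ Q.S₁
  · refine ⟨OrderEmbedding.ofStrictMono
      (fun p : Q.Row i => (⟨Q.sTilde i + Q.r p.1.v + p.1.row.val - Q.sTilde p.1.v, ?_⟩ :
        Fin (Q.sTilde i))) ?_, ?_⟩
    · have h1 := p.1.row.2
      have h2 := s_le_sTilde p.1.hv
      have h3 := width_mono p.1.hv p.2
      have h4 := Q.r_pos i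
      have h5 : 0 < Q.r p.1.v := Q.r_pos p.1.v
      omega
    · intro p q hpq
      have hpq' : p.1 < q.1 := hpq
      rw [newRow_lt_iff] at hpq'
      rw [Fin.lt_def]
      have hp1 := p.1.row.2
      have hp2 := s_le_sTilde p.1.hv
      have hp3 := width_mono p.1.hv p.2
      have hq1 := q.1.row.2
      have hq3 := width_mono q.1.hv q.2
      rcases hpq' with h | ⟨h, h'⟩
      · obtain ⟨hr, hne⟩ := reach_of_rank_lt hi p.1.hv q.1.hv p.2 q.2 h
        have := width_strict q.1.hv hr hne
        simp only
        omega
      · simp only [h] at *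
        omega
    · intro p
      have h3 := width_mono p.1.hv p.2
      have h1 := p.1.row.2
      have h2 := s_le_sTilde p.1.hv
      have h4 : 0 < Q.r p.1.v := Q.r_pos p.1.v
      simp only [A, if_pos hi]
      rw [dif_pos]
      · exact ⟨_, rfl⟩
      · change Q.sTilde i ≤ Q.sTilde i + Q.r p.1.v + p.1.row.val - Q.sTilde p.1.v + Q.sTilde p.1.v
        omega
  · refine ⟨OrderEmbedding.ofStrictMono
      (fun p : Q.Row i => (⟨Q.sTilde p.1.v - Q.s p.1.v + p.1.row.val, ?_⟩ :
        Fin (Q.sTilde i))) ?_, ?_⟩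
    · have h1 := p.1.row.2
      have h2 := s_le_sTilde p.1.hv
      have h3 := width_mono p.1.hv p.2
      omega
    · intro p q hpq
      have hpq' : p.1 < q.1 := hpq
      rw [newRow_lt_iff] at hpq'
      rw [Fin.lt_def]
      have hp1 := p.1.row.2
      have hp2 := s_le_sTilde p.1.hv
      have hq1 := q.1.row.2
      rcases hpq' with h | ⟨h, h'⟩
      · obtain ⟨hr, hne⟩ := reach_of_rank_lt' hi p.1.hv q.1.hv p.2 q.2 h
        have := width_strict p.1.hv hr hne
        simp only
        omega
      · simp only [h] at *
        omega
    · intro p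
      have h1 := p.1.row.2
      have h2 := s_le_sTilde p.1.hv
      have h4 : 0 < Q.r p.1.v := Q.r_pos p.1.v
      simp only [A, if_neg hi]
      rw [dif_pos]
      · exact ⟨_, rfl⟩
      · change Q.sTilde p.1.v - Q.s p.1.v + p.1.row.val < Q.sTilde p.1.v
        omega

/-- Every entry of `A_i` is zero or a coordinate, and no coordinate occurs twice. -/
theorem A_entry (i : Q.V) (p : Q.Row i) (k : Fin (Q.sTilde i)) (x : Q.Coord)
    (h : Q.A i p k = MvPolynomial.X x) (p' : Q.Row i) (k' : Fin (Q.sTilde i)) :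
    Q.A i p' k' = 0 ∨ ∃ y, Q.A i p' k' = MvPolynomial.X y ∧ (y = x → p' = p ∧ k' = k) := by
  classical
  by_cases hi : i ∈ Q.S₁
  · simp only [A, if_pos hi] at h ⊢
    split_ifs at h with h1
    · obtain rfl := MvPolynomial.X_injective h
      split_ifs with h2
      · refine Or.inr ⟨_, rfl, fun e => ?_⟩
        rw [Coord.mk.injEq] at e
        obtain ⟨e1, e2⟩ := e
        obtain rfl := Subtype.ext e1
        have e3 := Fin.val_eq_of_eq (eq_of_heq e2)
        refine ⟨rfl, Fin.ext ?_⟩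
        simp only at e3
        omega
      · exact Or.inl rfl
    · exact absurd h.symm (MvPolynomial.X_ne_zero x)
  · simp only [A, if_neg hi] at h ⊢
    split_ifs at h with h1
    · obtain rfl := MvPolynomial.X_injective h
      split_ifs with h2
      · refine Or.inr ⟨_, rfl, fun e => ?_⟩
        rw [Coord.mk.injEq] at e
        obtain ⟨e1, e2⟩ := e
        obtain rfl := Subtype.ext e1
        have e3 := Fin.val_eq_of_eq (eq_of_heq e2)
        exact ⟨rfl, Fin.ext e3⟩
      · exact Or.inl rfl
    · exact absurd h.symm (MvPolynomial.X_ne_zero x)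

theorem exists_minor_ne_zero (i : Q.V) : ∃ σ : Q.Plucker i, Q.minor i σ ≠ 0 := by
  classical
  obtain ⟨σ, hσ⟩ := exists_diagonal i
  choose x hx using hσ
  refine ⟨σ, fun h => ?_⟩
  let ev : MvPolynomial Q.Coord ℂ →+* ℂ :=
    MvPolynomial.eval (fun y => if y ∈ Set.range x then 1 else 0)
  have h1 : ev (Q.minor i σ) = 1 := by
    rw [minor, RingHom.map_det]
    convert Matrix.det_one (n := Q.Row i) (R := ℂ)
    ext p q
    simp only [RingHom.mapMatrix_apply, Matrix.map_apply, Matrix.submatrix_apply, id_eq,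
      Matrix.one_apply]
    split_ifs with hpq
    · subst hpq
      rw [hx]
      simp only [ev, MvPolynomial.eval_X]
      exact if_pos (Set.mem_range_self p)
    · rcases A_entry i q (σ q) (x q) (hx q) p (σ q) with h0 | ⟨y, hy, _⟩
      · rw [h0]
        simp
      · rw [hy]
        have : y ∉ Set.range x := by
          rintro ⟨q', rfl⟩
          rcases A_entry i q' (σ q') (x q') (hx q') p (σ q) with h0 | ⟨y', hy', e'⟩
          · rw [h0] at hy
            exact absurd hy.symm (MvPolynomial.X_ne_zero _)
          · rw [hy] at hy'
            obtain ⟨a, b⟩ := e' (MvPolynomial.X_injective hy').symm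
            exact hpq (a.trans (σ.injective b).symm)
        simp only [ev, MvPolynomial.eval_X]
        exact if_neg this
  rw [h, map_zero] at h1
  exact zero_ne_one h1

end Nonvanishing

/-! ## The toric degeneration `Y(Q)` -/

/-- The structure morphism `Proj 𝒜 → Spec ℂ` of the `Proj` of an `ℕ`-graded `ℂ`-algebra. -/
noncomputable def projOver {R : Type} [CommRing R] [Algebra ℂ R] (𝒜 : ℕ → Submodule ℂ R)
    [GradedAlgebra 𝒜] : Over (Spec (.of ℂ)) :=
  Over.mk (Proj.toSpecZero 𝒜 ≫ Spec.map (CommRingCat.ofHom (algebraMap ℂ (𝒜 0))))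

/-- The affine scheme `Spec B` of a `ℂ`-algebra `B`, over `Spec ℂ`. -/
noncomputable def specOver (B : Type) [CommRing B] [Algebra ℂ B] : Over (Spec (.of ℂ)) :=
  Over.mk (Spec.map (CommRingCat.ofHom (algebraMap ℂ B)))

/-- The morphism `Spec B → Proj 𝒜` over `Spec ℂ` that is given by a homomorphism of algebras `φ` such
that the image of the irrelevant ideal generates the unit ideal. -/
noncomputable def specToProj {R B : Type} [CommRing R] [Algebra ℂ R] [CommRing B] [Algebra ℂ B]
    (𝒜 : ℕ → Submodule ℂ R) [GradedAlgebra 𝒜] (φ : R →ₐ[ℂ] B)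
    (hφ : (HomogeneousIdeal.irrelevant 𝒜).toIdeal.map
      (((Scheme.ΓSpecIso (.of B)).inv.hom).comp (φ : R →+* B)) = ⊤) :
    specOver B ⟶ projOver 𝒜 :=
  Over.homMk (Proj.fromOfGlobalSections 𝒜
    (((Scheme.ΓSpecIso (.of B)).inv.hom).comp (φ : R →+* B)) hφ) (by
      simp only [projOver, specOver, Over.mk_hom]
      rw [Proj.fromOfGlobalSections_toSpecZero_assoc, ← Spec.map_comp]
      have h : CommRingCat.ofHom (algebraMap ℂ (𝒜 0)) ≫
          CommRingCat.ofHom ((((Scheme.ΓSpecIso (.of B)).inv.hom).comp (φ : R →+* B)).comp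
              (algebraMap (𝒜 0) R)) =
          CommRingCat.ofHom (algebraMap ℂ B) ≫ (Scheme.ΓSpecIso (.of B)).inv := by
        ext z
        exact congrArg (Scheme.ΓSpecIso (.of B)).inv.hom (φ.commutes z)
      rw [h, Spec.map_comp]
      exact toSpecΓ_SpecMap_ΓSpecIso_inv_assoc _ _)

attribute [local instance] MvPolynomial.gradedAlgebra

/-- The projective space over `ℂ` with homogeneous coordinates indexed by `J`. -/
noncomputable def projectiveSpace (J : Type) : Over (Spec (.of ℂ)) :=
  projOver (MvPolynomial.homogeneousSubmodule J ℂ)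

/-- The ring of Laurent polynomials in the coordinates `x^{(v)}_{j,k}`. -/
abbrev Laurent : Type := AddMonoidAlgebra ℂ (Q.Coord →₀ ℤ)

/-- The torus with coordinate functions `x^{(v)}_{j,k}`. -/
noncomputable def torus : Over (Spec (.of ℂ)) :=
  specOver Q.Laurent

/-- A polynomial as a Laurent polynomial, that is, as a function on the torus. -/
noncomputable def toLaurent : MvPolynomial Q.Coord ℂ →ₐ[ℂ] Q.Laurent :=
  MvPolynomial.aeval fun x => AddMonoidAlgebra.single (Finsupp.single x 1) 1

/-- The homomorphism of algebras that takes the homogeneous coordinate `p_σ` to the initial term of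
the maximal minor of `A_i` with columns `σ`. -/
noncomputable def coordMap (i : Q.V) : MvPolynomial (Q.Plucker i) ℂ →ₐ[ℂ] Q.Laurent :=
  MvPolynomial.aeval fun σ => Q.toLaurent (Q.initialTerm i σ)

theorem isUnit_toLaurent_monomial (d : Q.Coord →₀ ℕ) {c : ℂ} (hc : c ≠ 0) :
    IsUnit (Q.toLaurent (MvPolynomial.monomial d c)) := by
  rw [MvPolynomial.monomial_eq, map_mul, ← MvPolynomial.algebraMap_eq, AlgHom.commutes]
  refine IsUnit.mul ((IsUnit.mk0 c hc).map _) ?_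
  rw [Finsupp.prod, map_prod]
  refine IsUnit.prod_iff.2 fun x _ => ?_
  rw [map_pow]
  refine IsUnit.pow _ ?_
  rw [toLaurent, MvPolynomial.aeval_X]
  refine IsUnit.of_mul_eq_one (AddMonoidAlgebra.single (-Finsupp.single x 1) 1) ?_
  rw [AddMonoidAlgebra.single_mul_single]
  simp [AddMonoidAlgebra.one_def]

theorem exists_isUnit_coordMap (i : Q.V) :
    ∃ σ : Q.Plucker i, IsUnit (Q.coordMap i (MvPolynomial.X σ)) := by
  obtain ⟨σ, hσ⟩ := exists_minor_ne_zero i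
  refine ⟨σ, ?_⟩
  rw [coordMap, MvPolynomial.aeval_X, initialTerm, MonomialOrder.leadingTerm]
  exact Q.isUnit_toLaurent_monomial _ (MonomialOrder.leadingCoeff_ne_zero_iff.2 hσ)

theorem irrelevant_map_coordMap (i : Q.V) :
    (HomogeneousIdeal.irrelevant
      (MvPolynomial.homogeneousSubmodule (Q.Plucker i) ℂ)).toIdeal.map
      (((Scheme.ΓSpecIso (.of Q.Laurent)).inv.hom).comp (Q.coordMap i : _ →+* Q.Laurent)) = ⊤ := by
  obtain ⟨σ, hσ⟩ := Q.exists_isUnit_coordMap i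
  refine Ideal.eq_top_of_isUnit_mem _ (Ideal.mem_map_of_mem _ ?_)
    (hσ.map (Scheme.ΓSpecIso (.of Q.Laurent)).inv.hom)
  change MvPolynomial.X σ ∈ HomogeneousIdeal.irrelevant _
  rw [HomogeneousIdeal.mem_irrelevant_iff, GradedRing.proj_apply]
  exact DirectSum.decompose_of_mem_ne _ (MvPolynomial.isHomogeneous_X ℂ σ) one_ne_zero

/-- The morphism from the torus to the projective space `ℙ^{N_i}` whose homogeneous coordinates are
the initial terms of the maximal minors of `A_i`. -/
noncomputable def torusToProjectiveSpace (i : Q.V) : Q.torus ⟶ projectiveSpace (Q.Plucker i) :=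
  specToProj (MvPolynomial.homogeneousSubmodule (Q.Plucker i) ℂ) (Q.coordMap i)
    (Q.irrelevant_map_coordMap i)

/-- The product of the projective spaces `ℙ^{N_i}` over `Spec ℂ`, over all non-source vertices `i`. -/
noncomputable def ambient : Over (Spec (.of ℂ)) :=
  ∏ᶜ fun i : {i : Q.V // i ≠ 0} => projectiveSpace (Q.Plucker i.1)

/-- The morphism from the torus to the product of the projective spaces `ℙ^{N_i}` that is given by
the initial terms of the maximal minors of all `A_i`. -/
noncomputable def torusMap : Q.torus ⟶ Q.ambient :=
  Limits.Pi.lift fun i : {i : Q.V // i ≠ 0} => Q.torusToProjectiveSpace i.1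

/-- The toric variety `Y(Q)` of the SAGBI degeneration of `M_Q`: the closure of the image of the torus
(with the reduced structure, since the torus is reduced) in the product of the projective spaces. -/
noncomputable def Y : Over (Spec (.of ℂ)) :=
  Over.mk (Q.torusMap.left.imageι ≫ Q.ambient.hom)

/-! ## The ladder diagram and the ladder quiver -/

/-- The width `sTilde i - r i` of the ladder diagram of `Gr(sTilde i, r i)`, whose height is `r i`. -/
def width (i : Q.V) : ℤ := (Q.sTilde i : ℤ) - Q.r i

/-- The unit squares (given by their lower left corners) that vertex `i` contributes to the ladder
diagram of its branch: a rectangle of height `r i` over the columns between the width of the previous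
vertex and the width of `i`, which are `s i - r i` columns. -/
def branchBoxes (i : Q.V) : Set (ℤ × ℤ) :=
  {P | Q.width i - ((Q.s i : ℤ) - Q.r i) ≤ P.1 ∧ P.1 < Q.width i ∧ 0 ≤ P.2 ∧ P.2 < Q.r i}

/-- The unit squares of the ladder diagram: those of the ladder diagram of vertex `1` and the branch
`S₁`, and those of the ladder diagram of the branch `S₂`, which is turned by half a turn so that its
origin is moved to `(sTilde 1 - r 1, r 1)`. -/
def boxes : Set (ℤ × ℤ) :=
  {P | (∃ i, (i = 1 ∨ i ∈ Q.S₁) ∧ P ∈ Q.branchBoxes i) ∨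
    ∃ i ∈ Q.S₂, (Q.width 1 - 1 - P.1, (Q.r 1 : ℤ) - 1 - P.2) ∈ Q.branchBoxes i}

/-- A point of the ladder diagram of the branch of `i` as a point of the whole diagram. -/
noncomputable def place (i : Q.V) (P : ℤ × ℤ) : ℤ × ℤ :=
  open scoped Classical in
  if i ∈ Q.S₂ then (Q.width 1 - P.1, (Q.r 1 : ℤ) - P.2) else P

/-- The external vertex `v_i`, `i ≥ 1`. -/
noncomputable def externalVertex (i : Q.V) : ℤ × ℤ := Q.place i (Q.width i, Q.r i)

/-- The points in the interior of the ladder diagram. -/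
def interiorPoints : Set (ℤ × ℤ) :=
  {P | (P.1, P.2) ∈ Q.boxes ∧ (P.1 - 1, P.2) ∈ Q.boxes ∧ (P.1, P.2 - 1) ∈ Q.boxes ∧
    (P.1 - 1, P.2 - 1) ∈ Q.boxes}

/-- The points where the boundaries of the rectangles of two consecutive vertices `p` and `i` of a
branch intersect. -/
def intersectionPoints : Set (ℤ × ℤ) :=
  {P | ∃ p i : Q.V, p ≠ 0 ∧ Q.n p i ≠ 0 ∧
    P = Q.place i (Q.width p, min (Q.r p : ℤ) (Q.r i))}

/-- The vertices of the ladder quiver. -/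
def vertices : Set (ℤ × ℤ) :=
  {(0, 0)} ∪ {P | ∃ i, i ≠ 0 ∧ P = Q.externalVertex i} ∪ Q.interiorPoints ∪ Q.intersectionPoints

/-- A unit step to the right or upwards along the side of a square of the ladder diagram. -/
def Step (P P' : ℤ × ℤ) : Prop :=
  (P' = (P.1 + 1, P.2) ∧ (P ∈ Q.boxes ∨ (P.1, P.2 - 1) ∈ Q.boxes)) ∨
    (P' = (P.1, P.2 + 1) ∧ (P ∈ Q.boxes ∨ (P.1 - 1, P.2) ∈ Q.boxes))

/-- The arrows of the ladder quiver: paths in the ladder diagram that go up and to the right, from one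
vertex to another, without a vertex in between. -/
structure Arrow where
  src : Q.vertices
  tgt : Q.vertices
  inner : List (ℤ × ℤ)
  isPath : List.IsChain Q.Step (src.1 :: inner ++ [tgt.1])
  inner_notMem : ∀ P ∈ inner, P ∉ Q.vertices

/-! ### Finiteness of the ladder quiver -/

theorem finite_branchBoxes (i : Q.V) : (Q.branchBoxes i).Finite := by
  refine (Set.finite_Icc ((Q.width i - ((Q.s i : ℤ) - Q.r i), 0) : ℤ × ℤ)
    (Q.width i, (Q.r i : ℤ))).subset ?_
  rintro ⟨x, y⟩ ⟨h1, h2, h3, h4⟩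
  exact ⟨⟨h1, h3⟩, ⟨h2.le, h4.le⟩⟩

theorem finite_boxes : Q.boxes.Finite := by
  have h1 : (⋃ i : Q.V, Q.branchBoxes i).Finite := Set.finite_iUnion Q.finite_branchBoxes
  have h2 : Function.Injective
      (fun P : ℤ × ℤ => (Q.width 1 - 1 - P.1, (Q.r 1 : ℤ) - 1 - P.2)) := by
    rintro ⟨a, b⟩ ⟨c, d⟩ h
    simp only [Prod.mk.injEq] at h
    ext <;> simp only <;> omega
  refine (h1.union (h1.preimage h2.injOn)).subset ?_
  rintro P (⟨i, _, h⟩ | ⟨i, _, h⟩)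
  · exact Or.inl (Set.mem_iUnion.2 ⟨i, h⟩)
  · exact Or.inr (Set.mem_iUnion.2 ⟨i, h⟩)

/-- The lower left, upper left and lower right corners of the squares. -/
def corners (Q : YShapedQuiver) : Set (ℤ × ℤ) :=
  {P | P ∈ Q.boxes ∨ (P.1, P.2 - 1) ∈ Q.boxes ∨ (P.1 - 1, P.2) ∈ Q.boxes}

theorem finite_corners : Q.corners.Finite := by
  have h1 : Function.Injective (fun P : ℤ × ℤ => (P.1, P.2 - 1)) := by
    rintro ⟨a, b⟩ ⟨c, d⟩ h
    simp only [Prod.mk.injEq] at h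
    ext <;> simp only <;> omega
  have h2 : Function.Injective (fun P : ℤ × ℤ => (P.1 - 1, P.2)) := by
    rintro ⟨a, b⟩ ⟨c, d⟩ h
    simp only [Prod.mk.injEq] at h
    ext <;> simp only <;> omega
  exact Q.finite_boxes.union
    ((Q.finite_boxes.preimage h1.injOn).union (Q.finite_boxes.preimage h2.injOn))

theorem finite_vertices : Q.vertices.Finite := by
  refine (((Set.finite_singleton _).union ?_).union ?_).union ?_
  · refine (Set.finite_range Q.externalVertex).subset ?_
    rintro P ⟨i, _, rfl⟩
    exact Set.mem_range_self i
  · exact Q.finite_boxes.subset fun P h => h.1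
  · refine (Set.finite_range
      (fun z : Q.V × Q.V => Q.place z.2 (Q.width z.1, min (Q.r z.1 : ℤ) (Q.r z.2)))).subset ?_
    rintro P ⟨p, i, _, _, rfl⟩
    exact ⟨(p, i), rfl⟩

instance : Finite Q.vertices := Q.finite_vertices

theorem Step.sum_lt {P P' : ℤ × ℤ} (h : Q.Step P P') : P.1 + P.2 < P'.1 + P'.2 := by
  rcases h with ⟨rfl, _⟩ | ⟨rfl, _⟩ <;> simp only <;> omega

theorem Step.mem_corners {P P' : ℤ × ℤ} (h : Q.Step P P') : P ∈ Q.corners := by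
  rcases h with ⟨_, h | h⟩ | ⟨_, h | h⟩
  · exact Or.inl h
  · exact Or.inr (Or.inl h)
  · exact Or.inl h
  · exact Or.inr (Or.inr h)

theorem chain_props (l : List (ℤ × ℤ)) (t : ℤ × ℤ) (h : List.IsChain Q.Step (l ++ [t])) :
    l.Nodup ∧ ∀ P ∈ l, P ∈ Q.corners := by
  constructor
  · have h1 : List.IsChain (fun P P' : ℤ × ℤ => P.1 + P.2 < P'.1 + P'.2) (l ++ [t]) :=
      h.imp fun _ _ hs => Step.sum_lt Q hs
    have : IsTrans (ℤ × ℤ) (fun P P' : ℤ × ℤ => P.1 + P.2 < P'.1 + P'.2) :=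
      ⟨fun _ _ _ a b => lt_trans a b⟩
    have h2 := (List.isChain_iff_pairwise.1 h1).sublist (List.sublist_append_left l [t])
    exact h2.imp fun {a b} hab e => by
      subst e
      exact lt_irrefl _ hab
  · induction l with
    | nil => simp
    | cons a l ih =>
      intro P hP
      rcases List.mem_cons.1 hP with rfl | hP
      · cases l with
        | nil => exact Step.mem_corners Q (List.isChain_cons_cons.1 h).1
        | cons b l => exact Step.mem_corners Q (List.isChain_cons_cons.1 h).1
      · exact ih h.tail P hP

instance : Finite Q.Arrow := by
  have : Finite Q.corners := Q.finite_corners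
  have := Fintype.ofFinite Q.corners
  classical
  have hp : ∀ a : Q.Arrow, a.inner.Nodup ∧ ∀ P ∈ a.inner, P ∈ Q.corners := fun a =>
    Q.chain_props a.inner a.tgt.1 a.isPath.tail
  refine Finite.of_injective
    (fun a : Q.Arrow => (a.src, a.tgt,
      (⟨a.inner.attachWith _ (hp a).2, ?_⟩ : {l : List Q.corners // l.Nodup}))) ?_
  · refine List.Nodup.of_map Subtype.val ?_
    rw [List.attachWith_map_subtype_val]
    exact (hp a).1
  · rintro a b h
    simp only [Prod.mk.injEq, Subtype.mk.injEq] at h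
    obtain ⟨h1, h2, h3⟩ := h
    have h4 := congrArg (List.map Subtype.val) h3
    rw [List.attachWith_map_subtype_val, List.attachWith_map_subtype_val] at h4
    cases a
    cases b
    simp only at h1 h2 h4
    subst h1 h2 h4
    rfl

noncomputable instance : Fintype Q.Arrow := Fintype.ofFinite _

end YShapedQuiver

/-! ## The toric GIT quotient `X(Q)` -/

section GIT

/-! A torus `K` with character lattice `M` acts on the affine space with coordinates `y_a`, `a ∈ I`,
with weights `D a`; `w` is a character of `K`. -/

variable {I M : Type} [AddCommGroup M] (D : I → M) (w : M)

/-- The semi-invariants of weight `k w`. -/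
noncomputable def semiInvariants (k : ℕ) : Submodule ℂ (MvPolynomial I ℂ) :=
  MvPolynomial.weightedHomogeneousSubmodule ℂ D (k • w)

/-- The ring `⨁_k ℂ[y_a]_{k w}` of semi-invariants, as the ring of those polynomials `∑_k f_k T^k` for
which `f_k` is a semi-invariant of weight `k w`. -/
noncomputable def semiInvariantRing : Subalgebra ℂ (Polynomial (MvPolynomial I ℂ)) where
  carrier := {f | ∀ k, f.coeff k ∈ semiInvariants D w k}
  mul_mem' := by
    intro f g hf hg k
    rw [Polynomial.coeff_mul]
    refine Submodule.sum_mem _ fun ij hij => ?_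
    have h := (hf ij.1).mul (hg ij.2)
    rw [← add_smul, Finset.HasAntidiagonal.mem_antidiagonal.1 hij] at h
    exact h
  add_mem' := by
    intro f g hf hg k
    rw [Polynomial.coeff_add]
    exact Submodule.add_mem _ (hf k) (hg k)
  algebraMap_mem' := by
    intro c k
    rw [Polynomial.algebraMap_apply, Polynomial.coeff_C]
    split_ifs with h
    · subst h
      rw [MvPolynomial.algebraMap_eq]
      change MvPolynomial.IsWeightedHomogeneous _ _ _
      rw [zero_smul]
      exact MvPolynomial.isWeightedHomogeneous_C D c
    · exact Submodule.zero_mem _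

/-- The part of degree `k` of the ring of semi-invariants. -/
noncomputable def semiInvariantGrading (k : ℕ) : Submodule ℂ (semiInvariantRing D w) where
  carrier := {f | ∀ l, l ≠ k → f.1.coeff l = 0}
  add_mem' := by
    intro f g hf hg l hl
    change (f.1 + g.1).coeff l = 0
    rw [Polynomial.coeff_add, hf l hl, hg l hl, add_zero]
  zero_mem' := fun l _ => Polynomial.coeff_zero l
  smul_mem' := by
    intro c f hf l hl
    change (c • f.1).coeff l = 0
    rw [Polynomial.coeff_smul, hf l hl, smul_zero]

/-- The component of degree `k`. -/
noncomputable def semiInvariantComponent (k : ℕ) (f : semiInvariantRing D w) :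
    semiInvariantGrading D w k :=
  ⟨⟨Polynomial.monomial k (f.1.coeff k), fun l => by
    rw [Polynomial.coeff_monomial]
    split_ifs with h
    · subst h
      exact f.2 k
    · exact Submodule.zero_mem _⟩, fun l hl => by
    change (Polynomial.monomial k (f.1.coeff k)).coeff l = 0
    rw [Polynomial.coeff_monomial, if_neg (Ne.symm hl)]⟩

theorem semiInvariantComponent_of_mem {k l : ℕ} {f : semiInvariantRing D w}
    (hf : f ∈ semiInvariantGrading D w l) (h : l ≠ k) : semiInvariantComponent D w k f = 0 := by
  apply Subtype.ext
  apply Subtype.ext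
  change Polynomial.monomial k (f.1.coeff k) = 0
  rw [hf k h.symm, map_zero]

theorem semiInvariantComponent_self {k : ℕ} (f : semiInvariantGrading D w k) :
    semiInvariantComponent D w k f.1 = f := by
  apply Subtype.ext
  apply Subtype.ext
  change Polynomial.monomial k (f.1.1.coeff k) = f.1.1
  ext1 l
  rw [Polynomial.coeff_monomial]
  split_ifs with h
  · subst h
    rfl
  · exact (f.2 l (Ne.symm h)).symm

theorem semiInvariantComponent_add (k : ℕ) (f g : semiInvariantRing D w) :
    semiInvariantComponent D w k (f + g) =
      semiInvariantComponent D w k f + semiInvariantComponent D w k g := by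
  apply Subtype.ext
  apply Subtype.ext
  change Polynomial.monomial k ((f.1 + g.1).coeff k) =
    Polynomial.monomial k (f.1.coeff k) + Polynomial.monomial k (g.1.coeff k)
  rw [Polynomial.coeff_add, map_add]

noncomputable instance : GradedAlgebra (semiInvariantGrading D w) := by
  classical
  exact
  { one_mem := fun l hl => by
      change (1 : Polynomial (MvPolynomial I ℂ)).coeff l = 0
      rw [Polynomial.coeff_one, if_neg hl]
    mul_mem := fun {i j f g} hf hg l hl => by
      change (f.1 * g.1).coeff l = 0
      rw [Polynomial.coeff_mul]
      refine Finset.sum_eq_zero fun ab hab => ?_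
      by_cases ha : ab.1 = i
      · by_cases hb : ab.2 = j
        · rw [Finset.HasAntidiagonal.mem_antidiagonal, ha, hb] at hab
          exact absurd hab.symm hl
        · rw [hg _ hb, mul_zero]
      · rw [hf _ ha, zero_mul]
    decompose' := fun f => ∑ k ∈ f.1.support,
      DirectSum.of (fun k => semiInvariantGrading D w k) k (semiInvariantComponent D w k f)
    left_inv := fun f => by
      simp only [map_sum, DirectSum.coeAddMonoidHom_of]
      apply Subtype.ext
      rw [AddSubmonoidClass.coe_finsetSum]
      exact f.1.sum_monomial_eq
    right_inv := fun x => by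
      have h1 : ∀ k, semiInvariantComponent D w k
          (DirectSum.coeAddMonoidHom (semiInvariantGrading D w) x) = x k := by
        intro k
        induction x using DirectSum.induction_on with
        | zero =>
          apply Subtype.ext
          apply Subtype.ext
          rw [map_zero]
          change Polynomial.monomial k ((0 : Polynomial (MvPolynomial I ℂ)).coeff k) = 0
          rw [Polynomial.coeff_zero, map_zero]
        | of i z =>
          rw [DirectSum.coeAddMonoidHom_of]
          by_cases h : i = k
          · subst h
            rw [semiInvariantComponent_self, DirectSum.of_eq_same]
          · rw [semiInvariantComponent_of_mem D w z.2 h, DirectSum.of_eq_of_ne _ _ _ (Ne.symm h)]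
        | add x y hx hy => rw [map_add, semiInvariantComponent_add, hx, hy, DirectSum.add_apply]
      refine DFinsupp.ext fun l => ?_
      rw [← h1 l]
      generalize DirectSum.coeAddMonoidHom (semiInvariantGrading D w) x = f
      change (∑ k ∈ f.1.support, DirectSum.of (fun k => semiInvariantGrading D w k) k
        (semiInvariantComponent D w k f) : DirectSum ℕ _) l = _
      rw [DFinsupp.finsetSum_apply]
      by_cases hl : l ∈ f.1.support
      · rw [Finset.sum_eq_single l]
        · exact DirectSum.of_eq_same _ _
        · intro k _ hk
          exact DirectSum.of_eq_of_ne _ _ _ (Ne.symm hk)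
        · exact fun h => absurd hl h
      · rw [Finset.sum_eq_zero]
        · apply Subtype.ext
          apply Subtype.ext
          change 0 = Polynomial.monomial l (f.1.coeff l)
          rw [Polynomial.notMem_support_iff.1 hl, map_zero]
        · intro k hk
          refine DirectSum.of_eq_of_ne _ _ _ ?_
          rintro rfl
          exact hl hk }

/-- The GIT quotient `Proj (⨁_k ℂ[y_a]_{k w})` of the affine space by the torus, with stability condition
`w`. -/
noncomputable def toricGITQuotient : Over (Spec (.of ℂ)) :=
  YShapedQuiver.projOver (R := semiInvariantRing D w) (semiInvariantGrading D w)

end GIT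

namespace YShapedQuiver

variable (Q : YShapedQuiver)

/-- The character lattice of the torus acting on the representations of the ladder quiver with dimension
vector `1`: it has a standard basis indexed by the vertices other than `(0, 0)`. -/
abbrev CharacterLattice : Type := {P : Q.vertices // P.1 ≠ (0, 0)} → ℤ

/-- The standard basis of the character lattice, with `0` for the vertex `(0, 0)`. -/
def e (P : Q.vertices) : Q.CharacterLattice := fun P' => if P'.1.1 = P.1 then 1 else 0

/-- The weight of an arrow of the ladder quiver. -/
def arrowWeight (a : Q.Arrow) : Q.CharacterLattice := Q.e a.tgt - Q.e a.src

/-- The toric variety `X(Q)` of the ladder quiver: the GIT quotient whose stability condition is the sum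
of the weights of all arrows. -/
noncomputable def X : Over (Spec (.of ℂ)) :=
  toricGITQuotient Q.arrowWeight (∑ a, Q.arrowWeight a)

end YShapedQuiver

/-! Both varieties are governed by lattice paths in the ladder diagram. The initial term of a
nonzero maximal minor of `A_i` is the product of its diagonal entries. If the rows of the matrices
are matched with the columns of the diagram, and coordinates with its horizontal edges, this product
runs over the horizontal edges of a lattice path from a source point to a target point that depend
on `i` only. All such paths occur (`toLaurent_initialTerm`, `exists_valid_of_heights`), and the
other minors vanish identically.

On the side of the ladder quiver, a monomial in the arrows is a flow on the edges of the diagram,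
and its weight is the boundary of this flow. A point that is not a vertex has a forced exit
(merging) or a forced entry (splitting). An arrow therefore contains exactly one private edge, which
lies on no other arrow, and flows on arrows are the same as flows on edges with sources and sinks at
the vertices (`IsForked.flow_privateEdge`, `IsForked.flow_arrowFlow`).

Let `θ i` be the weight of the lattice paths of `i`. Three facts, collected in `IsToricEmbedding`,
carry the proof. (1) A monomial is determined by its weight and its flow through the horizontal
edges (`eq_of_horizontal_eq`). (2) Every monomial of weight `∑ i, n i • θ i` is a product of `n i`
path monomials for each `i`: a lattice path along the lowest edges of the flow can be split off
repeatedly (`IsFlow.exists_pathFlow_le`). (3) The stability condition is `∑ i, (s i - s'_i) • θ i`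
(`sum_weight_eq_sum_pathWeight`), and the Fano condition makes all coefficients positive. For this a
potential on the points of the diagram is used that extends the standard basis of the character
lattice and changes along an arrow only at its private edge. The sum over all arrows becomes a
telescoping sum over all edges.

The geometric conclusion is formal. By (1) the semi-invariants of each degree embed into the Laurent
polynomials, so that `Proj` is reduced and the torus is dense in it. Products of path monomials are
sections of degree one. By (2) their basic open sets cover `Proj`, and the functions there are
generated by ratios of path monomials. Positivity of the coefficients makes these ratios regular and
identifies the basic open sets with the preimages of the products of standard charts. Hence `Proj`
is a closed subscheme of the product of the projective spaces, and it is the image closure of the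
torus. -/

open CategoryTheory AlgebraicGeometry

/-! ### Morphisms from an affine scheme into one chart of `Proj` -/

section AwayLift

open HomogeneousLocalization

variable {A B : Type} [CommRing A] [Algebra ℂ A] [CommRing B]
  (𝒜 : ℕ → Submodule ℂ A) [GradedAlgebra 𝒜]

/-- The homomorphism from the degree zero part of `A_r` that is induced by a homomorphism of rings
which maps `r` to a unit. -/
noncomputable def awayLift (φ : A →+* B) {r : A} (hr : IsUnit (φ r)) : Away 𝒜 r →+* B :=
  (IsLocalization.Away.lift (S := Localization.Away r) r hr).comp
    (algebraMap (Away 𝒜 r) (Localization.Away r))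

/-- Clearing the denominator characterizes the value at a fraction by an equation in `B`, so that no
inverse of `φ r` has to be written. -/
theorem awayLift_mk_mul (φ : A →+* B) {r : A} (hr : IsUnit (φ r)) {d : ℕ} (hd : r ∈ 𝒜 d) (n : ℕ)
    (a : A) (ha : a ∈ 𝒜 (n • d)) :
    awayLift 𝒜 φ hr (Away.mk 𝒜 hd n a ha) * φ r ^ n = φ a := by
  rw [awayLift, RingHom.comp_apply, HomogeneousLocalization.algebraMap_apply, Away.val_mk,
    Localization.mk_eq_mk', ← map_pow,
    ← IsLocalization.Away.lift_eq (S := Localization.Away r) r hr (r ^ n), ← map_mul]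
  erw [IsLocalization.mk'_spec]
  rw [IsLocalization.Away.lift_eq]

theorem isoOfEq_inv_morphismRestrict_ι {X Y : Scheme.{0}} (f : X ⟶ Y) (U : Y.Opens) (V : X.Opens)
    (h : f ⁻¹ᵁ U = V) : (X.isoOfEq h).inv ≫ (f ∣_ U) ≫ U.ι = V.ι ≫ f := by
  subst h
  simp [morphismRestrict_ι]

theorem toSpecΓ_morphismRestrict_basicOpen (X : Scheme.{0}) (x : Γ(X, ⊤)) :
    ((X.isoOfEq (X.toSpecΓ_preimage_basicOpen x)).inv ≫ X.toSpecΓ ∣_ PrimeSpectrum.basicOpen x) ≫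
      (basicOpenIsoSpecAway x).hom ≫
      Spec.map (CommRingCat.ofHom (algebraMap Γ(X, ⊤) (Localization.Away x))) =
    (X.basicOpen x).ι ≫ X.toSpecΓ := by
  rw [basicOpenIsoSpecAway_hom_SpecMap, Category.assoc]
  exact isoOfEq_inv_morphismRestrict_ι _ _ _ _

/-- As `φ r` is a unit, its basic open set in `Spec B` is everything, and the description of the
morphism over this single chart determines it. Comparisons of morphisms out of `Spec B` thereby
become comparisons of ring homomorphisms. -/
theorem fromOfGlobalSections_eq_awayι (φ : A →+* B) {r : A} (hr : IsUnit (φ r)) {d : ℕ}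
    (hd : r ∈ 𝒜 d) (h0 : 0 < d)
    (hφ : (HomogeneousIdeal.irrelevant 𝒜).toIdeal.map
      (((Scheme.ΓSpecIso (.of B)).inv.hom).comp φ) = ⊤) :
    Proj.fromOfGlobalSections 𝒜 (((Scheme.ΓSpecIso (.of B)).inv.hom).comp φ) hφ =
      Spec.map (CommRingCat.ofHom (awayLift 𝒜 φ hr)) ≫ Proj.awayι 𝒜 r hd h0 := by
  set f := ((Scheme.ΓSpecIso (.of B)).inv.hom).comp φ with hf
  have hu : IsUnit (f r) := hr.map (Scheme.ΓSpecIso (.of B)).inv.hom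
  have htop : (Spec (.of B)).basicOpen (f r) = ⊤ := Scheme.basicOpen_of_isUnit _ hu
  have : IsIso ((Spec (.of B)).basicOpen (f r)).ι := by
    rw [htop]
    exact inferInstanceAs (IsIso (Scheme.topIso _).hom)
  rw [← cancel_epi ((Spec (.of B)).basicOpen (f r)).ι]
  have h2 := congrArg (· ≫ (Proj.basicOpen 𝒜 r).ι)
    (Proj.fromOfGlobalSections_resLE 𝒜 f hφ h0 hd)
  simp only [Scheme.Hom.resLE_comp_ι] at h2
  rw [h2, Proj.toBasicOpenOfGlobalSections]
  simp only [Category.assoc, Proj.basicOpenIsoSpec_inv_ι]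
  simp only [← Category.assoc]
  congr 1
  have h3 : (IsLocalization.map (Localization.Away (f r)) (M := .powers r) (T := .powers (f r)) f
        (Submonoid.map_le_iff_le_comap.1 (Submonoid.map_powers f r).le)).comp
        (algebraMap (Away 𝒜 r) (Localization.Away r)) =
      ((algebraMap _ (Localization.Away (f r))).comp (Scheme.ΓSpecIso (.of B)).inv.hom).comp
        (awayLift 𝒜 φ hr) := by
    rw [awayLift, ← RingHom.comp_assoc]
    congr 1
    refine IsLocalization.ringHom_ext (Submonoid.powers r) ?_
    ext x
    simp [hf]
  have h4 : (Spec (.of B)).toSpecΓ ≫ Spec.map (Scheme.ΓSpecIso (.of B)).inv = 𝟙 _ := by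
    simp
  rw [h3, CommRingCat.ofHom_comp, Spec.map_comp, CommRingCat.ofHom_comp, Spec.map_comp]
  have h5 := toSpecΓ_morphismRestrict_basicOpen (Spec (.of B)) (f r)
  have h6 := congrArg (· ≫ Spec.map (Scheme.ΓSpecIso (.of B)).inv ≫
    Spec.map (CommRingCat.ofHom (awayLift 𝒜 φ hr))) h5
  simp only [Category.assoc] at h6
  rw [reassoc_of% h4] at h6
  simp only [Category.assoc]
  exact h6

end AwayLift

/-! ### Gluing morphisms out of `Proj` that agree on `Spec B` -/

section Glue

open HomogeneousLocalization

variable {A B : Type} [CommRing A] [Algebra ℂ A] [CommRing B]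
  (𝒜 : ℕ → Submodule ℂ A) [GradedAlgebra 𝒜]

/-- A fraction has a homogeneous numerator, so injectivity of `φ` on homogeneous elements is enough.
-/
theorem awayLift_injective (φ : A →+* B) (hφ : ∀ k, ∀ a ∈ 𝒜 k, φ a = 0 → a = 0) {r : A}
    (hr : IsUnit (φ r)) {d : ℕ} (hd : r ∈ 𝒜 d) : Function.Injective (awayLift 𝒜 φ hr) := by
  rw [injective_iff_map_eq_zero]
  intro z hz
  obtain ⟨n, a, ha, rfl⟩ := Away.mk_surjective 𝒜 hd z
  have h := awayLift_mk_mul 𝒜 φ hr hd n a ha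
  rw [hz, zero_mul] at h
  obtain rfl := hφ _ a ha h.symm
  exact mk_eq_zero_of_num _ rfl

theorem awayLift_comp_awayMap (φ : A →+* B) {r g x : A} (hr : IsUnit (φ r)) {d : ℕ} (hg : g ∈ 𝒜 d)
    (hx : x = r * g) (hu : IsUnit (φ x)) :
    (awayLift 𝒜 φ hu).comp (awayMap 𝒜 hg hx) = awayLift 𝒜 φ hr := by
  ext z
  simp only [awayLift, RingHom.comp_apply, HomogeneousLocalization.algebraMap_apply]
  rw [val_awayMap, ← RingHom.comp_apply]
  congr 1
  refine IsLocalization.ringHom_ext (Submonoid.powers r) ?_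
  ext x
  simp

theorem isDominant_specMap {R R' : Type} [CommRing R] [CommRing R'] (f : R →+* R')
    (hf : Function.Injective f) : IsDominant (Spec.map (CommRingCat.ofHom f)) := by
  refine isDominant_of_of_appTop_injective ?_
  have h := Scheme.ΓSpecIso_inv_naturality (CommRingCat.ofHom f)
  have h1 : (Spec.map (CommRingCat.ofHom f)).appTop =
      (Scheme.ΓSpecIso (.of R)).hom ≫ CommRingCat.ofHom f ≫ (Scheme.ΓSpecIso (.of R')).inv := by
    rw [h, Iso.hom_inv_id_assoc]
  rw [h1]
  exact ((ConcreteCategory.bijective_of_isIso (Scheme.ΓSpecIso (.of R')).inv).1.comp hf).comp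
    (ConcreteCategory.bijective_of_isIso (Scheme.ΓSpecIso (.of R)).hom).1

/-- On the overlap of two charts both morphisms restrict to `t`. The coordinate ring of the overlap
embeds into the domain `B`, so the overlap is reduced and `Spec B` is dense in it. As `Z` is
separated, the morphisms agree. -/
theorem exists_glue [IsDomain B] (φ : A →+* B) (hφ : ∀ k, ∀ a ∈ 𝒜 k, φ a = 0 → a = 0)
    {κ : Type} (f : κ → A) (d : ℕ) (h0 : 0 < d) (hf : ∀ k, f k ∈ 𝒜 d)
    (hu : ∀ k, IsUnit (φ (f k)))
    (hcov : ∀ x : Proj 𝒜, ∃ k, x ∈ Proj.basicOpen 𝒜 (f k)) {Z : Scheme.{0}} [Z.IsSeparated]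
    (h : ∀ k, Spec (.of (Away 𝒜 (f k))) ⟶ Z) (t : Spec (.of B) ⟶ Z)
    (ht : ∀ k, Spec.map (CommRingCat.ofHom (awayLift 𝒜 φ (hu k))) ≫ h k = t) :
    ∃ F : Proj 𝒜 ⟶ Z, ∀ k, Proj.awayι 𝒜 (f k) (hf k) h0 ≫ F = h k := by
  choose idx hidx using hcov
  let 𝒰 : (Proj 𝒜).AffineOpenCover :=
    { I₀ := κ
      X := fun k => .of (Away 𝒜 (f k))
      f := fun k => Proj.awayι 𝒜 (f k) (hf k) h0
      idx := idx
      covers := fun x => by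
        change x ∈ (Proj.awayι 𝒜 _ _ _).opensRange
        rw [Proj.opensRange_awayι]
        exact hidx x }
  have hglue : ∀ x y : κ, Limits.pullback.fst (Proj.awayι 𝒜 (f x) (hf x) h0)
      (Proj.awayι 𝒜 (f y) (hf y) h0) ≫ h x = Limits.pullback.snd _ _ ≫ h y := by
    intro x y
    rw [← cancel_epi (Proj.pullbackAwayιIso 𝒜 (hf x) h0 (hf y) h0 rfl).inv,
      Proj.pullbackAwayιIso_inv_fst_assoc, Proj.pullbackAwayιIso_inv_snd_assoc]
    have huu : IsUnit (φ (f x * f y)) := by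
      rw [map_mul]
      exact (hu x).mul (hu y)
    have hinj := awayLift_injective 𝒜 φ hφ huu (SetLike.mul_mem_graded (hf x) (hf y))
    have : IsDomain (Away 𝒜 (f x * f y)) := hinj.isDomain
    have := isDominant_specMap _ hinj
    refine ext_of_isDominant (Spec.map (CommRingCat.ofHom (awayLift 𝒜 φ huu))) ?_
    rw [← Spec.map_comp_assoc, ← Spec.map_comp_assoc, ← CommRingCat.ofHom_comp,
      ← CommRingCat.ofHom_comp, awayLift_comp_awayMap 𝒜 φ (hu x) (hf y) _ huu, ht,
      awayLift_comp_awayMap 𝒜 φ (hu y) (hf x) _ huu, ht]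
  refine ⟨𝒰.openCover.glueMorphisms h hglue, fun k => ?_⟩
  exact 𝒰.openCover.ι_glueMorphisms h hglue k

end Glue

/-! ### Affine open sets in products over an affine base -/

section AffineProducts

open Limits

/-- The product over `S` is a limit in the category of schemes of the wide pullback diagram of the
structure morphisms, and a limit of affine schemes is affine. -/
theorem isAffine_left_piObj {S : Scheme.{0}} [IsAffine S] {I : Type} [Finite I] (Z : I → Over S)
    [∀ i, IsAffine (Z i).left] : IsAffine (∏ᶜ Z).left := by
  let F := Discrete.functor Z
  let e := Over.ConstructProducts.conesEquiv S F
  have hl : IsLimit (e.inverse.obj (limit.cone F)) :=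
    (IsLimit.ofConeEquiv e.symm).symm (limit.isLimit F)
  have : ∀ i, IsAffine ((Over.ConstructProducts.widePullbackDiagramOfDiagramOver S F).obj i) := by
    rintro (_ | i)
    · assumption
    · exact inferInstanceAs (IsAffine (Z i).left)
  exact Scheme.isAffine_of_isLimit _ hl

/-- The intersection of the preimages is the product of the charts `C i`, by a pair of mutually
inverse morphisms, and this product is affine. -/
theorem isAffineOpen_iInf_preimage {S : Scheme.{0}} [IsAffine S] {I : Type} [Finite I]
    (Z C : I → Over S) (j : ∀ i, C i ⟶ Z i) [∀ i, IsAffine (C i).left]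
    [∀ i, IsOpenImmersion (j i).left] :
    IsAffineOpen (⨅ i, (Pi.π Z i).left ⁻¹ᵁ (j i).left.opensRange) := by
  set W : (∏ᶜ Z).left.Opens := ⨅ i, (Pi.π Z i).left ⁻¹ᵁ (j i).left.opensRange with hW
  have hle : ∀ i, W ≤ (Pi.π Z i).left ⁻¹ᵁ (j i).left.opensRange := fun i => iInf_le _ i
  have hmem : ∀ z : (∏ᶜ Z).left, (∀ i, (Pi.π Z i).left z ∈ Set.range (j i).left) → z ∈ W := by
    intro z hz
    have := Fintype.ofFinite I
    rw [hW, ← Finset.inf_univ_eq_iInf, ← SetLike.mem_coe, TopologicalSpace.Opens.coe_finset_inf,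
      Finset.inf_eq_iInf]
    simpa using hz
  let Wo : Over S := Over.mk (W.ι ≫ (∏ᶜ Z).hom)
  let ι : Wo ⟶ ∏ᶜ Z := Over.homMk W.ι rfl
  have h1 : ∀ i, Set.range (ι ≫ Pi.π Z i).left ⊆ Set.range (j i).left := by
    rintro i _ ⟨x, rfl⟩
    exact hle i x.2
  let a : Wo ⟶ ∏ᶜ C := Pi.lift fun i =>
    Over.homMk (IsOpenImmersion.lift (j i).left (ι ≫ Pi.π Z i).left (h1 i)) (by
      rw [← Over.w (j i), IsOpenImmersion.lift_fac_assoc, Over.w])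
  have ha : a ≫ Limits.Pi.map j = ι := by
    refine Pi.hom_ext _ _ fun i => ?_
    rw [Category.assoc, Limits.Pi.map_π, Pi.lift_π_assoc]
    ext1
    exact IsOpenImmersion.lift_fac _ _ _
  have h2 : Set.range (Limits.Pi.map j).left ⊆ Set.range ι.left := by
    rintro _ ⟨x, rfl⟩
    have : (Limits.Pi.map j).left x ∈ W := by
      refine hmem _ fun i => ⟨(Pi.π C i).left x, ?_⟩
      rw [← Scheme.Hom.comp_apply, ← Scheme.Hom.comp_apply, ← Over.comp_left, ← Over.comp_left,
        Limits.Pi.map_π]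
    exact ⟨⟨_, this⟩, rfl⟩
  have : IsOpenImmersion ι.left := inferInstanceAs (IsOpenImmersion W.ι)
  let b : ∏ᶜ C ⟶ Wo := Over.homMk (IsOpenImmersion.lift ι.left (Limits.Pi.map j).left h2) (by
      rw [← Over.w ι, IsOpenImmersion.lift_fac_assoc, Over.w])
  have hb : b ≫ ι = Limits.Pi.map j := by
    refine Over.OverMorphism.ext ?_
    exact IsOpenImmersion.lift_fac ι.left _ _
  have hab : a ≫ b = 𝟙 _ := by
    ext1
    rw [← cancel_mono ι.left, ← Over.comp_left, Category.assoc, hb, ha, ← Over.comp_left,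
      Category.id_comp]
  have hba : b ≫ a = 𝟙 _ := by
    refine Pi.hom_ext _ _ fun i => ?_
    ext1
    rw [← cancel_mono (j i).left, ← Over.comp_left, ← Over.comp_left, Category.assoc,
      Category.assoc, ← Limits.Pi.map_π, reassoc_of% ha, reassoc_of% hb, Category.id_comp, Limits.Pi.map_π]
  have := isAffine_left_piObj C
  have hiso : IsIso a.left := ⟨b.left, by rw [← Over.comp_left, hab]; rfl,
    by rw [← Over.comp_left, hba]; rfl⟩
  exact IsAffine.of_isIso a.left

end AffineProducts

/-! ### Reducedness of `Proj` and density of `Spec B` -/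

section ProjGeneral

open HomogeneousLocalization

variable {A B : Type} [CommRing A] [Algebra ℂ A] [CommRing B]
  (𝒜 : ℕ → Submodule ℂ A) [GradedAlgebra 𝒜]

theorem exists_awayι_apply_eq {r : A} {d : ℕ} (hd : r ∈ 𝒜 d) (h0 : 0 < d) {x : Proj 𝒜}
    (hx : x ∈ Proj.basicOpen 𝒜 r) : ∃ z, Proj.awayι 𝒜 r hd h0 z = x := by
  rw [← Proj.opensRange_awayι 𝒜 r hd h0] at hx
  exact hx

/-- Every point lies in a chart whose coordinate ring is a subring of the domain `B`. Reducedness is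
read off from the stalks. -/
theorem isReduced_proj [IsDomain B] (φ : A →+* B) (hφ : ∀ k, ∀ a ∈ 𝒜 k, φ a = 0 → a = 0)
    {κ : Type} (f : κ → A) (d : ℕ) (h0 : 0 < d) (hf : ∀ k, f k ∈ 𝒜 d)
    (hu : ∀ k, IsUnit (φ (f k)))
    (hcov : ∀ x : Proj 𝒜, ∃ k, x ∈ Proj.basicOpen 𝒜 (f k)) : IsReduced (Proj 𝒜) := by
  have h : ∀ x : Proj 𝒜, _root_.IsReduced ((Proj 𝒜).presheaf.stalk x) := by
    intro x
    obtain ⟨k, hk⟩ := hcov x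
    obtain ⟨z, rfl⟩ := exists_awayι_apply_eq 𝒜 (hf k) h0 hk
    have : IsDomain (Away 𝒜 (f k)) := (awayLift_injective 𝒜 φ hφ (hu k) (hf k)).isDomain
    have e := (asIso ((Proj.awayι 𝒜 (f k) (hf k) h0).stalkMap z)).commRingCatIsoToRingEquiv
    exact isReduced_of_injective e.toRingHom e.injective
  exact isReduced_of_isReduced_stalk _

/-- Density can be tested in the charts, where it is the injectivity of `awayLift`. -/
theorem isDominant_toProj (φ : A →+* B) (hφ : ∀ k, ∀ a ∈ 𝒜 k, φ a = 0 → a = 0)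
    {κ : Type} (f : κ → A) (d : ℕ) (h0 : 0 < d) (hf : ∀ k, f k ∈ 𝒜 d)
    (hu : ∀ k, IsUnit (φ (f k)))
    (hcov : ∀ x : Proj 𝒜, ∃ k, x ∈ Proj.basicOpen 𝒜 (f k)) (t : Spec (.of B) ⟶ Proj 𝒜)
    (ht : ∀ k, t = Spec.map (CommRingCat.ofHom (awayLift 𝒜 φ (hu k))) ≫
      Proj.awayι 𝒜 (f k) (hf k) h0) : IsDominant t := by
  refine ⟨dense_iff_inter_open.2 fun U hU ⟨x, hx⟩ => ?_⟩
  obtain ⟨k, hk⟩ := hcov x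
  obtain ⟨z, rfl⟩ := exists_awayι_apply_eq 𝒜 (hf k) h0 hk
  have hd := isDominant_specMap _ (awayLift_injective 𝒜 φ hφ (hu k) (hf k))
  obtain ⟨_, hy, ⟨y, rfl⟩⟩ := dense_iff_inter_open.1 hd.denseRange _
    (hU.preimage (Proj.awayι 𝒜 (f k) (hf k) h0).continuous) ⟨z, hx⟩
  refine ⟨t y, ?_, ⟨y, rfl⟩⟩
  rw [ht k]
  exact hy

end ProjGeneral

/-! ### Scheme-theoretic images -/

section ClosedImmersion

/-- If a morphism over `S` is the composition of a dominant morphism to a reduced scheme `X` and a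
closed immersion, then its scheme-theoretic image is isomorphic to `X`. -/
theorem nonempty_image_iso {S : Scheme.{0}} {T X P : Over S} (t : T ⟶ X) (F : X ⟶ P)
    [IsReduced X.left] [IsDominant t.left] [IsClosedImmersion F.left] :
    Nonempty (Over.mk ((t ≫ F).left.imageι ≫ P.hom) ≅ X) := by
  have := IsSchemeTheoreticallyDominant.of_isDominant t.left
  -- A dominant morphism to a reduced scheme is schematically dominant, so it does not change the
  -- kernel. Closed immersions with the same kernel are isomorphic.
  have hk : (t ≫ F).left.imageι.ker = F.left.ker := by
    rw [Scheme.IdealSheafData.ker_subschemeι, Over.comp_left, Scheme.Hom.ker_comp,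
      t.left.ker_eq_bot, Scheme.IdealSheafData.map_bot]
  have := IsClosedImmersion.isIso_lift F.left (t ≫ F).left.imageι hk.symm
  refine ⟨Over.isoMk (asIso (IsClosedImmersion.lift F.left (t ≫ F).left.imageι hk.ge.ge)) ?_⟩
  rw [asIso_hom, ← Over.w F, IsClosedImmersion.lift_fac_assoc]
  rfl

end ClosedImmersion

/-! ### A criterion for `Proj` to map to a product of `Proj`s -/

section ProductEmbedding

open HomogeneousLocalization YShapedQuiver

attribute [local instance] MvPolynomial.gradedAlgebra

theorem exists_factor {R R' B : Type} [CommRing R] [CommRing R'] [CommRing B] (a : R →+* B)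
    (b : R' →+* B) (hb : Function.Injective b) (h : a.range ≤ b.range) :
    ∃ g : R →+* R', b.comp g = a := by
  let e := RingEquiv.ofBijective b.rangeRestrict
    ⟨fun x y hxy => hb (congrArg Subtype.val hxy), b.rangeRestrict_surjective⟩
  refine ⟨(e.symm : b.range →+* R').comp ((Subring.inclusion h).comp a.rangeRestrict), ?_⟩
  ext x
  have : e (e.symm (Subring.inclusion h (a.rangeRestrict x))) = _ := e.apply_symm_apply _
  exact congrArg Subtype.val this

theorem mvPolynomial_exists_mem_basicOpen {J : Type}
    (x : Proj (MvPolynomial.homogeneousSubmodule J ℂ)) :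
    ∃ j, x ∈ Proj.basicOpen (MvPolynomial.homogeneousSubmodule J ℂ) (MvPolynomial.X j) := by
  have h := Proj.iSup_basicOpen_eq_top' (MvPolynomial.homogeneousSubmodule J ℂ)
    (fun j => MvPolynomial.X j) (fun j => ⟨1, MvPolynomial.isHomogeneous_X ℂ j⟩) (by
      rw [eq_top_iff]
      intro p _
      have hp : p ∈ Algebra.adjoin ℂ (Set.range (MvPolynomial.X (R := ℂ) (σ := J))) := by
        rw [MvPolynomial.adjoin_range_X]
        trivial
      induction hp using Algebra.adjoin_induction with
      | mem x hx => exact Algebra.subset_adjoin hx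
      | algebraMap r =>
        exact Subalgebra.algebraMap_mem _
          (algebraMap ℂ (MvPolynomial.homogeneousSubmodule J ℂ 0) r)
      | add x y _ _ hx hy => exact add_mem (hx trivial) (hy trivial)
      | mul x y _ _ hx hy => exact mul_mem (hx trivial) (hy trivial))
  exact TopologicalSpace.Opens.mem_iSup.1 (h.ge (Set.mem_univ x))

variable {A B : Type} [CommRing A] [Algebra ℂ A] [CommRing B] [Algebra ℂ B]
  (𝒜 : ℕ → Submodule ℂ A) [GradedAlgebra 𝒜]

theorem specToProj_left_eq (φ : A →ₐ[ℂ] B) {r : A} (hr : IsUnit (φ r)) {d : ℕ}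
    (hd : r ∈ 𝒜 d) (h0 : 0 < d) (hφ) :
    (specToProj 𝒜 φ hφ).left =
      Spec.map (CommRingCat.ofHom (awayLift 𝒜 (φ : A →+* B) hr)) ≫ Proj.awayι 𝒜 r hd h0 :=
  fromOfGlobalSections_eq_awayι 𝒜 (φ : A →+* B) hr hd h0 hφ

theorem awayLift_comp_algebraMap (φ : A →ₐ[ℂ] B) {r : A} (hr : IsUnit (φ r)) :
    (awayLift 𝒜 (φ : A →+* B) hr).comp
      ((fromZeroRingHom 𝒜 (.powers r)).comp (algebraMap ℂ (𝒜 0))) = algebraMap ℂ B := by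
  ext z
  have h := IsLocalization.Away.lift_eq (S := Localization.Away r) (g := (φ : A →+* B)) r hr
    (algebraMap ℂ A z)
  exact h.trans (φ.commutes z)

variable {I : Type} [Finite I] {J : I → Type} {R : I → Type} [∀ i, CommRing (R i)]
  [∀ i, Algebra ℂ (R i)] (ℛ : ∀ i, ℕ → Submodule ℂ (R i)) [∀ i, GradedAlgebra (ℛ i)]
  (X : ∀ i, J i → R i) (ψ : A →ₐ[ℂ] B) (φ : ∀ i, R i →ₐ[ℂ] B)

/-- The data that exhibit `Proj 𝒜` as the image of `Spec B` in the product of the `Proj (ℛ i)`. -/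
structure IsProductEmbedding (c : I → ℕ) (f : (∀ i, J i) → A) : Prop where
  injective : ∀ k, ∀ a ∈ 𝒜 k, ψ a = 0 → a = 0
  X_mem : ∀ i j, X i j ∈ ℛ i 1
  X_cover : ∀ i, ∀ x : Proj (ℛ i), ∃ j, x ∈ Proj.basicOpen (ℛ i) (X i j)
  zero_or_isUnit : ∀ i j, φ i (X i j) = 0 ∨ IsUnit (φ i (X i j))
  pos : ∀ i, 0 < c i
  mem : ∀ σ, f σ ∈ 𝒜 1
  map_eq : ∀ σ, ψ (f σ) = ∏ᶠ i, φ i (X i (σ i)) ^ c i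
  cover : ∀ x : Proj 𝒜, ∃ σ, (∀ i, IsUnit (φ i (X i (σ i)))) ∧ x ∈ Proj.basicOpen 𝒜 (f σ)
  -- The inclusion `≥` makes the morphisms to the factors regular on the chart of `f σ`, and `≤`
  -- makes the morphism to the product a closed immersion there.
  range_eq : ∀ σ, ∀ h : ∀ i, IsUnit (φ i (X i (σ i))), ∀ h' : IsUnit (ψ (f σ)),
    (awayLift 𝒜 (ψ : A →+* B) h').range = ⨆ i, (awayLift (ℛ i) (φ i : R i →+* B) (h i)).range

namespace IsProductEmbedding

variable {𝒜 ℛ X ψ φ} {c : I → ℕ} {f : (∀ i, J i) → A} (H : IsProductEmbedding 𝒜 ℛ X ψ φ c f)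

include H

theorem isUnit {σ : ∀ i, J i} (h : ∀ i, IsUnit (φ i (X i (σ i)))) :
    IsUnit (ψ (f σ)) := by
  have := Fintype.ofFinite I
  rw [H.map_eq, finprod_eq_prod_of_fintype]
  exact IsUnit.prod_iff.2 fun i _ => (h i).pow _

theorem exists_ratio {σ : ∀ i, J i} (h : ∀ i, IsUnit (φ i (X i (σ i)))) (i : I) :
    ∃ g : Away (ℛ i) (X i (σ i)) →+* Away 𝒜 (f σ),
      (awayLift 𝒜 (ψ : A →+* B) (H.isUnit h)).comp g =
        awayLift (ℛ i) (φ i : R i →+* B) (h i) := by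
  refine exists_factor _ _ (awayLift_injective 𝒜 (ψ : A →+* B) H.injective _ (H.mem σ)) ?_
  rw [H.range_eq σ h]
  exact le_iSup (fun i => (awayLift (ℛ i) (φ i : R i →+* B) (h i)).range) i

/-- The homomorphism that expresses `X i j / X i (σ i)` as a function on the basic open set of
`f σ`. -/
noncomputable def ratio (σ : ∀ i, J i) (h : ∀ i, IsUnit (φ i (X i (σ i)))) (i : I) :
    Away (ℛ i) (X i (σ i)) →+* Away 𝒜 (f σ) := (H.exists_ratio h i).choose

theorem awayLift_comp_ratio (σ : ∀ i, J i) (h : ∀ i, IsUnit (φ i (X i (σ i)))) (i : I) :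
    (awayLift 𝒜 (ψ : A →+* B) (H.isUnit h)).comp (H.ratio σ h i) =
      awayLift (ℛ i) (φ i : R i →+* B) (h i) := (H.exists_ratio h i).choose_spec

theorem awayLift_ratio (σ : ∀ i, J i) (h : ∀ i, IsUnit (φ i (X i (σ i)))) (i : I)
    (z : Away (ℛ i) (X i (σ i))) :
    awayLift 𝒜 (ψ : A →+* B) (H.isUnit h) (H.ratio σ h i z) =
      awayLift (ℛ i) (φ i : R i →+* B) (h i) z :=
  DFunLike.congr_fun (H.awayLift_comp_ratio σ h i) z

theorem awayLift_isInjective (σ : ∀ i, J i) (h : ∀ i, IsUnit (φ i (X i (σ i)))) :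
    Function.Injective (awayLift 𝒜 (ψ : A →+* B) (H.isUnit h)) :=
  awayLift_injective 𝒜 (ψ : A →+* B) H.injective _ (H.mem σ)

/-- The basic open set of `f σ`, as a morphism to `Proj 𝒜`. -/
noncomputable def openι (σ : ∀ i, J i) : Spec (.of (Away 𝒜 (f σ))) ⟶ Proj 𝒜 :=
  Proj.awayι 𝒜 (f σ) (H.mem σ) Nat.one_pos

/-- The basic open set of `X i j`, as a morphism to `Proj (ℛ i)`. -/
noncomputable def XOpenι (i : I) (j : J i) : Spec (.of (Away (ℛ i) (X i j))) ⟶ Proj (ℛ i) :=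
  Proj.awayι (ℛ i) (X i j) (H.X_mem i j) Nat.one_pos

/-- The morphism to `Proj (ℛ i)` on the basic open set of `f σ`. -/
noncomputable def chart (σ : ∀ i, J i) (h : ∀ i, IsUnit (φ i (X i (σ i)))) (i : I) :
    Spec (.of (Away 𝒜 (f σ))) ⟶ Proj (ℛ i) :=
  Spec.map (CommRingCat.ofHom (H.ratio σ h i)) ≫ H.XOpenι i (σ i)

/-- After multiplication by the denominators both sides have the same image in `B` by `map_eq`, and
`awayLift` is injective. This multiplicativity links nonvanishing in `Proj 𝒜` to nonvanishing in the
factors. -/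
theorem isLocalizationElem_eq (σ τ : ∀ i, J i) (h : ∀ i, IsUnit (φ i (X i (σ i)))) :
    Away.isLocalizationElem (H.mem σ) (H.mem τ) =
      ∏ᶠ i, H.ratio σ h i (Away.isLocalizationElem (H.X_mem i (σ i)) (H.X_mem i (τ i))) ^ c i := by
  have := Fintype.ofFinite I
  refine H.awayLift_isInjective σ h ?_
  have h1 := awayLift_mk_mul 𝒜 (ψ : A →+* B) (H.isUnit h) (H.mem σ) 1 (f τ ^ 1)
    (SetLike.pow_mem_graded _ (H.mem τ))
  have h2 : ∀ i, awayLift (ℛ i) (φ i : R i →+* B) (h i)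
      (Away.isLocalizationElem (H.X_mem i (σ i)) (H.X_mem i (τ i))) * φ i (X i (σ i)) ^ 1 =
        φ i (X i (τ i) ^ 1) := fun i =>
    awayLift_mk_mul (ℛ i) (φ i : R i →+* B) (h i) (H.X_mem i (σ i)) 1 (X i (τ i) ^ 1)
      (SetLike.pow_mem_graded _ (H.X_mem i (τ i)))
  refine (H.isUnit h).mul_right_cancel ?_
  refine (congrArg _ (pow_one _).symm).trans (h1.trans ?_)
  rw [finprod_eq_prod_of_fintype, map_prod, H.map_eq σ, finprod_eq_prod_of_fintype,
    ← Finset.prod_mul_distrib]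
  refine Eq.trans ?_ (Finset.prod_congr rfl fun i _ => by
    rw [map_pow, awayLift_ratio, ← mul_pow, ← pow_one (φ i (X i (σ i))), h2 i, pow_one])
  rw [← finprod_eq_prod_of_fintype, ← H.map_eq τ]
  simp

/-- In a chart around `x`, the ratio `f τ / f σ` is the product of the `c i`-th powers of ratios of
coordinates. A prime ideal avoids this product exactly if it avoids all the ratios, because every `c
i` is positive. -/
theorem mem_basicOpen_iff (F : ∀ i, Proj 𝒜 ⟶ Proj (ℛ i))
    (hF : ∀ (i : I) (σ : ∀ i, J i) (h : ∀ i, IsUnit (φ i (X i (σ i)))),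
      H.openι σ ≫ F i = H.chart σ h i) (τ : ∀ i, J i) (x : Proj 𝒜) :
    x ∈ Proj.basicOpen 𝒜 (f τ) ↔ ∀ i, F i x ∈ Proj.basicOpen (ℛ i) (X i (τ i)) := by
  have := Fintype.ofFinite I
  obtain ⟨σ, h, hx⟩ := H.cover x
  obtain ⟨z, rfl⟩ := exists_awayι_apply_eq 𝒜 (H.mem σ) Nat.one_pos hx
  have h1 : Proj.awayι 𝒜 (f σ) (H.mem σ) Nat.one_pos z ∈ Proj.basicOpen 𝒜 (f τ) ↔
      Away.isLocalizationElem (H.mem σ) (H.mem τ) ∉ z.asIdeal := by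
    have := congrArg (fun U => z ∈ U)
      (Proj.awayι_preimage_basicOpen 𝒜 (H.mem σ) Nat.one_pos (H.mem τ) Nat.one_pos)
    exact iff_of_eq this
  have h2 : ∀ i, F i (Proj.awayι 𝒜 (f σ) (H.mem σ) Nat.one_pos z) ∈
      Proj.basicOpen (ℛ i) (X i (τ i)) ↔
      H.ratio σ h i (Away.isLocalizationElem (H.X_mem i (σ i)) (H.X_mem i (τ i))) ∉ z.asIdeal := by
    intro i
    have h3 := congrArg (fun U => Spec.map (CommRingCat.ofHom (H.ratio σ h i)) z ∈ U)
      (Proj.awayι_preimage_basicOpen (ℛ i) (H.X_mem i (σ i)) Nat.one_pos (H.X_mem i (τ i))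
        Nat.one_pos)
    have h4 : F i (Proj.awayι 𝒜 (f σ) (H.mem σ) Nat.one_pos z) =
        H.XOpenι i (σ i) (Spec.map (CommRingCat.ofHom (H.ratio σ h i)) z) := by
      have := congrArg (fun g : Spec (.of (Away 𝒜 (f σ))) ⟶ Proj (ℛ i) => g z) (hF i σ h)
      exact this
    rw [h4]
    exact iff_of_eq h3
  rw [h1, H.isLocalizationElem_eq σ τ h, finprod_eq_prod_of_fintype]
  simp only [h2]
  have hp := z.isPrime
  rw [hp.prod_mem_iff]
  push Not
  refine forall_congr' fun i => ?_
  simp only [Finset.mem_univ, true_imp_iff]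
  rw [hp.pow_mem_iff_mem _ (H.pos i)]

variable [IsDomain B]

/-- The morphisms on the charts all restrict to the given morphism on `Spec B`, and this is what
`exists_glue` needs. -/
theorem exists_toProj (i : I) (hφ) : ∃ F : Proj 𝒜 ⟶ Proj (ℛ i),
    (∀ (σ : ∀ i, J i) (h : ∀ i, IsUnit (φ i (X i (σ i)))),
      H.openι σ ≫ F = H.chart σ h i) ∧
    ∀ (σ : ∀ i, J i) (h : ∀ i, IsUnit (φ i (X i (σ i)))),
      Spec.map (CommRingCat.ofHom (awayLift 𝒜 (ψ : A →+* B) (H.isUnit h))) ≫ H.chart σ h i =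
        (specToProj (ℛ i) (φ i) hφ).left := by
  have key : ∀ (σ : ∀ i, J i) (h : ∀ i, IsUnit (φ i (X i (σ i)))),
      Spec.map (CommRingCat.ofHom (awayLift 𝒜 (ψ : A →+* B) (H.isUnit h))) ≫ H.chart σ h i =
        (specToProj (ℛ i) (φ i) hφ).left := by
    intro σ h
    rw [chart, ← Spec.map_comp_assoc, ← CommRingCat.ofHom_comp, awayLift_comp_ratio]
    exact (specToProj_left_eq (ℛ i) (φ i) (h i) (H.X_mem i _) Nat.one_pos hφ).symm
  obtain ⟨F, hF⟩ := exists_glue 𝒜 (ψ : A →+* B) H.injective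
    (κ := {σ : ∀ i, J i // ∀ i, IsUnit (φ i (X i (σ i)))}) (fun k => f k.1) 1 Nat.one_pos
    (fun k => H.mem k.1) (fun k => H.isUnit k.2)
    (fun x => by
      obtain ⟨σ, h, hx⟩ := H.cover x
      exact ⟨⟨σ, h⟩, hx⟩) (Z := Proj (ℛ i)) (fun k => H.chart k.1 k.2 i) _ (fun k => key k.1 k.2)
  exact ⟨F, fun σ h => hF ⟨σ, h⟩, key⟩

end IsProductEmbedding

end ProductEmbedding

/-! ### The morphism to the product is a closed immersion -/

section ProductEmbeddingIso

open HomogeneousLocalization YShapedQuiver Limits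

namespace IsProductEmbedding

variable {A B : Type} [CommRing A] [Algebra ℂ A] [CommRing B] [Algebra ℂ B]
  {𝒜 : ℕ → Submodule ℂ A} [GradedAlgebra 𝒜]
  {I : Type} [Finite I] {J : I → Type} {R : I → Type} [∀ i, CommRing (R i)]
  [∀ i, Algebra ℂ (R i)] {ℛ : ∀ i, ℕ → Submodule ℂ (R i)} [∀ i, GradedAlgebra (ℛ i)]
  {X : ∀ i, J i → R i} {ψ : A →ₐ[ℂ] B} {φ : ∀ i, R i →ₐ[ℂ] B}
  {c : I → ℕ} {f : (∀ i, J i) → A} (H : IsProductEmbedding 𝒜 ℛ X ψ φ c f)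

include H

/-- This is `range_eq`, carried back from `B` to the chart along the injective map `awayLift`. -/
theorem iSup_range_ratio (σ : ∀ i, J i) (h : ∀ i, IsUnit (φ i (X i (σ i)))) :
    ⨆ i, (H.ratio σ h i).range = ⊤ := by
  have hinj : Function.Injective (Subring.map (awayLift 𝒜 (ψ : A →+* B) (H.isUnit h))) := by
    intro S S' hS
    have := congrArg (fun T : Subring B => (T : Set B)) hS
    exact SetLike.coe_injective ((H.awayLift_isInjective σ h).image_injective this)
  apply hinj
  rw [Subring.map_iSup, ← RingHom.range_eq_map, H.range_eq σ h]
  refine iSup_congr fun i => ?_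
  rw [← H.awayLift_comp_ratio σ h i, RingHom.range_eq_map, RingHom.range_eq_map, Subring.map_map]

instance isOpenImmersion_XOpenι (i : I) (j : J i) : IsOpenImmersion (H.XOpenι i j) := by
  unfold XOpenι
  infer_instance

theorem opensRange_XOpenι (i : I) (j : J i) :
    (H.XOpenι i j).opensRange = Proj.basicOpen (ℛ i) (X i j) :=
  Proj.opensRange_awayι _ _ _ _

/-- The functions pulled back from the factors along the `q i` already generate all functions on the
chart, so restriction of functions from `W` is surjective. -/
theorem isClosedImmersion_of_ratio {W : Scheme.{0}} [IsAffine W] (σ : ∀ i, J i)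
    (h : ∀ i, IsUnit (φ i (X i (σ i)))) (k : Spec (.of (Away 𝒜 (f σ))) ⟶ W)
    (q : ∀ i, W ⟶ Spec (.of (Away (ℛ i) (X i (σ i)))))
    (hq : ∀ i, k ≫ q i = Spec.map (CommRingCat.ofHom (H.ratio σ h i))) :
    IsClosedImmersion k := by
  refine IsClosedImmersion.of_surjective_of_isAffine _ ?_
  let e := Scheme.ΓSpecIso (.of (Away 𝒜 (f σ)))
  let ρ : Γ(W, ⊤) →+* Away 𝒜 (f σ) := (k.appTop ≫ e.hom).hom
  have h1 : ∀ i, (H.ratio σ h i).range ≤ ρ.range := by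
    rintro i _ ⟨z, rfl⟩
    refine ⟨((Scheme.ΓSpecIso (.of (Away (ℛ i) (X i (σ i))))).inv ≫ (q i).appTop).hom z, ?_⟩
    have h2 : ((Scheme.ΓSpecIso (.of (Away (ℛ i) (X i (σ i))))).inv ≫ (q i).appTop) ≫
        k.appTop ≫ e.hom = CommRingCat.ofHom (H.ratio σ h i) := by
      rw [Category.assoc, ← Scheme.Hom.comp_appTop_assoc, hq,
        ← Scheme.ΓSpecIso_inv_naturality_assoc, Iso.inv_hom_id, Category.comp_id]
    exact congrArg (fun g => g.hom z) h2
  have h3 : ρ.range = ⊤ := by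
    rw [eq_top_iff, ← H.iSup_range_ratio σ h]
    exact iSup_le h1
  have h4 : Function.Surjective ρ := RingHom.range_eq_top.1 h3
  intro y
  obtain ⟨x, hx⟩ := h4 (e.hom.hom y)
  exact ⟨x, (ConcreteCategory.bijective_of_isIso e.hom).1 hx⟩

theorem isClosedImmersion_morphismRestrict {Z : Scheme.{0}} (F : ∀ i, Proj 𝒜 ⟶ Proj (ℛ i))
    (hF : ∀ (i : I) (σ : ∀ i, J i) (h : ∀ i, IsUnit (φ i (X i (σ i)))),
      H.openι σ ≫ F i = H.chart σ h i) (g : Proj 𝒜 ⟶ Z) (p : ∀ i, Z ⟶ Proj (ℛ i))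
    (hgp : ∀ i, g ≫ p i = F i) {τ : ∀ i, J i} (h : ∀ i, IsUnit (φ i (X i (τ i)))) (W : Z.Opens)
    [IsAffine W.toScheme] (hle : ∀ i, W ≤ p i ⁻¹ᵁ (H.XOpenι i (τ i)).opensRange)
    (hpre : g ⁻¹ᵁ W = Proj.basicOpen 𝒜 (f τ)) : IsClosedImmersion (g ∣_ W) := by
  let q : ∀ i, W.toScheme ⟶ Spec (.of (Away (ℛ i) (X i (τ i)))) := fun i =>
    IsOpenImmersion.lift (H.XOpenι i (τ i)) (W.ι ≫ p i) (by
      rintro _ ⟨y, rfl⟩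
      exact hle i y.2)
  let e := (Proj.basicOpenIsoSpec 𝒜 (f τ) (H.mem τ) Nat.one_pos).symm ≪≫
    (Scheme.isoOfEq _ hpre).symm
  have he : e.hom ≫ (g ⁻¹ᵁ W).ι = H.openι τ := by
    simp only [e, Iso.trans_hom, Iso.symm_hom, Category.assoc, Scheme.isoOfEq_inv_ι]
    rfl
  have hk : IsClosedImmersion (e.hom ≫ g ∣_ W) := by
    refine H.isClosedImmersion_of_ratio τ h _ q fun i => ?_
    have hqi : q i ≫ H.XOpenι i (τ i) = W.ι ≫ p i := IsOpenImmersion.lift_fac _ _ _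
    rw [← cancel_mono (H.XOpenι i (τ i)), Category.assoc, Category.assoc, hqi, morphismRestrict_ι_assoc, hgp, ← Category.assoc, he, hF i τ h]
    rfl
  exact (MorphismProperty.cancel_left_of_respectsIso @IsClosedImmersion e.hom _).1 hk

/-- The property is local on the target. Around a point, choose in every factor a coordinate that
does not vanish; the product of these charts pulls back to the basic open set of `f τ`. If all the
chosen coordinates are units in `B`, functions restrict surjectively there. If one of them is zero
in `B`, then `f τ = 0` and the preimage is empty. -/
theorem isClosedImmersion_lift (F : ∀ i, projOver 𝒜 ⟶ projOver (ℛ i))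
    (hF : ∀ (i : I) (σ : ∀ i, J i) (h : ∀ i, IsUnit (φ i (X i (σ i)))),
      H.openι σ ≫ (F i).left = H.chart σ h i) :
    IsClosedImmersion (Pi.lift F : projOver 𝒜 ⟶ ∏ᶜ fun i => projOver (ℛ i)).left := by
  have := Fintype.ofFinite I
  set G : projOver 𝒜 ⟶ ∏ᶜ fun i => projOver (ℛ i) := Pi.lift F with hG
  have hπ : ∀ i, G.left ≫ (Pi.π (fun i => projOver (ℛ i)) i).left = (F i).left := by
    intro i
    rw [← Over.comp_left, hG, Pi.lift_π]
  refine IsZariskiLocalAtTarget.of_forall_exists_morphismRestrict fun x => ?_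
  choose τ hτ using fun i => H.X_cover i ((Pi.π (fun i => projOver (ℛ i)) i).left x)
  set W : (∏ᶜ fun i => projOver (ℛ i)).left.Opens :=
    ⨅ i, (Pi.π (fun i => projOver (ℛ i)) i).left ⁻¹ᵁ (H.XOpenι i (τ i)).opensRange with hW
  have hmem : ∀ y, y ∈ W ↔ ∀ i, (Pi.π (fun i => projOver (ℛ i)) i).left y ∈
      Proj.basicOpen (ℛ i) (X i (τ i)) := by
    intro y
    rw [hW, ← Finset.inf_univ_eq_iInf, ← SetLike.mem_coe, TopologicalSpace.Opens.coe_finset_inf,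
      Finset.inf_eq_iInf]
    simp only [Finset.mem_univ, iInf_true, Set.iInf_eq_iInter, Set.mem_iInter]
    refine forall_congr' fun i => ?_
    rw [← H.opensRange_XOpenι]
    rfl
  have hpre : G.left ⁻¹ᵁ W = Proj.basicOpen 𝒜 (f τ) := by
    ext y
    have h1 := H.mem_basicOpen_iff (fun i => (F i).left) hF τ y
    refine Iff.trans ?_ h1.symm
    refine (hmem (G.left y)).trans (forall_congr' fun i => ?_)
    rw [← hπ i]
    rfl
  refine ⟨W, (hmem x).2 hτ, ?_⟩
  by_cases h : ∀ i, IsUnit (φ i (X i (τ i)))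
  · have := fun i => H.isOpenImmersion_XOpenι i (τ i)
    have hle : ∀ i, W ≤ (Pi.π (fun i => projOver (ℛ i)) i).left ⁻¹ᵁ
        (H.XOpenι i (τ i)).opensRange := fun i => by
      intro y hy
      have := (hmem y).1 hy i
      rwa [← H.opensRange_XOpenι] at this
    let C : I → Over (Spec (.of ℂ)) := fun i => Over.mk (H.XOpenι i (τ i) ≫ (projOver (ℛ i)).hom)
    let j : ∀ i, C i ⟶ projOver (ℛ i) := fun i => Over.homMk (H.XOpenι i (τ i)) rfl
    have hC : ∀ i, IsAffine (C i).left := fun i =>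
      inferInstanceAs (IsAffine (Spec (.of (Away (ℛ i) (X i (τ i))))))
    have hj : ∀ i, IsOpenImmersion (j i).left := fun i => this i
    have hWa : IsAffine W.toScheme := isAffineOpen_iInf_preimage (fun i => projOver (ℛ i)) C j
    exact H.isClosedImmersion_morphismRestrict (fun i => (F i).left) hF G.left
      (fun i => (Pi.π (fun i => projOver (ℛ i)) i).left) hπ h W hle hpre
  · push Not at h
    obtain ⟨i, hi⟩ := h
    have h0 : f τ = 0 := by
      refine H.injective 1 _ (H.mem τ) ?_
      rw [H.map_eq, finprod_eq_prod_of_fintype]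
      refine Finset.prod_eq_zero (Finset.mem_univ i) ?_
      rw [(H.zero_or_isUnit i (τ i)).resolve_right hi, zero_pow (H.pos i).ne']
    have hbot : G.left ⁻¹ᵁ W = ⊥ := by
      rw [hpre, h0, Proj.basicOpen_zero]
      rfl
    have : IsEmpty (G.left ⁻¹ᵁ W).toScheme := by
      rw [hbot]
      exact Set.isEmpty_coe_sort.2 rfl
    infer_instance

theorem irrelevant_map {σ : ∀ i, J i} (h : ∀ i, IsUnit (φ i (X i (σ i)))) :
    (HomogeneousIdeal.irrelevant 𝒜).toIdeal.map
      (((Scheme.ΓSpecIso (.of B)).inv.hom).comp (ψ : A →+* B)) = ⊤ := by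
  refine Ideal.eq_top_of_isUnit_mem _ (Ideal.mem_map_of_mem _ ?_)
    ((H.isUnit h).map (Scheme.ΓSpecIso (.of B)).inv.hom)
  change f σ ∈ HomogeneousIdeal.irrelevant _
  rw [HomogeneousIdeal.mem_irrelevant_iff, GradedRing.proj_apply]
  exact DirectSum.decompose_of_mem_ne _ (H.mem σ) one_ne_zero

theorem specToProj_left (hψ) (σ : ∀ i, J i) (h : ∀ i, IsUnit (φ i (X i (σ i)))) :
    (specToProj 𝒜 ψ hψ).left =
      Spec.map (CommRingCat.ofHom (awayLift 𝒜 (ψ : A →+* B) (H.isUnit h))) ≫ H.openι σ :=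
  specToProj_left_eq 𝒜 ψ (H.isUnit h) (H.mem σ) Nat.one_pos hψ

theorem nonempty_image_iso [IsDomain B] (hσ : ∀ i, ∃ j, IsUnit (φ i (X i j)))
    (hφ : ∀ i, (HomogeneousIdeal.irrelevant (ℛ i)).toIdeal.map
      (((Scheme.ΓSpecIso (.of B)).inv.hom).comp (φ i : R i →+* B)) = ⊤) :
    Nonempty (Over.mk ((Pi.lift fun i => specToProj (ℛ i) (φ i) (hφ i)).left.imageι ≫
      (∏ᶜ fun i => projOver (ℛ i)).hom) ≅ projOver 𝒜) := by
  choose F hF hF' using fun i => H.exists_toProj i (hφ i)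
  choose σ hσ using hσ
  let κ := {σ : ∀ i, J i // ∀ i, IsUnit (φ i (X i (σ i)))}
  have hcov : ∀ x : Proj 𝒜, ∃ k : κ, x ∈ Proj.basicOpen 𝒜 (f k.1) := fun x => by
    obtain ⟨σ, h, hx⟩ := H.cover x
    exact ⟨⟨σ, h⟩, hx⟩
  have hψ := H.irrelevant_map hσ
  have hred : IsReduced (Proj 𝒜) := isReduced_proj 𝒜 (ψ : A →+* B) H.injective
    (fun k : κ => f k.1) 1 Nat.one_pos (fun k => H.mem k.1) (fun k => H.isUnit k.2) hcov
  let t := specToProj 𝒜 ψ hψ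
  have ht : ∀ (σ : ∀ i, J i) (h : ∀ i, IsUnit (φ i (X i (σ i)))), t.left =
      Spec.map (CommRingCat.ofHom (awayLift 𝒜 (ψ : A →+* B) (H.isUnit h))) ≫ H.openι σ :=
    fun σ h => H.specToProj_left hψ σ h
  have hdom : IsDominant t.left := isDominant_toProj 𝒜 (ψ : A →+* B) H.injective
    (fun k : κ => f k.1) 1 Nat.one_pos (fun k => H.mem k.1) (fun k => H.isUnit k.2) hcov _
    (fun k => ht k.1 k.2)
  have htF : ∀ i, t.left ≫ F i = (specToProj (ℛ i) (φ i) (hφ i)).left := fun i => by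
    refine (congrArg (· ≫ F i) (ht σ hσ)).trans ((Category.assoc _ _ _).trans ?_)
    exact (congrArg (_ ≫ ·) (hF i σ hσ)).trans (hF' i σ hσ)
  -- The glued morphisms respect the structure morphisms to `Spec ℂ`, because they do so after
  -- composition with the dominant morphism from `Spec B`.
  have hw : ∀ i, F i ≫ (projOver (ℛ i)).hom = (projOver 𝒜).hom := fun i => by
    have : IsReduced (projOver 𝒜).left := hred
    refine ext_of_isDominant (W := (specOver B).left) (X := (projOver 𝒜).left) (ι := t.left) ?_
    refine Eq.trans ?_ (Over.w t).symm
    refine (Category.assoc _ _ _).symm.trans ((congrArg (· ≫ _) (htF i)).trans ?_)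
    exact Over.w (specToProj (ℛ i) (φ i) (hφ i))
  let G : ∀ i, projOver 𝒜 ⟶ projOver (ℛ i) := fun i => Over.homMk (F i) (hw i)
  have hG : IsClosedImmersion (Pi.lift G).left := H.isClosedImmersion_lift G hF
  have hfac : t ≫ Pi.lift G = Pi.lift fun i => specToProj (ℛ i) (φ i) (hφ i) := by
    refine Pi.hom_ext _ _ fun i => ?_
    rw [Category.assoc, Pi.lift_π, Pi.lift_π]
    exact Over.OverMorphism.ext (htF i)
  have : IsReduced (projOver 𝒜).left := hred
  have := _root_.nonempty_image_iso t (Pi.lift G)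
  rwa [hfac] at this

end IsProductEmbedding

end ProductEmbeddingIso

/-! ### Toric GIT quotients in products of projective spaces -/

section Toric

open HomogeneousLocalization MvPolynomial

variable {α M K I : Type} [AddCommGroup M] [Fintype I] {J : I → Type}

/-- Combinatorial data that exhibit the toric GIT quotient of the affine space with coordinates indexed
by `α`, with weights `D` and stability condition `w`, as the closure of a torus with characters `K →₀ ℤ`
in a product of projective spaces with homogeneous coordinates indexed by the `J i`. -/
structure IsToricEmbedding (D : α → M) (w : M) (χ : (α →₀ ℕ) →+ (K →₀ ℤ)) (θ : I → M) (c : I → ℕ)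
    (valid : ∀ i, J i → Prop) (u : ∀ i, J i → α →₀ ℕ) : Prop where
  inj : ∀ v v', Finsupp.weight D v = Finsupp.weight D v' → χ v = χ v' → v = v'
  weight_u : ∀ i j, valid i j → Finsupp.weight D (u i j) = θ i
  -- An integer decomposition property: lattice points of the polytope of exponents of weight `∑ i,
  -- n i • θ i` split into lattice points that belong to the `θ i`.
  decomp : ∀ (n : I → ℕ) (v : α →₀ ℕ), Finsupp.weight D v = ∑ i, n i • θ i →
    ∃ s : ∀ i, Multiset (J i), (∀ i, (s i).card = n i) ∧ (∀ i, ∀ j ∈ s i, valid i j) ∧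
      v = ∑ i, ((s i).map (u i)).sum
  w_eq : w = ∑ i, c i • θ i
  pos : ∀ i, 0 < c i

/-- The homomorphism from the ring of semi-invariants to the functions on the torus given by `χ`. -/
noncomputable def toricMap (D : α → M) (w : M) (χ : (α →₀ ℕ) →+ (K →₀ ℤ)) :
    semiInvariantRing D w →ₐ[ℂ] AddMonoidAlgebra ℂ (K →₀ ℤ) :=
  ((AddMonoidAlgebra.mapDomainAlgHom ℂ ℂ χ).comp
    ((Polynomial.aeval (1 : MvPolynomial α ℂ)).restrictScalars ℂ)).comp (semiInvariantRing D w).val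

/-- The semi-invariant `y ^ v * T ^ k`. -/
noncomputable def semiMonomial (D : α → M) (w : M) (k : ℕ) (v : α →₀ ℕ)
    (h : Finsupp.weight D v = k • w) : semiInvariantRing D w :=
  ⟨Polynomial.monomial k (MvPolynomial.monomial v 1), fun l => by
    rw [Polynomial.coeff_monomial]
    split_ifs with hl
    · subst hl
      exact isWeightedHomogeneous_monomial D v 1 h
    · exact Submodule.zero_mem _⟩

variable {D : α → M} {w : M} {χ : (α →₀ ℕ) →+ (K →₀ ℤ)}

theorem semiMonomial_mem (k : ℕ) (v : α →₀ ℕ) (h : Finsupp.weight D v = k • w) :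
    semiMonomial D w k v h ∈ semiInvariantGrading D w k := fun l hl => by
  change (Polynomial.monomial k _).coeff l = 0
  rw [Polynomial.coeff_monomial, if_neg hl.symm]

theorem toricMap_apply (f : semiInvariantRing D w) {k : ℕ} (hf : f ∈ semiInvariantGrading D w k) :
    toricMap D w χ f = AddMonoidAlgebra.mapDomainAlgHom ℂ ℂ χ (f.1.coeff k) := by
  have h : f.1 = Polynomial.monomial k (f.1.coeff k) :=
    (congrArg (fun g => g.1.1) (semiInvariantComponent_self (D := D) (w := w) ⟨f, hf⟩)).symm
  change AddMonoidAlgebra.mapDomainAlgHom ℂ ℂ χ (Polynomial.aeval (1 : MvPolynomial α ℂ) f.1) = _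
  rw [h, Polynomial.aeval_monomial]
  simp

theorem toricMap_semiMonomial (k : ℕ) (v : α →₀ ℕ) (h : Finsupp.weight D v = k • w) :
    toricMap D w χ (semiMonomial D w k v h) = AddMonoidAlgebra.single (χ v) 1 := by
  rw [toricMap_apply _ (semiMonomial_mem k v h)]
  change AddMonoidAlgebra.mapDomainAlgHom ℂ ℂ χ ((Polynomial.monomial k _).coeff k) = _
  rw [Polynomial.coeff_monomial, if_pos rfl]
  exact AddMonoidAlgebra.mapDomain_single

/-- All exponents in degree `k` have the same weight `k • w`, and on exponents of equal weight `χ`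
is injective. Only one degree at a time is considered, since `T` has been set to `1`. -/
theorem toricMap_injective
    (hχ : ∀ v v', Finsupp.weight D v = Finsupp.weight D v' → χ v = χ v' → v = v') (k : ℕ)
    (f : semiInvariantRing D w) (hf : f ∈ semiInvariantGrading D w k)
    (h0 : toricMap D w χ f = 0) : f = 0 := by
  rw [toricMap_apply f hf] at h0
  have h1 : f.1.coeff k = 0 := by
    have hinj := Finsupp.mapDomain_injOn (M := ℂ) {v | Finsupp.weight D v = k • w} (f := χ)
      (fun v hv v' hv' h => hχ v v' (hv.trans hv'.symm) h)
    have h2 := hinj (x₁ := AddMonoidAlgebra.coeff (f.1.coeff k)) (x₂ := 0)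
      (fun v hv => f.2 k (Finsupp.mem_support_iff.1 hv)) (by simp)
      ((congrArg AddMonoidAlgebra.coeff h0).trans Finsupp.mapDomain_zero.symm)
    exact AddMonoidAlgebra.coeff_injective h2
  refine Subtype.ext (Polynomial.ext fun l => ?_)
  by_cases hl : l = k
  · subst hl
    exact h1
  · exact hf l hl

theorem semiMonomial_mul (k l : ℕ) (v v' : α →₀ ℕ) (h : Finsupp.weight D v = k • w)
    (h' : Finsupp.weight D v' = l • w) :
    semiMonomial D w k v h * semiMonomial D w l v' h' =
      semiMonomial D w (k + l) (v + v') (by rw [map_add, h, h', add_smul]) := by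
  refine Subtype.ext ?_
  change Polynomial.monomial k _ * Polynomial.monomial l _ = Polynomial.monomial _ _
  rw [Polynomial.monomial_mul_monomial, MvPolynomial.monomial_mul, one_mul]

theorem semiMonomial_pow (k n : ℕ) (v : α →₀ ℕ) (h : Finsupp.weight D v = k • w) :
    semiMonomial D w k v h ^ n =
      semiMonomial D w (n * k) (n • v) (by rw [map_nsmul, h, mul_smul]) := by
  refine Subtype.ext ?_
  change Polynomial.monomial k _ ^ n = Polynomial.monomial _ _
  rw [Polynomial.monomial_pow, MvPolynomial.monomial_pow, one_pow, mul_comm]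

theorem eq_sum_semiMonomial (k : ℕ) (a : semiInvariantRing D w)
    (ha : a ∈ semiInvariantGrading D w k) :
    a = ∑ v ∈ (a.1.coeff k).support.attach, MvPolynomial.coeff v.1 (a.1.coeff k) •
      semiMonomial D w k v.1 (a.2 k (mem_support_iff.1 v.2)) := by
  refine Subtype.ext ?_
  have h1 : a.1 = Polynomial.monomial k (a.1.coeff k) :=
    (congrArg (fun g => g.1.1) (semiInvariantComponent_self (D := D) (w := w) ⟨a, ha⟩)).symm
  rw [AddSubmonoidClass.coe_finsetSum]
  refine h1.trans ?_
  change Polynomial.monomial k (a.1.coeff k) = ∑ v ∈ (a.1.coeff k).support.attach,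
    MvPolynomial.coeff v.1 (a.1.coeff k) •
      Polynomial.monomial k (MvPolynomial.monomial v.1 (1 : ℂ))
  conv_lhs => rw [← support_sum_monomial_coeff (a.1.coeff k), map_sum, ← Finset.sum_attach]
  refine Finset.sum_congr rfl fun v _ => ?_
  rw [Polynomial.smul_monomial, MvPolynomial.smul_monomial, smul_eq_mul, mul_one]

variable {B : Type} [CommRing B] (E : Multiplicative (K →₀ ℤ) →* B)

theorem sum_mem_comap {ι : Type} (S : Submonoid B) {s : Finset ι} (g : ι → K →₀ ℤ)
    (h : ∀ i ∈ s, E (.ofAdd (g i)) ∈ S) : E (.ofAdd (∑ i ∈ s, g i)) ∈ S := by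
  rw [ofAdd_sum, map_prod]
  exact S.prod_mem h

theorem multiset_sum_mem_comap {ι : Type} (S : Submonoid B) {s : Multiset ι} (g : ι → K →₀ ℤ)
    (h : ∀ i ∈ s, E (.ofAdd (g i)) ∈ S) : E (.ofAdd (s.map g).sum) ∈ S := by
  induction s using Multiset.induction_on with
  | empty => 
    rw [Multiset.map_zero, Multiset.sum_zero, ofAdd_zero, map_one]
    exact S.one_mem
  | cons a s ih =>
    rw [Multiset.map_cons, Multiset.sum_cons, ofAdd_add, map_mul]
    exact S.mul_mem (h a (Multiset.mem_cons_self a s))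
      (ih fun i hi => h i (Multiset.mem_cons_of_mem hi))

theorem isUnit_map_ofAdd (g : K →₀ ℤ) : IsUnit (E (.ofAdd g)) :=
  (Group.isUnit (Multiplicative.ofAdd g)).map E

theorem mul_map_neg (y : B) (g : K →₀ ℤ) : y * E (.ofAdd g) * E (.ofAdd (-g)) = y := by
  rw [mul_assoc, ← map_mul, ← ofAdd_add, add_neg_cancel, ofAdd_zero, map_one, mul_one]

variable [Algebra ℂ B] {R : Type} [CommRing R] [Algebra ℂ R] (ℛ : ℕ → Submodule ℂ R)
  [GradedAlgebra ℛ] (φ : R →ₐ[ℂ] B)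

/-- The functions of the form `φ a / φ r ^ n`, for `a` of the same degree as `r ^ n`. -/
noncomputable def awayRange {r : R} (hr : IsUnit (φ r)) : Subring B :=
  (awayLift ℛ (φ : R →+* B) hr).range

theorem exists_of_mem_awayRange {r : R} (hr : IsUnit (φ r)) (hr1 : r ∈ ℛ 1) {y : B}
    (hy : y ∈ awayRange ℛ φ hr) : ∃ k, ∃ a ∈ ℛ k, y * φ r ^ k = φ a := by
  obtain ⟨z, rfl⟩ := hy
  obtain ⟨k, a, ha, rfl⟩ := Away.mk_surjective _ hr1 z
  exact ⟨k, a, by simpa using ha, awayLift_mk_mul _ (φ : R →+* B) hr hr1 k a ha⟩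

theorem map_sub_mem_awayRange {r a : R} {g g' : K →₀ ℤ} (hr : IsUnit (φ r)) (hr1 : r ∈ ℛ 1)
    (ha1 : a ∈ ℛ 1) (hg : φ r = E (.ofAdd g)) (ha : φ a = E (.ofAdd g')) :
    E (.ofAdd (g' - g)) ∈ awayRange ℛ φ hr := by
  refine ⟨Away.mk ℛ hr1 1 a (by simpa using ha1), ?_⟩
  have h := awayLift_mk_mul ℛ (φ : R →+* B) hr hr1 1 a (by simpa using ha1)
  refine hr.mul_right_cancel ?_
  rw [← pow_one (φ r)]
  refine h.trans ?_
  change φ a = _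
  rw [ha, pow_one, hg, ← map_mul, ← ofAdd_add, sub_add_cancel]

theorem algebraMap_mem_awayRange {r : R} (hr : IsUnit (φ r)) (z : ℂ) :
    algebraMap ℂ B z ∈ awayRange ℛ φ hr :=
  ⟨_, DFunLike.congr_fun (awayLift_comp_algebraMap ℛ φ hr) z⟩

/-- A graded algebra that is spanned in degree `k` by monomials `y k v` with exponents `v` of weight
`k • w`. -/
structure IsMonomialGrading {A : Type} [CommRing A] [Algebra ℂ A] (𝒜 : ℕ → Submodule ℂ A) (D : α → M)
    (w : M) (y : ℕ → (α →₀ ℕ) → A) : Prop where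
  mem : ∀ k v, y k v ∈ 𝒜 k
  mul : ∀ k l v v', Finsupp.weight D v = k • w → Finsupp.weight D v' = l • w →
    y k v * y l v' = y (k + l) (v + v')
  pow : ∀ k n v, Finsupp.weight D v = k • w → y k v ^ n = y (n * k) (n • v)
  span : ∀ k, ∀ a ∈ 𝒜 k, a ∈ Submodule.span ℂ (y k '' {v | Finsupp.weight D v = k • w})

/-- Otherwise the point would contain every monomial of positive degree, hence the whole irrelevant
ideal. -/
theorem IsMonomialGrading.exists_notMem {A : Type} [CommRing A] [Algebra ℂ A]
    {𝒜 : ℕ → Submodule ℂ A} [GradedAlgebra 𝒜] {y : ℕ → (α →₀ ℕ) → A}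
    (hy : IsMonomialGrading 𝒜 D w y) (x : Proj 𝒜) :
    ∃ k, 0 < k ∧ ∃ v, Finsupp.weight D v = k • w ∧ y k v ∉ x.asHomogeneousIdeal := by
  by_contra! hcon
  refine x.not_irrelevant_le fun a ha => ?_
  classical
  rw [← DirectSum.sum_support_decompose 𝒜 a]
  refine Ideal.sum_mem _ fun k _ => ?_
  rcases Nat.eq_zero_or_pos k with rfl | hk
  · rw [HomogeneousIdeal.mem_irrelevant_iff, GradedRing.proj_apply] at ha
    rw [ha]
    exact Ideal.zero_mem _
  · generalize DirectSum.decompose 𝒜 a k = b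
    have h1 : Submodule.span ℂ (y k '' {v | Finsupp.weight D v = k • w}) ≤
        x.asHomogeneousIdeal.toIdeal.restrictScalars ℂ := by
      rw [Submodule.span_le]
      rintro _ ⟨v, hv, rfl⟩
      exact hcon k hk v hv
    exact h1 (hy.span k b.1 b.2)

namespace IsToricEmbedding

variable {A : Type} [CommRing A] [Algebra ℂ A] {𝒜 : ℕ → Submodule ℂ A} [GradedAlgebra 𝒜]
  {y : ℕ → (α →₀ ℕ) → A} (hy : IsMonomialGrading 𝒜 D w y) {θ : I → M} {c : I → ℕ} {valid : ∀ i, J i → Prop} {u : ∀ i, J i → α →₀ ℕ}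
  (H : IsToricEmbedding D w χ θ c valid u)

include H in
theorem weight_sum {σ : ∀ i, J i} (hσ : ∀ i, valid i (σ i)) (n : I → ℕ) :
    Finsupp.weight D (∑ i, n i • u i (σ i)) = ∑ i, n i • θ i := by
  rw [map_sum]
  exact Finset.sum_congr rfl fun i _ => by rw [map_nsmul, H.weight_u i _ (hσ i)]

variable (c valid u y) in
open scoped Classical in
/-- The element of degree `1` attached to a choice of homogeneous coordinates. -/
noncomputable def section_ (σ : ∀ i, J i) : A :=
  if ∀ i, valid i (σ i) then y 1 (∑ i, c i • u i (σ i)) else 0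

theorem section_eq {σ : ∀ i, J i} (h : ∀ i, valid i (σ i)) :
    section_ y c valid u σ = y 1 (∑ i, c i • u i (σ i)) :=
  if_pos h

include hy in
theorem section_mem (σ : ∀ i, J i) : section_ y c valid u σ ∈ 𝒜 1 := by
  rw [section_]
  split_ifs
  · exact hy.mem _ _
  · exact Submodule.zero_mem _

include H

theorem weight_section {σ : ∀ i, J i} (hσ : ∀ i, valid i (σ i)) :
    Finsupp.weight D (∑ i, c i • u i (σ i)) = 1 • w := by
  rw [H.weight_sum hσ, one_smul, H.w_eq]

/-- Decomposing `v` into `k * c i` exponents of each type writes the quotient of the monomial by the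
`k`-th power of the section of `σ` as a product of ratios of coordinates. -/
theorem exists_factors (σ : ∀ i, J i) (k : ℕ) (v : α →₀ ℕ)
    (hv : Finsupp.weight D v = k • w) : ∃ s : ∀ i, Multiset (J i), (∀ i, ∀ j ∈ s i, valid i j) ∧
      χ v - k • ∑ i, c i • χ (u i (σ i)) =
        ∑ i, ((s i).map fun j => χ (u i j) - χ (u i (σ i))).sum := by
  obtain ⟨s, hs, hval, rfl⟩ := H.decomp (fun i => k * c i) v (by
    rw [hv, H.w_eq, Finset.smul_sum]
    simp only [mul_smul])
  refine ⟨s, hval, ?_⟩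
  rw [map_sum, Finset.smul_sum, ← Finset.sum_sub_distrib]
  refine Finset.sum_congr rfl fun i _ => ?_
  rw [Multiset.sum_map_sub, Multiset.map_const', Multiset.sum_replicate, hs, map_multiset_sum,
    Multiset.map_map, smul_smul]
  rfl

variable {B : Type} [CommRing B] [Algebra ℂ B] {E : Multiplicative (K →₀ ℤ) →* B}
  {ψ : A →ₐ[ℂ] B} {φ : ∀ i, MvPolynomial (J i) ℂ →ₐ[ℂ] B}

attribute [local instance] MvPolynomial.gradedAlgebra

theorem map_section (hψ : ∀ k v, Finsupp.weight D v = k • w → ψ (y k v) = E (.ofAdd (χ v)))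
    {σ : ∀ i, J i} (h : ∀ i, valid i (σ i)) :
    ψ (section_ y c valid u σ) = E (.ofAdd (∑ i, c i • χ (u i (σ i)))) := by
  rw [section_eq h, hψ _ _ (H.weight_section h), map_sum]
  simp only [map_nsmul]

include hy in
-- A function on the chart is a combination of monomials divided by a power of the section, and
-- `exists_factors` turns each of these quotients into a product of ratios of coordinates.
theorem range_le [Nonempty I] (hψ : ∀ k v, Finsupp.weight D v = k • w → ψ (y k v) = E (.ofAdd (χ v)))
    (hφ : ∀ i j, valid i j → φ i (MvPolynomial.X j) = E (.ofAdd (χ (u i j))))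
    {σ : ∀ i, J i} (hσ : ∀ i, valid i (σ i)) (h : ∀ i, IsUnit (φ i (MvPolynomial.X (σ i))))
    (h' : IsUnit (ψ (section_ y c valid u σ))) :
    awayRange 𝒜 ψ h' ≤
      ⨆ i, awayRange (homogeneousSubmodule (J i) ℂ) (φ i) (h i) := by
  set S := ⨆ i, awayRange (homogeneousSubmodule (J i) ℂ) (φ i) (h i) with hS
  have hle : ∀ i, awayRange (homogeneousSubmodule (J i) ℂ) (φ i) (h i) ≤ S := fun i => le_iSup (fun i => awayRange (homogeneousSubmodule (J i) ℂ) (φ i) (h i)) i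
  intro z hz
  obtain ⟨k, a, ha, h1⟩ := exists_of_mem_awayRange _ ψ h' (section_mem hy σ) hz
  set g := ∑ i, c i • χ (u i (σ i)) with hg
  rw [H.map_section hψ hσ, ← map_pow, ← ofAdd_nsmul] at h1
  rw [← mul_map_neg E z (k • g), h1]
  have ha' := hy.span k a ha
  clear ha h1
  induction ha' using Submodule.span_induction with
  | zero =>
    rw [map_zero, zero_mul]
    exact S.zero_mem
  | add a a' _ _ h2 h3 =>
    rw [map_add, add_mul]
    exact S.add_mem h2 h3
  | smul z a _ h2 =>
    rw [map_smul, Algebra.smul_def, mul_assoc]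
    refine S.mul_mem ?_ h2
    -- Scalars belong to the ring of any one factor. Without factors the supremum would not contain
    -- them.
    obtain ⟨i⟩ := ‹Nonempty I›
    exact hle i (algebraMap_mem_awayRange _ (φ i) (h i) _)
  | mem a ha =>
    obtain ⟨v, hv, rfl⟩ := ha
    rw [hψ k v hv, ← map_mul, ← ofAdd_add, ← sub_eq_add_neg]
    obtain ⟨s, hs, hsum⟩ := H.exists_factors σ k v hv
    change _ ∈ S.toSubmonoid
    rw [hg, hsum]
    refine sum_mem_comap E _ _ fun i _ => multiset_sum_mem_comap E _ _ fun j hj => ?_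
    exact hle i (map_sub_mem_awayRange E _ (φ i) (h i) (isHomogeneous_X ℂ _) (isHomogeneous_X ℂ j)
      (hφ i _ (hσ i)) (hφ i j (hs i j hj)))

include hy in
-- As `c i` is positive, one copy of `u i (σ i)` in the exponent of the section can be replaced by
-- `u i j`. The result is again a monomial of weight `w`, and its quotient by the section is the
-- ratio of the two coordinates.
theorem le_range (hψ : ∀ k v, Finsupp.weight D v = k • w → ψ (y k v) = E (.ofAdd (χ v)))
    (hφ : ∀ i j, valid i j → φ i (MvPolynomial.X j) = E (.ofAdd (χ (u i j))))
    (hφ0 : ∀ i j, ¬ valid i j → φ i (MvPolynomial.X j) = 0)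
    {σ : ∀ i, J i} (hσ : ∀ i, valid i (σ i)) (h : ∀ i, IsUnit (φ i (MvPolynomial.X (σ i))))
    (h' : IsUnit (ψ (section_ y c valid u σ))) (i : I) :
    awayRange (homogeneousSubmodule (J i) ℂ) (φ i) (h i) ≤
      awayRange 𝒜 ψ h' := by
  set S := awayRange 𝒜 ψ h' with hS
  intro z hz
  obtain ⟨k, a, ha, h1⟩ := exists_of_mem_awayRange _ (φ i) (h i) (isHomogeneous_X ℂ (σ i)) hz
  set g := χ (u i (σ i)) with hg
  have hX : ∀ j, φ i (MvPolynomial.X j) * E (.ofAdd (-g)) ∈ S := by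
    intro j
    by_cases hj : valid i j
    · obtain ⟨v, hv⟩ := exists_add_of_le (a := u i (σ i)) (b := ∑ i, c i • u i (σ i))
        (le_trans (by
          obtain ⟨n, hn⟩ := Nat.exists_eq_succ_of_ne_zero (H.pos i).ne'
          rw [hn, succ_nsmul]
          exact le_add_self) (Finset.single_le_sum (f := fun i => c i • u i (σ i))
            (fun _ _ => zero_le) (Finset.mem_univ i)))
      have hw : Finsupp.weight D (u i j + v) = 1 • w := by
        rw [one_smul, H.w_eq, ← H.weight_sum hσ c, hv, map_add, map_add, H.weight_u i j hj,
          H.weight_u i _ (hσ i)]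
      have := map_sub_mem_awayRange E _ ψ h' (section_mem hy σ) (hy.mem 1 _)
        (H.map_section hψ hσ) (hψ 1 _ hw)
      have h4 : χ (u i j + v) - ∑ i, c i • χ (u i (σ i)) = χ (u i j) + -g := by
        have h5 := congrArg χ hv
        rw [map_sum, map_add] at h5
        simp only [map_nsmul] at h5
        rw [h5, map_add]
        abel
      rw [h4] at this
      rwa [hφ i j hj, ← map_mul, ← ofAdd_add]
    · rw [hφ0 i j hj, zero_mul]
      exact S.zero_mem
  rw [hφ i _ (hσ i), ← map_pow, ← ofAdd_nsmul] at h1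
  rw [← support_sum_monomial_coeff a, map_sum] at h1
  rw [← mul_map_neg E z (k • g), h1, Finset.sum_mul]
  refine Subring.sum_mem _ fun v hv => ?_
  have hk : k = v.degree := by
    rw [Finsupp.degree_eq_weight_one]
    exact (ha (mem_support_iff.1 hv)).symm
  have h3 : φ i (MvPolynomial.monomial v (MvPolynomial.coeff v a)) *
      E (.ofAdd (-(k • g))) = algebraMap ℂ _ (MvPolynomial.coeff v a) *
        ∏ j ∈ v.support, (φ i (MvPolynomial.X j) * E (.ofAdd (-g))) ^ v j := by
    simp only [mul_pow]
    rw [Finset.prod_mul_distrib, Finset.prod_pow_eq_pow_sum, ← Finsupp.degree_apply, ← hk,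
      ← map_pow, ← ofAdd_nsmul, ← mul_assoc, smul_neg, MvPolynomial.monomial_eq,
      map_mul, ← MvPolynomial.algebraMap_eq, AlgHom.commutes, Finsupp.prod, map_prod]
    simp only [map_pow]
  rw [h3]
  refine S.mul_mem (algebraMap_mem_awayRange _ ψ h' _) (S.prod_mem fun j _ => S.pow_mem (hX j) _)

include hy in
-- Decompose a monomial of positive degree that does not vanish at `x`, and pick for each `i` one
-- exponent that occurs in it. The section of this choice divides a power of the monomial, so it
-- does not vanish at `x` either.
theorem cover (x : Proj 𝒜) : ∃ σ : ∀ i, J i,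
    (∀ i, valid i (σ i)) ∧ x ∈ Proj.basicOpen 𝒜 (section_ y c valid u σ) := by
  obtain ⟨k, hk, v, hv, hx⟩ := hy.exists_notMem x
  obtain ⟨s, hs, hval, hsum⟩ := H.decomp (fun i => k * c i) v (by
    rw [hv, H.w_eq, Finset.smul_sum]
    simp only [mul_smul])
  have hne : ∀ i, ∃ j, j ∈ s i := fun i => Multiset.exists_mem_of_ne_zero fun h0 => by
    have h1 := hs i
    rw [h0, Multiset.card_zero] at h1
    exact (Nat.mul_pos hk (H.pos i)).ne h1
  choose σ hσ using hne
  have hσv : ∀ i, valid i (σ i) := fun i => hval i _ (hσ i)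
  refine ⟨σ, hσv, fun hmem => hx ?_⟩
  -- With this exponent the power contains the chosen exponent of type `i` at least `c i` times, for
  -- every `i`; the summand `1` keeps it positive.
  set N := 1 + ∑ i, c i with hN
  have hle : ∑ i, c i • u i (σ i) ≤ N • v := by
    rw [hsum, Finset.smul_sum]
    refine Finset.sum_le_sum fun i hi => ?_
    have h1 : c i ≤ N := (Finset.single_le_sum (f := c) (fun _ _ => zero_le) hi).trans
      (Nat.le_add_left _ _)
    refine (nsmul_le_nsmul_left zero_le h1).trans (nsmul_le_nsmul_right ?_ _)
    exact Multiset.single_le_sum (fun _ _ => zero_le) _ (Multiset.mem_map_of_mem _ (hσ i))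
  obtain ⟨v', hv'⟩ := exists_add_of_le hle
  obtain ⟨l, hl⟩ : ∃ l, N * k = 1 + l := Nat.exists_eq_add_of_le (Nat.mul_pos (by omega) hk)
  have hw' : Finsupp.weight D v' = l • w := by
    have h1 := congrArg (Finsupp.weight D) hv'
    rw [map_nsmul, map_add, hv, H.weight_sum hσv, ← H.w_eq, ← mul_smul, hl, add_smul,
      one_smul] at h1
    exact (add_left_cancel h1).symm
  have hp : y k v ^ N = section_ y c valid u σ * y l v' := by
    rw [section_eq hσv, hy.mul 1 l _ _ (H.weight_section hσv) hw', hy.pow k N v hv, hv', hl]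
  have := x.isPrime
  refine this.mem_of_pow_mem N ?_
  rw [hp]
  exact Ideal.mul_mem_right _ _ hmem

include hy in
theorem isProductEmbedding [Nonempty I] [Nontrivial B]
    (hinj : ∀ k, ∀ a ∈ 𝒜 k, ψ a = 0 → a = 0)
    (hψ : ∀ k v, Finsupp.weight D v = k • w → ψ (y k v) = E (.ofAdd (χ v)))
    (hφ : ∀ i j, valid i j → φ i (MvPolynomial.X j) = E (.ofAdd (χ (u i j))))
    (hφ0 : ∀ i j, ¬ valid i j → φ i (MvPolynomial.X j) = 0) :
    IsProductEmbedding 𝒜 (fun i => homogeneousSubmodule (J i) ℂ)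
      (fun i j => MvPolynomial.X j) ψ φ c (section_ y c valid u) where
  injective := hinj
  X_mem _ j := isHomogeneous_X ℂ j
  X_cover _ := mvPolynomial_exists_mem_basicOpen
  zero_or_isUnit i j := by
    by_cases h : valid i j
    · right
      rw [hφ i j h]
      exact isUnit_map_ofAdd E _
    · exact Or.inl (hφ0 i j h)
  pos := H.pos
  mem := section_mem hy
  map_eq σ := by
    rw [finprod_eq_prod_of_fintype]
    by_cases h : ∀ i, valid i (σ i)
    · rw [H.map_section hψ h, ofAdd_sum, map_prod]
      refine Finset.prod_congr rfl fun i _ => ?_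
      rw [hφ i _ (h i), ofAdd_nsmul, map_pow]
    · rw [section_, if_neg h, map_zero]
      push Not at h
      obtain ⟨i, hi⟩ := h
      rw [Finset.prod_eq_zero (Finset.mem_univ i)]
      rw [hφ0 i _ hi, zero_pow (H.pos i).ne']
  cover x := by
    obtain ⟨σ, hσ, hx⟩ := H.cover hy x
    exact ⟨σ, fun i => by rw [hφ i _ (hσ i)]; exact isUnit_map_ofAdd E _, hx⟩
  range_eq σ h h' := by
    have hσ : ∀ i, valid i (σ i) := fun i => by
      by_contra hv
      have h1 := h i
      rw [hφ0 i _ hv] at h1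
      exact not_isUnit_zero h1
    exact le_antisymm (H.range_le hy hψ hφ hσ h h')
      (iSup_le fun i => H.le_range hy hψ hφ hφ0 hσ h h' i)

end IsToricEmbedding

open scoped Classical in
/-- The semi-invariant `y ^ v * T ^ k`, or `0` if the weight of `v` is not `k • w`. -/
noncomputable def totalSemiMonomial (D : α → M) (w : M) (k : ℕ) (v : α →₀ ℕ) :
    semiInvariantRing D w :=
  if h : Finsupp.weight D v = k • w then semiMonomial D w k v h else 0

theorem isMonomialGrading_semiInvariantGrading :
    IsMonomialGrading (A := semiInvariantRing D w) (semiInvariantGrading D w) D w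
      (totalSemiMonomial D w) where
  mem k v := by
    rw [totalSemiMonomial]
    split_ifs
    · exact semiMonomial_mem _ _ _
    · exact (semiInvariantGrading D w k).zero_mem
  mul k l v v' h h' := by
    rw [totalSemiMonomial, totalSemiMonomial, totalSemiMonomial, dif_pos h, dif_pos h',
      dif_pos (by rw [map_add, h, h', add_smul]), semiMonomial_mul]
  pow k n v h := by
    rw [totalSemiMonomial, totalSemiMonomial, dif_pos h,
      dif_pos (by rw [map_nsmul, h, mul_smul]), semiMonomial_pow]
  span k a ha := by
    rw [eq_sum_semiMonomial k a ha]
    refine Submodule.sum_mem _ fun v _ => Submodule.smul_mem _ _ (Submodule.subset_span ?_)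
    have hv := a.2 k (mem_support_iff.1 v.2)
    exact ⟨v.1, hv, dif_pos hv⟩

open Limits YShapedQuiver

attribute [local instance] MvPolynomial.gradedAlgebra

theorem IsToricEmbedding.nonempty_image_iso [Nonempty I] {θ : I → M} {c : I → ℕ}
    {valid : ∀ i, J i → Prop} {u : ∀ i, J i → α →₀ ℕ} (H : IsToricEmbedding D w χ θ c valid u)
    {φ : ∀ i, MvPolynomial (J i) ℂ →ₐ[ℂ] AddMonoidAlgebra ℂ (K →₀ ℤ)}
    (hφ : ∀ i j, valid i j → φ i (MvPolynomial.X j) = AddMonoidAlgebra.single (χ (u i j)) 1)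
    (hφ0 : ∀ i j, ¬ valid i j → φ i (MvPolynomial.X j) = 0)
    (hne : ∀ i, ∃ j, IsUnit (φ i (MvPolynomial.X j)))
    (hirr : ∀ i, (HomogeneousIdeal.irrelevant (homogeneousSubmodule (J i) ℂ)).toIdeal.map
      (((Scheme.ΓSpecIso (.of (AddMonoidAlgebra ℂ (K →₀ ℤ)))).inv.hom).comp
        (φ i : _ →+* AddMonoidAlgebra ℂ (K →₀ ℤ))) = ⊤) :
    Nonempty (Over.mk ((Pi.lift fun i =>
        specToProj (homogeneousSubmodule (J i) ℂ) (φ i) (hirr i)).left.imageι ≫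
      (∏ᶜ fun i => projOver (homogeneousSubmodule (J i) ℂ)).hom) ≅ toricGITQuotient D w) :=
  (H.isProductEmbedding (A := semiInvariantRing D w) (E := AddMonoidAlgebra.of ℂ (K →₀ ℤ))
    isMonomialGrading_semiInvariantGrading (toricMap_injective H.inj)
    (fun k v h => by
      rw [totalSemiMonomial, dif_pos h]
      exact toricMap_semiMonomial k v h) hφ hφ0).nonempty_image_iso hne hirr

end Toric

namespace YShapedQuiver
variable (Q : YShapedQuiver)

/-- The theorem is reduced to combinatorics here: exponents of arrows have to be found whose
characters under `χ` are the nonzero initial terms. -/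
theorem nonempty_iso_of_isToricEmbedding
    {χ : (Q.Arrow →₀ ℕ) →+ (Q.Coord →₀ ℤ)} {θ : {i : Q.V // i ≠ 0} → Q.CharacterLattice}
    {c : {i : Q.V // i ≠ 0} → ℕ} {valid : ∀ i : {i : Q.V // i ≠ 0}, Q.Plucker i.1 → Prop}
    {u : ∀ i : {i : Q.V // i ≠ 0}, Q.Plucker i.1 → Q.Arrow →₀ ℕ}
    (H : IsToricEmbedding Q.arrowWeight (∑ a, Q.arrowWeight a) χ θ c valid u)
    (hφ : ∀ i j, valid i j → Q.toLaurent (Q.initialTerm i.1 j) =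
      AddMonoidAlgebra.single (χ (u i j)) 1)
    (hφ0 : ∀ i j, ¬ valid i j → Q.initialTerm i.1 j = 0) : Nonempty (Q.Y ≅ Q.X) := by
  have : Nonempty {i : Q.V // i ≠ 0} := ⟨⟨1, one_ne_zero⟩⟩
  have hX : ∀ i j, Q.coordMap i (MvPolynomial.X j) = Q.toLaurent (Q.initialTerm i j) :=
    fun i j => MvPolynomial.aeval_X _ _
  exact H.nonempty_image_iso (φ := fun i => Q.coordMap i.1)
    (fun i j h => (hX i.1 j).trans (hφ i j h))
    (fun i j h => by rw [hX, hφ0 i j h, map_zero])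
    (fun i => Q.exists_isUnit_coordMap i.1) (fun i => Q.irrelevant_map_coordMap i.1)

end YShapedQuiver

namespace YShapedQuiver

/-! ### Initial terms of the maximal minors -/

section InitialTerms

variable {Q : YShapedQuiver}

open scoped Classical in
variable (Q) in
/-- The column of `A_i` is shifted by this number to obtain the column of the block of `v`. -/
noncomputable def colShift (i v : Q.V) : ℤ :=
  if i ∈ Q.S₁ then (Q.sTilde v : ℤ) - Q.sTilde i else 0

theorem A_eq_zero_or (i : Q.V) (p : Q.Row i) (k : Fin (Q.sTilde i)) : Q.A i p k = 0 ∨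
    ∃ x : Q.Coord, Q.A i p k = MvPolynomial.X x ∧ x.newRow = p.1 ∧
      (x.col.val : ℤ) = k.val + Q.colShift i p.1.v := by
  classical
  by_cases hi : i ∈ Q.S₁
  · simp only [A, if_pos hi, colShift]
    split_ifs with h
    · exact Or.inr ⟨_, rfl, rfl, by simp only; omega⟩
    · exact Or.inl rfl
  · simp only [A, if_neg hi, colShift]
    split_ifs with h
    · exact Or.inr ⟨_, rfl, rfl, by simp⟩
    · exact Or.inl rfl

theorem A_ne_zero_iff_of_mem {i : Q.V} (hi : i ∈ Q.S₁) (p : Q.Row i) (k : Fin (Q.sTilde i)) :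
    Q.A i p k ≠ 0 ↔ Q.sTilde i ≤ k.val + Q.sTilde p.1.v := by
  classical
  simp only [A, if_pos hi]
  split_ifs with h <;> simp [h]

theorem A_ne_zero_iff_of_notMem {i : Q.V} (hi : i ∉ Q.S₁) (p : Q.Row i) (k : Fin (Q.sTilde i)) :
    Q.A i p k ≠ 0 ↔ k.val < Q.sTilde p.1.v := by
  classical
  simp only [A, if_neg hi]
  split_ifs with h <;> simp [h]

theorem sTilde_le_of_reach {q i : Q.V} (h : Q.Reach q i) : Q.sTilde q ≤ Q.sTilde i := by
  induction h with
  | refl => exact le_rfl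
  | @tail b c _ hbc ih =>
    refine ih.trans ?_
    have hc : c ≠ 0 := fun h0 => by
      have := Q.acyclic b c hbc
      rw [h0] at this
      exact absurd this (by simp)
    rw [sTilde_eq hc]
    exact (Nat.le_mul_of_pos_left _ (Nat.pos_of_ne_zero hbc)).trans
      (Finset.single_le_sum (f := fun j => Q.n j c * Q.sTilde j) (fun _ _ => Nat.zero_le _)
        (Finset.mem_univ b))

/-- The zero entries of `A_i` below the diagonal (on the left) for `i` in `S₁`. -/
theorem A_eq_zero_of_mem {i : Q.V} (hi : i ∈ Q.S₁) {p q : Q.Row i} (hpq : p ≤ q)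
    {k l : Fin (Q.sTilde i)} (hlk : l ≤ k) (h : Q.A i p k = 0) : Q.A i q l = 0 := by
  by_contra hne
  rw [← ne_eq, A_ne_zero_iff_of_mem hi] at hne
  refine (A_ne_zero_iff_of_mem hi p k).2 ?_ h
  have h1 : Q.sTilde q.1.v ≤ Q.sTilde p.1.v := by
    rcases hpq.eq_or_lt with rfl | hlt
    · exact le_rfl
    · have hlt' : p.1 < q.1 := hlt
      rw [newRow_lt_iff] at hlt'
      rcases hlt' with h | ⟨h, _⟩
      · exact sTilde_le_of_reach (reach_of_rank_lt hi p.1.hv q.1.hv p.2 q.2 h).1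
      · rw [h]
  rw [Fin.le_def] at hlk
  omega

/-- Here the zero entries form a staircase in the upper right corner, as the shorter rows come
first. -/
theorem A_eq_zero_of_notMem {i : Q.V} (hi : i ∉ Q.S₁) {p q : Q.Row i} (hpq : q ≤ p)
    {k l : Fin (Q.sTilde i)} (hlk : k ≤ l) (h : Q.A i p k = 0) : Q.A i q l = 0 := by
  by_contra hne
  rw [← ne_eq, A_ne_zero_iff_of_notMem hi] at hne
  refine (A_ne_zero_iff_of_notMem hi p k).2 ?_ h
  have h1 : Q.sTilde q.1.v ≤ Q.sTilde p.1.v := by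
    rcases hpq.eq_or_lt with rfl | hlt
    · exact le_rfl
    · have hlt' : q.1 < p.1 := hlt
      rw [newRow_lt_iff] at hlt'
      rcases hlt' with h | ⟨h, _⟩
      · exact sTilde_le_of_reach (reach_of_rank_lt' hi q.1.hv p.1.hv q.2 p.2 h).1
      · rw [h]
  rw [Fin.le_def] at hlk
  omega

/-- By the pigeonhole principle, the elements up to `a` cannot be mapped injectively into the
elements below `a`. -/
theorem _root_.Equiv.Perm.exists_le_le {α : Type} [LinearOrder α] [Fintype α] (τ : Equiv.Perm α)
    (a : α) : ∃ p, p ≤ a ∧ a ≤ τ p := by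
  classical
  by_contra! h
  have h1 : (Finset.univ.filter (· ≤ a)).card ≤ (Finset.univ.filter (· < a)).card :=
    Finset.card_le_card_of_injOn τ (fun p hp => by simpa using h p (by simpa using hp))
      τ.injective.injOn
  have h2 : (Finset.univ.filter (· < a)) ⊂ (Finset.univ.filter (· ≤ a)) := by
    refine ⟨fun p hp => ?_, fun hs => ?_⟩
    · simpa using (by simpa using hp : p < a).le
    · simpa using hs (by simp : a ∈ _)
  exact absurd (Finset.card_lt_card h2) (by omega)

/-- The zero on the diagonal spreads to a corner rectangle of zeros that is too large for a
permutation to avoid. So every term of the determinant vanishes. -/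
theorem minor_eq_zero {i : Q.V} {σ : Q.Plucker i} {p : Q.Row i} (h : Q.A i p (σ p) = 0) :
    Q.minor i σ = 0 := by
  classical
  rw [minor, Matrix.det_apply]
  refine Finset.sum_eq_zero fun τ _ => ?_
  have h0 : ∃ q, Q.A i (τ q) (σ q) = 0 := by
    by_cases hi : i ∈ Q.S₁
    · obtain ⟨q, hq, hq'⟩ := τ.exists_le_le p
      exact ⟨q, A_eq_zero_of_mem hi hq' (σ.monotone hq) h⟩
    · obtain ⟨q, hq, hq'⟩ := (τ⁻¹).exists_le_le p
      refine ⟨τ⁻¹ q, A_eq_zero_of_notMem hi ?_ (σ.monotone hq') h⟩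
      simpa using hq
  obtain ⟨q, hq⟩ := h0
  rw [Finset.prod_eq_zero (Finset.mem_univ q), smul_zero]
  exact hq

/-- Both monomials contain one coordinate from every row, and the variables are ordered row by row.
So the first row in which they differ decides, and there the smaller element of `Coord` is the
larger variable. -/
theorem sum_single_lt {i : Q.V} (x z : Q.Row i → Q.Coord) (hx : ∀ p, (x p).newRow = p.1)
    (hz : ∀ p, (z p).newRow = p.1) (q : Q.Row i) (hlt : ∀ p < q, z p = x p) (hq : x q < z q) :
    toLex (∑ p, Finsupp.single (z p) 1 : Q.Coord →₀ ℕ) < toLex (∑ p, Finsupp.single (x p) 1) := by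
  classical
  have hrow : ∀ c c' : Q.Coord, c.newRow < c'.newRow → c < c' := fun c c' h =>
    (Prod.Lex.toLex_lt_toLex).2 (Or.inl h)
  have hev : ∀ (y : Q.Row i → Q.Coord) (j : Q.Coord),
      (∑ p, Finsupp.single (y p) 1 : Q.Coord →₀ ℕ) j = ∑ p, if y p = j then 1 else 0 := by
    intro y j
    rw [Finsupp.finsetSum_apply]
    exact Finset.sum_congr rfl fun p _ => Finsupp.single_apply
  rw [Finsupp.Lex.lt_iff]
  refine ⟨x q, fun j hj => ?_, ?_⟩
  · change (∑ p, Finsupp.single (z p) 1 : Q.Coord →₀ ℕ) j = (∑ p, Finsupp.single (x p) 1 : Q.Coord →₀ ℕ) j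
    rw [hev, hev]
    refine Finset.sum_congr rfl fun p _ => ?_
    rcases lt_trichotomy p q with h | rfl | h
    · rw [hlt p h]
    · rw [if_neg (hj.trans hq).ne', if_neg hj.ne']
    · rw [if_neg, if_neg]
      · exact (hj.trans (hrow _ _ (by rw [hx, hx]; exact h))).ne'
      · exact (hj.trans (hrow _ _ (by rw [hx, hz]; exact h))).ne'
  · change (∑ p, Finsupp.single (z p) 1 : Q.Coord →₀ ℕ) (x q) <
      (∑ p, Finsupp.single (x p) 1 : Q.Coord →₀ ℕ) (x q)
    rw [hev, hev]
    rw [Finset.sum_eq_zero]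
    · exact Finset.sum_pos' (fun _ _ => Nat.zero_le _) ⟨q, Finset.mem_univ q, by simp⟩
    · intro p _
      refine if_neg fun h => ?_
      have h1 : p = q := Subtype.ext (by rw [← hz p, h, hx])
      subst h1
      exact hq.ne' h

theorem _root_.Equiv.Perm.exists_first {α : Type} [LinearOrder α] [Finite α] (π : Equiv.Perm α)
    (h : π ≠ 1) : ∃ q, (∀ p < q, π p = p) ∧ q < π q := by
  have hne : {q | π q ≠ q}.Nonempty := by
    by_contra hn
    rw [Set.not_nonempty_iff_eq_empty] at hn
    refine h (Equiv.ext fun q => ?_)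
    by_contra hq
    exact (Set.eq_empty_iff_forall_notMem.1 hn q) hq
  obtain ⟨q, hq, hmin⟩ := Set.exists_min_image _ id (Set.toFinite _) hne
  have hlt : ∀ p < q, π p = p := fun p hp => by
    by_contra hpp
    exact absurd (hmin p hpp) (not_le.2 hp)
  refine ⟨q, hlt, lt_of_le_of_ne ?_ (Ne.symm hq)⟩
  by_contra hcon
  have := hlt _ (not_le.1 hcon)
  exact hq (π.injective this)

/-- In the first row where a permutation differs from the identity, it uses a column further to the
right, that is, a smaller variable. Hence the diagonal term is leading, with coefficient `1`,
whatever happens among the other terms. -/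
theorem initialTerm_eq {i : Q.V} {σ : Q.Plucker i} (x : Q.Row i → Q.Coord)
    (hx : ∀ p, Q.A i p (σ p) = MvPolynomial.X (x p)) (hrow : ∀ p, (x p).newRow = p.1) :
    Q.initialTerm i σ = MvPolynomial.monomial (∑ p, Finsupp.single (x p) 1) 1 := by
  classical
  set d := (∑ p, Finsupp.single (x p) 1 : Q.Coord →₀ ℕ) with hd
  have hprod : ∀ y : Q.Row i → Q.Coord, ∏ p, (MvPolynomial.X (y p) : MvPolynomial Q.Coord ℂ) =
      MvPolynomial.monomial (∑ p, Finsupp.single (y p) 1) 1 := by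
    intro y
    rw [MvPolynomial.monomial_sum_one]
    rfl
  have hterm : ∀ τ : Equiv.Perm (Q.Row i), τ ≠ 1 → ∀ e ∈ (∏ p, Q.A i (τ p) (σ p)).support,
      toLex e < toLex d := by
    intro τ hτ e he
    have hτ' : τ⁻¹ ≠ 1 := fun h => hτ (inv_eq_one.1 h)
    -- The product is reindexed by rows, since the monomial order compares row by row; this replaces
    -- `τ` by its inverse.
    have hre : ∏ p, Q.A i (τ p) (σ p) = ∏ p, Q.A i p (σ (τ⁻¹ p)) := by
      rw [← Equiv.prod_comp τ (fun p => Q.A i p (σ (τ⁻¹ p)))]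
      simp
    rw [hre] at he
    have hne : ∀ p, Q.A i p (σ (τ⁻¹ p)) ≠ 0 := fun p h0 => by
      rw [Finset.prod_eq_zero (Finset.mem_univ p) h0] at he
      simp at he
    choose z hz hzr hzc using fun p => (A_eq_zero_or i p (σ (τ⁻¹ p))).resolve_left (hne p)
    simp only [hz] at he
    rw [hprod] at he
    have he' := MvPolynomial.support_monomial_subset he
    rw [Finset.mem_singleton] at he'
    subst he'
    obtain ⟨q, hq1, hq2⟩ := (τ⁻¹).exists_first hτ'
    refine sum_single_lt x z hrow hzr q (fun p hp => ?_) ?_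
    · have := hz p
      rw [hq1 p hp, hx] at this
      exact (MvPolynomial.X_injective this).symm
    · rcases A_eq_zero_or i q (σ q) with h0 | ⟨c, hc, hcr, hcc⟩
      · rw [hx] at h0
        exact absurd h0 (MvPolynomial.X_ne_zero _)
      · rw [hx] at hc
        obtain rfl := MvPolynomial.X_injective hc
        refine (Prod.Lex.toLex_lt_toLex).2 (Or.inr ⟨?_, ?_⟩)
        · exact congrArg NewRow.key ((hrow q).trans (hzr q).symm)
        · have := σ.strictMono hq2
          rw [Fin.lt_def] at this
          have := hzc q
          simp only
          omega
  have hm : Q.minor i σ = MvPolynomial.monomial d 1 +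
      ∑ τ ∈ Finset.univ.erase (1 : Equiv.Perm (Q.Row i)),
        Equiv.Perm.sign τ • ∏ p, Q.A i (τ p) (σ p) := by
    rw [minor, Matrix.det_apply, ← Finset.add_sum_erase _ _ (Finset.mem_univ 1)]
    congr 1
    rw [Equiv.Perm.sign_one, one_smul, hd, ← hprod]
    exact Finset.prod_congr rfl fun p _ => hx p
  have hrest : ∀ e, ¬ toLex e < toLex d → MvPolynomial.coeff e
      (∑ τ ∈ Finset.univ.erase (1 : Equiv.Perm (Q.Row i)),
        Equiv.Perm.sign τ • ∏ p, Q.A i (τ p) (σ p)) = 0 := by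
    intro e he
    rw [MvPolynomial.coeff_sum]
    refine Finset.sum_eq_zero fun τ hτ => ?_
    have h0 : MvPolynomial.coeff e (∏ p, Q.A i (τ p) (σ p)) = 0 := by
      by_contra h0
      exact he (hterm τ (Finset.ne_of_mem_erase hτ) e (MvPolynomial.mem_support_iff.2 h0))
    rcases Int.units_eq_one_or (Equiv.Perm.sign τ) with h | h <;> rw [h] <;> simp [h0]
  have hcd : MvPolynomial.coeff d (Q.minor i σ) = 1 := by
    rw [hm, MvPolynomial.coeff_add, hrest d (lt_irrefl _), MvPolynomial.coeff_monomial, if_pos rfl,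
      add_zero]
  have hdeg : MonomialOrder.lex.degree (Q.minor i σ) = d := by
    refine MonomialOrder.lex.toSyn.injective (le_antisymm ?_ ?_)
    · rw [MonomialOrder.degree_le_iff]
      intro e he
      rw [MonomialOrder.lex_le_iff]
      by_contra hcon
      rw [MvPolynomial.mem_support_iff, hm, MvPolynomial.coeff_add,
        hrest e (not_lt.2 (not_le.1 hcon).le), add_zero, MvPolynomial.coeff_monomial,
        if_neg] at he
      · exact he rfl
      · rintro rfl
        exact hcon le_rfl
    · exact MonomialOrder.le_degree (by
        rw [MvPolynomial.mem_support_iff, hcd]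
        exact one_ne_zero)
  rw [initialTerm, MonomialOrder.leadingTerm, MonomialOrder.leadingCoeff, hdeg, hcd]

theorem initialTerm_eq_zero {i : Q.V} {σ : Q.Plucker i} {p : Q.Row i} (h : Q.A i p (σ p) = 0) :
    Q.initialTerm i σ = 0 := by
  rw [initialTerm, minor_eq_zero h]
  simp

end InitialTerms

end YShapedQuiver

namespace YShapedQuiver

/-! ### Flows on arrows and flows on the edges of the diagram -/

section Flows

variable {Q : YShapedQuiver}

/-- The pairs of consecutive points of a list. -/
def edgeList (l : List (ℤ × ℤ)) : List ((ℤ × ℤ) × (ℤ × ℤ)) := l.zip l.tail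

theorem edgeList_cons_cons (P P' : ℤ × ℤ) (l : List (ℤ × ℤ)) :
    edgeList (P :: P' :: l) = (P, P') :: edgeList (P' :: l) := rfl

/-- The points of the diagram that an arrow of the ladder quiver passes through. -/
def Arrow.points (a : Q.Arrow) : List (ℤ × ℤ) := a.src.1 :: a.inner ++ [a.tgt.1]

theorem Arrow.points_injective : Function.Injective (Arrow.points (Q := Q)) := by
  rintro ⟨s, t, m, h1, h2⟩ ⟨s', t', m', h1', h2'⟩ h
  simp only [points, List.cons_append, List.cons.injEq] at h
  obtain ⟨hs, h⟩ := h
  obtain ⟨rfl, ht⟩ := List.append_inj' h rfl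
  obtain rfl := Subtype.ext hs
  obtain rfl := Subtype.ext (List.singleton_inj.1 ht)
  rfl

/-- The edges of an arrow of the ladder quiver, with multiplicities. -/
noncomputable def Arrow.edgeVec (a : Q.Arrow) : ((ℤ × ℤ) × (ℤ × ℤ)) →₀ ℕ :=
  Multiset.toFinsupp (edgeList a.points : Multiset _)

variable (Q) in
/-- The flow on the edges of the diagram that is given by a flow on the arrows of the ladder quiver. -/
noncomputable def flow : (Q.Arrow →₀ ℕ) →ₗ[ℕ] ((ℤ × ℤ) × (ℤ × ℤ)) →₀ ℕ :=
  Finsupp.linearCombination ℕ Arrow.edgeVec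

/-- The sum of the differences of `φ` along the edges. -/
noncomputable def boundary {M : Type} [AddCommGroup M] (φ : ℤ × ℤ → M) :
    (((ℤ × ℤ) × (ℤ × ℤ)) →₀ ℕ) →ₗ[ℕ] M :=
  Finsupp.linearCombination ℕ fun e => φ e.2 - φ e.1

theorem boundary_edgeList {M : Type} [AddCommGroup M] (φ : ℤ × ℤ → M) (P P' : ℤ × ℤ)
    (l : List (ℤ × ℤ)) :
    boundary φ (Multiset.toFinsupp (edgeList (P :: l ++ [P']) : Multiset _)) = φ P' - φ P := by
  induction l generalizing P with
  | nil =>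
    change boundary φ (Multiset.toFinsupp {(P, P')}) = _
    rw [Multiset.toFinsupp_singleton, boundary, Finsupp.linearCombination_single, one_smul]
  | cons q l ih =>
    have h := ih q
    rw [List.cons_append, List.cons_append, edgeList_cons_cons, ← Multiset.cons_coe,
      ← Multiset.singleton_add, map_add, map_add]
    rw [List.cons_append] at h
    rw [h, Multiset.toFinsupp_singleton, boundary, Finsupp.linearCombination_single, one_smul]
    abel

theorem boundary_flow {M : Type} [AddCommGroup M] (φ : ℤ × ℤ → M) (u : Q.Arrow →₀ ℕ) :
    boundary φ (Q.flow u) =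
      Finsupp.linearCombination ℕ (fun a : Q.Arrow => φ a.tgt.1 - φ a.src.1) u := by
  rw [← LinearMap.comp_apply]
  congr 1
  refine Finsupp.lhom_ext' fun a => LinearMap.ext_ring ?_
  simp only [LinearMap.comp_apply, Finsupp.lsingle_apply, Finsupp.linearCombination_single,
    one_smul, flow]
  exact boundary_edgeList φ _ _ _

/-- Classification of the points that are not vertices into merging and splitting ones. -/
structure IsForked (Q : YShapedQuiver) (Mg : Set (ℤ × ℤ)) : Prop where
  notMem : ∀ P ∈ Mg, P ∉ Q.vertices
  out_unique : ∀ P ∈ Mg, ∀ P₁ P₂, Q.Step P P₁ → Q.Step P P₂ → P₁ = P₂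
  in_unique : ∀ P, P ∉ Q.vertices → P ∉ Mg → ∀ P₁ P₂, Q.Step P₁ P → Q.Step P₂ P → P₁ = P₂
  -- A path that has met a merging point stays at merging points up to the next vertex. So an arrow
  -- passes through splitting points first and through merging points afterwards.
  next : ∀ P ∈ Mg, ∀ P', Q.Step P P' → P' ∈ Q.vertices ∨ P' ∈ Mg
  exists_out : ∀ P P', P' ∉ Q.vertices → Q.Step P P' → ∃ P'', Q.Step P' P''
  exists_in : ∀ P P', P ∉ Q.vertices → Q.Step P P' → ∃ P'', Q.Step P'' P

/-- The list of the points after `P` up to the first vertex. -/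
inductive Fwd (Q : YShapedQuiver) : ℤ × ℤ → List (ℤ × ℤ) → Prop
  | nil {P} (h : P ∈ Q.vertices) : Fwd Q P []
  | cons {P P' l} (h : P ∉ Q.vertices) (hs : Q.Step P P') (hl : Fwd Q P' l) : Fwd Q P (P' :: l)

/-- The list of the points before `P`, back to the first vertex. -/
inductive Bwd (Q : YShapedQuiver) : ℤ × ℤ → List (ℤ × ℤ) → Prop
  | nil {P} (h : P ∈ Q.vertices) : Bwd Q P []
  | cons {P P' l} (h : P ∉ Q.vertices) (hs : Q.Step P' P) (hl : Bwd Q P' l) : Bwd Q P (P' :: l)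

theorem fwd_of_isChain {P t : ℤ × ℤ} {l : List (ℤ × ℤ)} (h : List.IsChain Q.Step (P :: l ++ [t]))
    (hP : P ∉ Q.vertices) (hl : ∀ P ∈ l, P ∉ Q.vertices) (ht : t ∈ Q.vertices) :
    Q.Fwd P (l ++ [t]) := by
  induction l generalizing P with
  | nil => exact .cons hP (List.isChain_cons_cons.1 h).1 (.nil ht)
  | cons q l ih =>
    exact .cons hP (List.isChain_cons_cons.1 h).1 (ih (List.isChain_cons_cons.1 h).2
      (hl q List.mem_cons_self) fun P hP => hl P (List.mem_cons_of_mem q hP))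

theorem Fwd.exists_eq {P : ℤ × ℤ} {l : List (ℤ × ℤ)} (h : Q.Fwd P l) :
    ∃ m, ∃ t ∈ Q.vertices, P :: l = m ++ [t] ∧ (∀ P ∈ m, P ∉ Q.vertices) ∧
      List.IsChain Q.Step (P :: l) := by
  induction h with
  | @nil P h => exact ⟨[], P, h, rfl, by simp, List.isChain_singleton P⟩
  | @cons P P' l h hs hl ih =>
    obtain ⟨m, t, ht, h1, h2, h3⟩ := ih
    refine ⟨P :: m, t, ht, by rw [h1]; rfl, ?_, List.isChain_cons_cons.2 ⟨hs, h3⟩⟩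
    intro R hR
    rcases List.mem_cons.1 hR with rfl | hR
    · exact h
    · exact h2 R hR

theorem Bwd.exists_eq {P : ℤ × ℤ} {l : List (ℤ × ℤ)} (h : Q.Bwd P l) :
    ∃ m, ∃ s ∈ Q.vertices, l.reverse ++ [P] = s :: m ∧ (∀ P ∈ m, P ∉ Q.vertices) ∧
      List.IsChain Q.Step (l.reverse ++ [P]) := by
  induction h with
  | @nil P h => exact ⟨[], P, h, rfl, by simp, List.isChain_singleton P⟩
  | @cons P P' l h hs hl ih =>
    obtain ⟨m, s, hsv, h1, h2, h3⟩ := ih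
    refine ⟨m ++ [P], s, hsv, by rw [List.reverse_cons, h1]; rfl, ?_, ?_⟩
    · intro R hR
      rcases List.mem_append.1 hR with hR | hR
      · exact h2 R hR
      · rw [List.mem_singleton.1 hR]
        exact h
    · rw [List.reverse_cons]
      refine List.IsChain.append h3 (List.isChain_singleton P) ?_
      intro x hx y hy
      simp only [List.getLast?_append, List.getLast?_singleton, List.head?_cons,
        Option.mem_def, Option.some.injEq, Option.some_or] at hx hy
      subst hx hy
      exact hs

theorem exists_arrow {P P' : ℤ × ℤ} {l l' : List (ℤ × ℤ)} (h : Q.Bwd P l) (hs : Q.Step P P')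
    (h' : Q.Fwd P' l') : ∃ a : Q.Arrow, a.points = l.reverse ++ P :: P' :: l' := by
  obtain ⟨m, s, hsv, h1, h2, h3⟩ := h.exists_eq
  obtain ⟨m', t, ht, h1', h2', h3'⟩ := h'.exists_eq
  have e : s :: (m ++ m') ++ [t] = l.reverse ++ P :: P' :: l' := by
    have : l.reverse ++ P :: P' :: l' = (l.reverse ++ [P]) ++ (P' :: l') := by simp
    rw [this, h1, h1']
    simp
  refine ⟨⟨⟨s, hsv⟩, ⟨t, ht⟩, m ++ m', ?_, ?_⟩, e⟩
  · change List.IsChain Q.Step (s :: (m ++ m') ++ [t])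
    rw [e]
    have : l.reverse ++ P :: P' :: l' = (l.reverse ++ [P]) ++ (P' :: l') := by simp
    rw [this]
    refine List.IsChain.append h3 h3' ?_
    intro x hx y hy
    simp only [List.getLast?_append, List.getLast?_singleton, List.head?_cons,
        Option.mem_def, Option.some.injEq, Option.some_or] at hx hy
    subst hx hy
    exact hs
  · intro R hR
    rcases List.mem_append.1 hR with hR | hR
    · exact h2 R hR
    · exact h2' R hR

theorem split_of_mem {P t R R' : ℤ × ℤ} {l m : List (ℤ × ℤ)} (hl : Q.Bwd P l)
    (h : List.IsChain Q.Step (P :: m ++ [t])) (hm : ∀ P ∈ m, P ∉ Q.vertices) (ht : t ∈ Q.vertices)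
    (he : (R, R') ∈ edgeList (P :: m ++ [t])) : ∃ l₁ l₂, Q.Bwd R l₁ ∧ Q.Fwd R' l₂ ∧ Q.Step R R' ∧
      l.reverse ++ (P :: m ++ [t]) = l₁.reverse ++ R :: R' :: l₂ := by
  induction m generalizing P l with
  | nil =>
    change (R, R') ∈ [(P, t)] at he
    rw [List.mem_singleton, Prod.mk.injEq] at he
    obtain ⟨rfl, rfl⟩ := he
    exact ⟨l, [], hl, .nil ht, (List.isChain_cons_cons.1 h).1, rfl⟩
  | cons q m ih =>
    rw [List.cons_append, List.cons_append] at he h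
    rw [edgeList_cons_cons, List.mem_cons] at he
    have hq := hm q List.mem_cons_self
    have hm' : ∀ P ∈ m, P ∉ Q.vertices := fun P hP => hm P (List.mem_cons_of_mem q hP)
    obtain ⟨h1, h2⟩ := List.isChain_cons_cons.1 h
    rcases he with he | he
    · rw [Prod.mk.injEq] at he
      obtain ⟨rfl, rfl⟩ := he
      exact ⟨l, m ++ [t], hl, fwd_of_isChain h2 hq hm' ht, h1, rfl⟩
    · obtain ⟨l₁, l₂, h3, h4, h5, h6⟩ := ih (.cons hq h1 hl) h2 hm' he
      refine ⟨l₁, l₂, h3, h4, h5, ?_⟩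
      rw [← h6]
      simp

theorem Arrow.split (a : Q.Arrow) {R R' : ℤ × ℤ} (he : (R, R') ∈ edgeList a.points) :
    ∃ l₁ l₂, Q.Bwd R l₁ ∧ Q.Fwd R' l₂ ∧ Q.Step R R' ∧ a.points = l₁.reverse ++ R :: R' :: l₂ :=
  split_of_mem (l := []) (.nil a.src.2) a.isPath a.inner_notMem a.tgt.2 he

theorem mem_edgeList_append (l l' : List (ℤ × ℤ)) (P P' : ℤ × ℤ) :
    (P, P') ∈ edgeList (l ++ P :: P' :: l') := by
  induction l with
  | nil => exact List.mem_cons_self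
  | cons q l ih =>
    cases l with
    | nil => exact List.mem_cons_of_mem _ ih
    | cons q' l => exact List.mem_cons_of_mem _ ih

theorem edgeList_map_fst (l : List (ℤ × ℤ)) : (edgeList l).map Prod.fst = l.dropLast := by
  induction l with
  | nil => rfl
  | cons a l ih =>
    cases l with
    | nil => rfl
    | cons b l => rw [edgeList_cons_cons, List.map_cons, ih]; rfl

theorem Arrow.nodup_edgeList (a : Q.Arrow) : (edgeList a.points).Nodup := by
  refine List.Nodup.of_map Prod.fst ?_
  rw [edgeList_map_fst, points, List.dropLast_concat]
  exact (Q.chain_props _ _ a.isPath).1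

theorem Arrow.edgeVec_apply (a : Q.Arrow) (e : (ℤ × ℤ) × (ℤ × ℤ)) [Decidable (e ∈ edgeList a.points)] :
    a.edgeVec e = if e ∈ edgeList a.points then 1 else 0 := by
  rw [edgeVec, Multiset.toFinsupp_apply]
  split_ifs with h
  · exact Multiset.count_eq_one_of_mem (Multiset.coe_nodup.2 a.nodup_edgeList) h
  · exact Multiset.count_eq_zero.2 h

theorem step_of_flow_ne_zero {u : Q.Arrow →₀ ℕ} {e : (ℤ × ℤ) × (ℤ × ℤ)} (h : Q.flow u e ≠ 0) :
    Q.Step e.1 e.2 := by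
  classical
  rw [flow, Finsupp.linearCombination_apply, Finsupp.sum_apply] at h
  obtain ⟨a, _, ha⟩ := Finset.exists_ne_zero_of_sum_ne_zero h
  simp only [Finsupp.smul_apply, Arrow.edgeVec_apply, smul_eq_mul] at ha
  have he : e ∈ edgeList a.points := by
    by_contra hn
    simp [hn] at ha
  obtain ⟨_, _, _, _, hs, _⟩ := a.split he
  exact hs

/-- The edges that are neither forced by the point after it nor by the point before it. -/
def IsPrivate (Q : YShapedQuiver) (Mg : Set (ℤ × ℤ)) (e : (ℤ × ℤ) × (ℤ × ℤ)) : Prop :=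
  Q.Step e.1 e.2 ∧ e.1 ∉ Mg ∧ (e.2 ∈ Q.vertices ∨ e.2 ∈ Mg)

namespace IsForked

variable {Mg : Set (ℤ × ℤ)} (H : Q.IsForked Mg)

include H

/-- A merging point has a single exit, and this exit leads to a vertex or to another merging point.
So the way forward is forced. -/
theorem fwd_unique {P : ℤ × ℤ} {l l' : List (ℤ × ℤ)} (h : Q.Fwd P l) (h' : Q.Fwd P l')
    (hP : P ∈ Q.vertices ∨ P ∈ Mg) : l = l' := by
  induction h generalizing l' with
  | @nil P h =>
    cases h' with
    | nil => rfl
    | cons hn => exact absurd h hn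
  | @cons P P' l h hs hl ih =>
    have hM := hP.resolve_left h
    cases h' with
    | nil hn => exact absurd hn h
    | @cons _ P'' l' _ hs' hl' =>
      obtain rfl := H.out_unique P hM _ _ hs hs'
      rw [ih hl' (H.next P hM _ hs)]

/-- A splitting point has a single entry, and it cannot be entered from a merging point by `next`.
So the way back is forced. -/
theorem bwd_unique {P : ℤ × ℤ} {l l' : List (ℤ × ℤ)} (h : Q.Bwd P l) (h' : Q.Bwd P l')
    (hP : P ∉ Mg) : l = l' := by
  induction h generalizing l' with
  | @nil P h =>
    cases h' with
    | nil => rfl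
    | cons hn => exact absurd h hn
  | @cons P P' l h hs hl ih =>
    cases h' with
    | nil hn => exact absurd hn h
    | @cons _ P'' l' _ hs' hl' =>
      obtain rfl := H.in_unique P h hP _ _ hs hs'
      rw [ih hl' fun hM => ((H.next _ hM P hs).elim h hP)]

/-- Each step raises the sum of the coordinates, which is bounded on the finite diagram. The walk
must end, and it can only end at a vertex. -/
theorem exists_fwd {P P' : ℤ × ℤ} (hs : Q.Step P P') : ∃ l, Q.Fwd P' l := by
  obtain ⟨B, hB⟩ := (Q.finite_corners.image fun P => P.1 + P.2).bddAbove
  have key : ∀ n : ℕ, ∀ P P', Q.Step P P' → B < P'.1 + P'.2 + n → ∃ l, Q.Fwd P' l := by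
    intro n
    induction n with
    | zero =>
      intro P P' hs hn
      by_cases hv : P' ∈ Q.vertices
      · exact ⟨[], .nil hv⟩
      · obtain ⟨P'', h⟩ := H.exists_out P P' hv hs
        have : P'.1 + P'.2 ≤ B := hB ⟨P', Step.mem_corners Q h, rfl⟩
        simp only [Nat.cast_zero] at hn
        omega
    | succ n ih =>
      intro P P' hs hn
      by_cases hv : P' ∈ Q.vertices
      · exact ⟨[], .nil hv⟩
      · obtain ⟨P'', h⟩ := H.exists_out P P' hv hs
        have h1 := Step.sum_lt Q h
        push_cast at hn
        obtain ⟨l, hl⟩ := ih P' P'' h (by omega)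
        exact ⟨_, .cons hv h hl⟩
  exact key (B + 1 - (P'.1 + P'.2)).toNat P P' hs (by omega)

theorem exists_bwd {P P' : ℤ × ℤ} (hs : Q.Step P P') : ∃ l, Q.Bwd P l := by
  obtain ⟨B, hB⟩ := (Q.finite_corners.image fun P => P.1 + P.2).bddBelow
  have key : ∀ n : ℕ, ∀ P P', Q.Step P P' → P.1 + P.2 ≤ B + n → ∃ l, Q.Bwd P l := by
    intro n
    induction n with
    | zero =>
      intro P P' hs hn
      by_cases hv : P ∈ Q.vertices
      · exact ⟨[], .nil hv⟩
      · obtain ⟨P'', h⟩ := H.exists_in P P' hv hs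
        have h1 : B ≤ P''.1 + P''.2 := hB ⟨P'', Step.mem_corners Q h, rfl⟩
        have h2 := Step.sum_lt Q h
        simp only [Nat.cast_zero] at hn
        omega
    | succ n ih =>
      intro P P' hs hn
      by_cases hv : P ∈ Q.vertices
      · exact ⟨[], .nil hv⟩
      · obtain ⟨P'', h⟩ := H.exists_in P P' hv hs
        have h1 := Step.sum_lt Q h
        push_cast at hn
        obtain ⟨l, hl⟩ := ih P'' P h (by omega)
        exact ⟨_, .cons hv h hl⟩
  exact key (P.1 + P.2 - B).toNat P P' hs (by omega)

/-- From a private edge both the way on to the next vertex and the way back to the previous vertex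
exist and are forced. -/
theorem existsUnique_arrow {e : (ℤ × ℤ) × (ℤ × ℤ)} (he : Q.IsPrivate Mg e) :
    ∃! a : Q.Arrow, e ∈ edgeList a.points := by
  obtain ⟨l, hl⟩ := H.exists_bwd he.1
  obtain ⟨l', hl'⟩ := H.exists_fwd he.1
  obtain ⟨a, ha⟩ := exists_arrow hl he.1 hl'
  refine ⟨a, ?_, fun b hb => ?_⟩
  · change e ∈ edgeList a.points
    rw [ha]
    exact mem_edgeList_append _ _ _ _
  obtain ⟨l₁, l₂, h1, h2, _, h4⟩ := b.split hb
  apply Arrow.points_injective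
  rw [h4, ha, H.bwd_unique h1 hl he.2.1, H.fwd_unique h2 hl' he.2.2]

theorem mem_Mg_of_mem_edgeList {P t : ℤ × ℤ} {m : List (ℤ × ℤ)}
    (h : List.IsChain Q.Step (P :: m ++ [t])) (hm : ∀ P ∈ m, P ∉ Q.vertices) (hP : P ∈ Mg)
    {e : (ℤ × ℤ) × (ℤ × ℤ)} (he : e ∈ edgeList (P :: m ++ [t])) : e.1 ∈ Mg := by
  induction m generalizing P with
  | nil =>
    change e ∈ [(P, t)] at he
    rw [List.mem_singleton.1 he]
    exact hP
  | cons q m ih =>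
    rw [List.cons_append, List.cons_append] at he h
    rw [edgeList_cons_cons, List.mem_cons] at he
    obtain ⟨h1, h2⟩ := List.isChain_cons_cons.1 h
    rcases he with rfl | he
    · exact hP
    · exact ih h2 (fun P hP => hm P (List.mem_cons_of_mem q hP))
        ((H.next P hP q h1).resolve_left (hm q List.mem_cons_self)) he

/-- The private edge is the place where the path leaves its last non-merging point before it reaches
merging points or the final vertex. The change happens only once. -/
theorem existsUnique_private {P t : ℤ × ℤ} {m : List (ℤ × ℤ)}
    (h : List.IsChain Q.Step (P :: m ++ [t])) (hm : ∀ P ∈ m, P ∉ Q.vertices) (hP : P ∉ Mg)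
    (ht : t ∈ Q.vertices) : ∃! e, e ∈ edgeList (P :: m ++ [t]) ∧ Q.IsPrivate Mg e := by
  induction m generalizing P with
  | nil =>
    refine ⟨(P, t), ⟨List.mem_singleton.2 rfl, (List.isChain_cons_cons.1 h).1, hP, Or.inl ht⟩, ?_⟩
    rintro e ⟨he, _⟩
    exact List.mem_singleton.1 he
  | cons q m ih =>
    rw [List.cons_append, List.cons_append] at h ⊢
    rw [edgeList_cons_cons]
    obtain ⟨h1, h2⟩ := List.isChain_cons_cons.1 h
    have hm' : ∀ P ∈ m, P ∉ Q.vertices := fun P hP => hm P (List.mem_cons_of_mem q hP)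
    by_cases hq : q ∈ Mg
    · refine ⟨(P, q), ⟨List.mem_cons_self, h1, hP, Or.inr hq⟩, ?_⟩
      rintro e ⟨he, he'⟩
      rcases List.mem_cons.1 he with rfl | he
      · rfl
      · exact absurd (H.mem_Mg_of_mem_edgeList h2 hm' hq he) he'.2.1
    · obtain ⟨e, ⟨he, he'⟩, huniq⟩ := ih h2 hm' hq
      refine ⟨e, ⟨List.mem_cons_of_mem _ he, he'⟩, ?_⟩
      rintro e₁ ⟨he₁, he₁'⟩
      rcases List.mem_cons.1 he₁ with rfl | he₁
      · exact absurd he₁'.2.2 (not_or.2 ⟨hm q List.mem_cons_self, hq⟩)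
      · exact huniq e₁ ⟨he₁, he₁'⟩

theorem existsUnique_privateEdge (a : Q.Arrow) :
    ∃! e, e ∈ edgeList a.points ∧ Q.IsPrivate Mg e :=
  H.existsUnique_private a.isPath a.inner_notMem (fun h => H.notMem _ h a.src.2) a.tgt.2

/-- The private edge of an arrow. -/
noncomputable def privateEdge (a : Q.Arrow) : (ℤ × ℤ) × (ℤ × ℤ) := (H.existsUnique_privateEdge a).choose

theorem privateEdge_mem (a : Q.Arrow) : H.privateEdge a ∈ edgeList a.points :=
  (H.existsUnique_privateEdge a).choose_spec.1.1

theorem isPrivate_privateEdge (a : Q.Arrow) : Q.IsPrivate Mg (H.privateEdge a) :=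
  (H.existsUnique_privateEdge a).choose_spec.1.2

theorem mem_edgeList_iff {a : Q.Arrow} {e : (ℤ × ℤ) × (ℤ × ℤ)} (he : Q.IsPrivate Mg e) :
    e ∈ edgeList a.points ↔ H.privateEdge a = e := by
  constructor
  · intro h
    exact (H.existsUnique_privateEdge a).unique ⟨H.privateEdge_mem a, H.isPrivate_privateEdge a⟩
      ⟨h, he⟩
  · rintro rfl
    exact H.privateEdge_mem a

theorem privateEdge_injective : Function.Injective H.privateEdge := fun a b h =>
  (H.existsUnique_arrow (H.isPrivate_privateEdge a)).unique (H.privateEdge_mem a)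
    (h ▸ H.privateEdge_mem b)

theorem exists_privateEdge_eq {e : (ℤ × ℤ) × (ℤ × ℤ)} (he : Q.IsPrivate Mg e) :
    ∃ a, H.privateEdge a = e := by
  obtain ⟨a, ha, _⟩ := H.existsUnique_arrow he
  exact ⟨a, (H.mem_edgeList_iff he).1 ha⟩

/-- Only one arrow passes through a private edge, so the flow there is the multiplicity of this
arrow. The flow on the arrows can be read off from the flow on the edges in this way. -/
theorem flow_privateEdge (u : Q.Arrow →₀ ℕ) (a : Q.Arrow) : Q.flow u (H.privateEdge a) = u a := by
  classical
  rw [flow, Finsupp.linearCombination_apply, Finsupp.sum_apply, Finsupp.sum]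
  simp only [Finsupp.smul_apply, Arrow.edgeVec_apply, smul_eq_mul,
    H.mem_edgeList_iff (H.isPrivate_privateEdge a), H.privateEdge_injective.eq_iff, mul_ite, mul_one,
    mul_zero]
  rw [Finset.sum_ite_eq' u.support a]
  split_ifs with h
  · rfl
  · exact (Finsupp.notMem_support_iff.1 h).symm

end IsForked

/-- A flow on the edges of the diagram, with sources and sinks at the vertices of the ladder quiver. -/
structure IsFlow (Q : YShapedQuiver) (f : ((ℤ × ℤ) × (ℤ × ℤ)) →₀ ℕ) : Prop where
  step : ∀ e, f e ≠ 0 → Q.Step e.1 e.2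
  -- Conservation at the points that are not vertices is tested against functions vanishing at the
  -- vertices; the indicator function of a point gives the usual balance.
  conserved : ∀ φ : ℤ × ℤ → ℤ, (∀ P ∈ Q.vertices, φ P = 0) → boundary φ f = 0

theorem isFlow_flow (u : Q.Arrow →₀ ℕ) : Q.IsFlow (Q.flow u) where
  step _ h := step_of_flow_ne_zero h
  conserved φ hφ := by
    rw [boundary_flow, Finsupp.linearCombination_apply]
    refine Finset.sum_eq_zero fun a _ => ?_
    simp only [hφ _ a.tgt.2, hφ _ a.src.2, sub_zero, smul_zero]

theorem degree_filter_of_unique {α : Type} {f : α →₀ ℕ} {p : α → Prop} [DecidablePred p] {a : α}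
    (ha : p a) (h : ∀ b, p b → f b ≠ 0 → b = a) : (f.filter p).degree = f a := by
  classical
  have : f.filter p = Finsupp.single a (f a) := by
    ext b
    rw [Finsupp.filter_apply, Finsupp.single_apply]
    by_cases hb : a = b
    · subst hb
      rw [if_pos ha, if_pos rfl]
    · rw [if_neg hb]
      split_ifs with hp
      · by_contra h0
        exact hb (h b hp h0).symm
      · rfl
  rw [this, Finsupp.degree_single]

theorem sum_in_eq_sum_out [DecidableEq (ℤ × ℤ)] {f : ((ℤ × ℤ) × (ℤ × ℤ)) →₀ ℕ} (hf : Q.IsFlow f)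
    {P : ℤ × ℤ} (hP : P ∉ Q.vertices) :
    (f.filter fun e => e.2 = P).degree = (f.filter fun e => e.1 = P).degree := by
  have h := hf.conserved (fun R => if R = P then 1 else 0) fun R hR => if_neg fun h => hP (by rwa [← h])
  have h1 : ∀ p : (ℤ × ℤ) × (ℤ × ℤ) → Prop, ∀ _ : DecidablePred p,
      ((f.filter p).degree : ℤ) = ∑ e ∈ f.support, f e • (if p e then (1 : ℤ) else 0) := by
    intro p _
    rw [Finsupp.degree_apply, Finsupp.support_filter, Finset.sum_filter]
    push_cast
    refine Finset.sum_congr rfl fun e _ => ?_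
    split_ifs with h
    · rw [Finsupp.filter_apply_pos _ _ h]; simp
    · simp
  rw [boundary, Finsupp.linearCombination_apply, Finsupp.sum] at h
  simp only [smul_sub, Finset.sum_sub_distrib] at h
  have h2 := h1 (fun e => e.2 = P) inferInstance
  have h3 := h1 (fun e => e.1 = P) inferInstance
  rw [← h2, ← h3] at h
  omega

namespace IsForked

variable {Mg : Set (ℤ × ℤ)} (H : Q.IsForked Mg)

include H

/-- At a splitting point the only incoming edge carries the sum of the outgoing ones; at a merging
point the only outgoing edge carries the sum of the incoming ones. So the values on private edges
propagate backwards through splitting points and forwards through merging points. -/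
theorem eq_of_eq_private {f f' : ((ℤ × ℤ) × (ℤ × ℤ)) →₀ ℕ} (hf : Q.IsFlow f) (hf' : Q.IsFlow f')
    (h : ∀ e, Q.IsPrivate Mg e → f e = f' e) : f = f' := by
  classical
  have key : ∀ e, (Q.Step e.1 e.2 → f e = f' e) → f e = f' e := fun e he => by
    by_cases hs : Q.Step e.1 e.2
    · exact he hs
    · have h1 : f e = 0 := not_imp_comm.1 (hf.step e) hs
      have h2 : f' e = 0 := not_imp_comm.1 (hf'.step e) hs
      rw [h1, h2]
  obtain ⟨B, hB⟩ := (Q.finite_corners.image fun P => P.1 + P.2).bddAbove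
  -- Induction on how far `P'` is from the upper right end, measured by the sum of the coordinates.
  have hsplit : ∀ n : ℕ, ∀ P P' : ℤ × ℤ, P' ∉ Q.vertices → P' ∉ Mg → B < P'.1 + P'.2 + n →
      f (P, P') = f' (P, P') := by
    intro n
    induction n with
    | zero =>
      intro P P' hv hM hn
      refine key _ fun hs => ?_
      obtain ⟨P'', hs'⟩ := H.exists_out P P' hv hs
      have : P'.1 + P'.2 ≤ B := hB ⟨P', Step.mem_corners Q hs', rfl⟩
      simp only [Nat.cast_zero] at hn
      omega
    | succ n ih =>
      intro P P' hv hM hn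
      refine key _ fun hs => ?_
      have h1 : ∀ g, Q.IsFlow g → (g.filter fun e => e.2 = P').degree = g (P, P') := fun g hg =>
        degree_filter_of_unique rfl fun e he he0 => by
          have h2 := hg.step e he0
          rw [he] at h2
          exact Prod.ext (H.in_unique P' hv hM _ _ h2 hs) he
      rw [← h1 f hf, ← h1 f' hf', sum_in_eq_sum_out hf hv, sum_in_eq_sum_out hf' hv]
      congr 1
      ext ⟨R, R'⟩
      rw [Finsupp.filter_apply, Finsupp.filter_apply]
      split_ifs with hR
      · simp only at hR
        subst hR
        refine key _ fun hs' => ?_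
        by_cases hp : R' ∈ Q.vertices ∨ R' ∈ Mg
        · exact h _ ⟨hs', hM, hp⟩
        · rw [not_or] at hp
          have h3 := Step.sum_lt Q hs'
          push_cast at hn
          simp only at h3
          exact ih R R' hp.1 hp.2 (by omega)
      · rfl
  obtain ⟨B', hB'⟩ := (Q.finite_corners.image fun P => P.1 + P.2).bddBelow
  -- The mirror image, by induction on how far `P` is from the lower left end.
  have hmerge : ∀ n : ℕ, ∀ P P' : ℤ × ℤ, P ∈ Mg → P.1 + P.2 < B' + n →
      f (P, P') = f' (P, P') := by
    intro n
    induction n with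
    | zero =>
      intro P P' hM hn
      refine key _ fun hs => ?_
      have : B' ≤ P.1 + P.2 := hB' ⟨P, Step.mem_corners Q hs, rfl⟩
      simp only [Nat.cast_zero] at hn
      omega
    | succ n ih =>
      intro P P' hM hn
      refine key _ fun hs => ?_
      have hv := H.notMem P hM
      have h1 : ∀ g, Q.IsFlow g → (g.filter fun e => e.1 = P).degree = g (P, P') := fun g hg =>
        degree_filter_of_unique rfl fun e he he0 => by
          have h2 := hg.step e he0
          rw [he] at h2
          exact Prod.ext he (H.out_unique P hM _ _ h2 hs)
      rw [← h1 f hf, ← h1 f' hf', ← sum_in_eq_sum_out hf hv, ← sum_in_eq_sum_out hf' hv]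
      congr 1
      ext ⟨R, R'⟩
      rw [Finsupp.filter_apply, Finsupp.filter_apply]
      split_ifs with hR
      · simp only at hR
        subst hR
        refine key _ fun hs' => ?_
        by_cases hp : R ∈ Mg
        · have h3 := Step.sum_lt Q hs'
          push_cast at hn
          simp only at h3
          exact ih R R' hp (by omega)
        · exact h _ ⟨hs', hp, Or.inr hM⟩
      · rfl
  ext ⟨P, P'⟩
  refine key _ fun hs => ?_
  by_cases hM : P ∈ Mg
  · exact hmerge (P.1 + P.2 + 1 - B').toNat P P' hM (by omega)
  by_cases hp : P' ∈ Q.vertices ∨ P' ∈ Mg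
  · exact h _ ⟨hs, hM, hp⟩
  · rw [not_or] at hp
    exact hsplit (B + 1 - (P'.1 + P'.2)).toNat P P' hp.1 hp.2 (by omega)

/-- The flow on the arrows of the ladder quiver that comes from a flow on the edges. -/
noncomputable def arrowFlow (f : ((ℤ × ℤ) × (ℤ × ℤ)) →₀ ℕ) : Q.Arrow →₀ ℕ :=
  f.comapDomain H.privateEdge H.privateEdge_injective.injOn

/-- Both sides agree on private edges by construction, and private edges determine a flow. -/
theorem flow_arrowFlow {f : ((ℤ × ℤ) × (ℤ × ℤ)) →₀ ℕ} (hf : Q.IsFlow f) :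
    Q.flow (H.arrowFlow f) = f := by
  refine H.eq_of_eq_private (isFlow_flow _) hf fun e he => ?_
  obtain ⟨a, rfl⟩ := H.exists_privateEdge_eq he
  rw [H.flow_privateEdge]
  rfl

theorem flow_injective : Function.Injective Q.flow := fun u u' h => Finsupp.ext fun a => by
  rw [← H.flow_privateEdge u a, h, H.flow_privateEdge]

theorem le_of_flow_le {u u' : Q.Arrow →₀ ℕ} (h : Q.flow u ≤ Q.flow u') : u ≤ u' := fun a => by
  rw [← H.flow_privateEdge u a, ← H.flow_privateEdge u' a]
  exact h _

end IsForked

end Flows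

end YShapedQuiver

namespace YShapedQuiver

/-! ### The two branches of a Y-shaped quiver -/

section Branches

variable {Q : YShapedQuiver}

theorem one_ne_zero' : (1 : Q.V) ≠ 0 := by simp

theorem eq_one_or_one_lt {i : Q.V} (hi : i ≠ 0) : i = 1 ∨ 1 < i := by
  rw [Fin.lt_def, Fin.ext_iff, Fin.val_one]
  have : i.val ≠ 0 := fun h => hi (Fin.ext h)
  omega

theorem ne_zero_of_one_lt {i : Q.V} (hi : 1 < i) : i ≠ 0 := by
  rintro rfl
  exact absurd hi (by simp)

theorem one_lt_of_n_ne_zero {p i : Q.V} (hp : p ≠ 0) (h : Q.n p i ≠ 0) : 1 < i := by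
  have := Q.acyclic p i h
  rcases eq_one_or_one_lt hp with rfl | hp
  · exact this
  · exact hp.trans this

theorem one_lt_of_mem_S₁ {i : Q.V} (hi : i ∈ Q.S₁) : 1 < i := by
  rcases Q.S₁_spec with ⟨h, _⟩ | ⟨c, hc, h⟩
  · rw [h] at hi
    exact absurd hi (Set.notMem_empty i)
  · rw [h] at hi
    exact (Q.acyclic 1 c hc).trans_le (reach_le hi)

theorem one_notMem_S₁ : (1 : Q.V) ∉ Q.S₁ := fun h => lt_irrefl _ (one_lt_of_mem_S₁ h)

theorem one_notMem_S₂ : (1 : Q.V) ∉ Q.S₂ := fun h => lt_irrefl _ h.1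

theorem notMem_S₂_of_mem_S₁ {i : Q.V} (hi : i ∈ Q.S₁) : i ∉ Q.S₂ := fun h => h.2 hi

theorem eq_one_or_mem_S₁_iff {i : Q.V} (hi : i ≠ 0) : (i = 1 ∨ i ∈ Q.S₁) ↔ i ∉ Q.S₂ := by
  constructor
  · rintro (rfl | h)
    · exact one_notMem_S₂
    · exact notMem_S₂_of_mem_S₁ h
  · intro h
    refine (eq_one_or_one_lt hi).imp_right fun h1 => ?_
    by_contra h2
    exact h ⟨h1, h2⟩

theorem exists_parent {i : Q.V} (hi : 1 < i) : ∃ p, p ≠ 0 ∧ Q.n p i ≠ 0 := by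
  rcases Relation.ReflTransGen.cases_tail (Q.connected i hi) with h | ⟨p, hp, hpi⟩
  · exact absurd h.symm hi.ne
  · exact ⟨p, ne_zero_of_reach one_ne_zero' hp, hpi⟩

theorem mem_S₁_of_reach {p i : Q.V} (hp : p ∈ Q.S₁) (h : Q.Reach p i) : i ∈ Q.S₁ := by
  rcases Q.S₁_spec with ⟨h', _⟩ | ⟨c, hc, h'⟩
  · rw [h'] at hp
    exact absurd hp (Set.notMem_empty p)
  · rw [h'] at hp ⊢
    exact Relation.ReflTransGen.trans hp h

theorem parent_notMem_S₂ {p i : Q.V} (hp : p ≠ 0) (h : Q.n p i ≠ 0) (hi : i ∉ Q.S₂) :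
    p ∉ Q.S₂ := by
  have hi1 := one_lt_of_n_ne_zero hp h
  have hS : i ∈ Q.S₁ := by
    by_contra hS
    exact hi ⟨hi1, hS⟩
  intro hp2
  refine hp2.2 ?_
  rcases Q.S₁_spec with ⟨h', _⟩ | ⟨c, hc, h'⟩
  · rw [h'] at hS
    exact absurd hS (Set.notMem_empty i)
  · rw [h'] at hS ⊢
    rcases Relation.ReflTransGen.cases_tail hS with e | ⟨d, hd, hdi⟩
    · subst e
      have := parent_unique hp one_ne_zero' h hc
      subst this
      exact absurd hp2 one_notMem_S₂
    · have hc0 : c ≠ 0 := ne_zero_of_one_lt (one_lt_of_n_ne_zero one_ne_zero' hc)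
      obtain rfl := parent_unique hp (ne_zero_of_reach hc0 hd) h hdi
      exact hd

theorem parent_of_mem_S₂ {p i : Q.V} (hp : p ≠ 0) (h : Q.n p i ≠ 0) (hi : i ∈ Q.S₂) :
    p = 1 ∨ p ∈ Q.S₂ := by
  refine (eq_one_or_one_lt hp).imp_right fun h1 => ⟨h1, fun hS => ?_⟩
  exact hi.2 (mem_S₁_of_reach hS (Relation.ReflTransGen.single h))

theorem child_unique {p i j : Q.V} (hp : 1 < p) (hi : Q.n p i ≠ 0) (hj : Q.n p j ≠ 0) : i = j := by
  by_contra hne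
  have h := Q.arrows_from p hp
  have h1 := Finset.sum_le_sum_of_subset (f := fun j => Q.n p j) (Finset.subset_univ {i, j})
  rw [Finset.sum_pair hne] at h1
  omega

/-- Beyond vertex `1` there is at most one arrow to follow, so the vertices reached from `c` form a
chain. -/
theorem reach_total_from {c i j : Q.V} (hc : 1 < c) (hi : Q.Reach c i) (hj : Q.Reach c j) :
    Q.Reach i j ∨ Q.Reach j i := by
  induction hi with
  | refl => exact Or.inl hj
  | @tail b d hb hbd ih =>
    rcases ih with h | h
    · rcases Relation.ReflTransGen.cases_head h with rfl | ⟨d', hd', h'⟩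
      · exact Or.inr (Relation.ReflTransGen.single hbd)
      · obtain rfl := child_unique (hc.trans_le (reach_le hb)) hbd hd'
        exact Or.inl h'
    · exact Or.inr (h.tail hbd)

theorem reach_total_of_mem_S₁ {i j : Q.V} (hi : i ∈ Q.S₁) (hj : j ∈ Q.S₁) :
    Q.Reach i j ∨ Q.Reach j i := by
  rcases Q.S₁_spec with ⟨h', _⟩ | ⟨c, hc, h'⟩
  · rw [h'] at hi
    exact absurd hi (Set.notMem_empty i)
  · rw [h'] at hi hj
    exact reach_total_from (one_lt_of_n_ne_zero one_ne_zero' hc) hi hj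

theorem exists_first_of_mem_S₂ {i : Q.V} (hi : i ∈ Q.S₂) :
    ∃ c', Q.n 1 c' ≠ 0 ∧ Q.Reach c' i := by
  rcases Relation.ReflTransGen.cases_head (Q.connected i hi.1) with h | h
  · exact absurd hi (h ▸ one_notMem_S₂)
  · exact h

/-- Vertex `1` has at most two outgoing arrows, and if there is one at all, one of them leads into
`S₁`. -/
theorem first_unique_of_mem_S₂ {i j a b : Q.V} (hi : i ∈ Q.S₂) (hj : j ∈ Q.S₂) (ha : Q.n 1 a ≠ 0)
    (hai : Q.Reach a i) (hb : Q.n 1 b ≠ 0) (hbj : Q.Reach b j) : a = b := by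
  rcases Q.S₁_spec with ⟨_, h⟩ | ⟨c, hc, h'⟩
  · exact absurd (h a) ha
  · by_contra hne
    have hca : c ≠ a := by
      rintro rfl
      exact hi.2 (by rw [h']; exact hai)
    have hcb : c ≠ b := by
      rintro rfl
      exact hj.2 (by rw [h']; exact hbj)
    have h := Q.arrows_from_one
    have h1 := Finset.sum_le_sum_of_subset (f := fun j => Q.n 1 j) (Finset.subset_univ {c, a, b})
    rw [Finset.sum_insert (by simp [hca, hcb]), Finset.sum_pair hne] at h1
    omega

theorem reach_total_of_mem_S₂ {i j : Q.V} (hi : i ∈ Q.S₂) (hj : j ∈ Q.S₂) :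
    Q.Reach i j ∨ Q.Reach j i := by
  obtain ⟨a, ha, hai⟩ := exists_first_of_mem_S₂ hi
  obtain ⟨b, hb, hbj⟩ := exists_first_of_mem_S₂ hj
  obtain rfl := first_unique_of_mem_S₂ hi hj ha hai hb hbj
  exact reach_total_from (one_lt_of_n_ne_zero one_ne_zero' ha) hai hbj

theorem s_one : Q.s 1 = Q.sTilde 1 := by
  rw [sTilde_eq one_ne_zero', QuiverFlagData.s]
  refine Finset.sum_congr rfl fun j _ => ?_
  by_cases h : Q.n j 1 = 0
  · simp [h]
  · have hj : j = 0 := by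
      have := Q.acyclic j 1 h
      rw [Fin.lt_def, Fin.val_one] at this
      exact Fin.ext (by rw [Fin.val_zero]; omega)
    rw [hj, sTilde_zero, Q.r_zero]

end Branches

/-! ### The ladder diagram as a sequence of blocks of columns -/

section Blocks

variable {Q : YShapedQuiver}

open scoped Classical in
/-- The columns `left v ≤ x < right v` of the ladder diagram belong to the vertex `v`. -/
noncomputable def left (v : Q.V) : ℤ :=
  if v ∈ Q.S₂ then Q.width 1 - Q.width v else Q.width v - ((Q.s v : ℤ) - Q.r v)

/-- The right end of the block of `v`. -/
noncomputable def right (v : Q.V) : ℤ := left v + ((Q.s v : ℤ) - Q.r v)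

open scoped Classical in
/-- The lower end of the block of `v`. -/
noncomputable def bottom (v : Q.V) : ℤ := if v ∈ Q.S₂ then (Q.r 1 : ℤ) - Q.r v else 0

open scoped Classical in
/-- The upper end of the block of `v`. -/
noncomputable def top (v : Q.V) : ℤ := if v ∈ Q.S₂ then (Q.r 1 : ℤ) else Q.r v

theorem left_of_mem {v : Q.V} (h : v ∈ Q.S₂) : left v = Q.width 1 - Q.width v := if_pos h
theorem left_of_notMem {v : Q.V} (h : v ∉ Q.S₂) :
    left v = Q.width v - ((Q.s v : ℤ) - Q.r v) := if_neg h
theorem right_of_notMem {v : Q.V} (h : v ∉ Q.S₂) : right v = Q.width v := by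
  rw [right, left_of_notMem h]
  ring
theorem bottom_of_mem {v : Q.V} (h : v ∈ Q.S₂) : bottom v = (Q.r 1 : ℤ) - Q.r v := if_pos h
theorem bottom_of_notMem {v : Q.V} (h : v ∉ Q.S₂) : bottom v = 0 := if_neg h
theorem top_of_mem {v : Q.V} (h : v ∈ Q.S₂) : top v = (Q.r 1 : ℤ) := if_pos h
theorem top_of_notMem {v : Q.V} (h : v ∉ Q.S₂) : top v = (Q.r v : ℤ) := if_neg h

theorem left_lt_right {v : Q.V} (h : v ≠ 0) : left v < right v := by
  have := r_lt_s h
  rw [right]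
  omega

theorem bottom_lt_top (v : Q.V) : bottom v < top v := by
  have := Q.r_pos v
  by_cases h : v ∈ Q.S₂
  · rw [bottom_of_mem h, top_of_mem h]
    omega
  · rw [bottom_of_notMem h, top_of_notMem h]
    omega

theorem left_one : left (1 : Q.V) = 0 := by
  rw [left_of_notMem one_notMem_S₂, width, s_one]
  ring

theorem right_one : right (1 : Q.V) = Q.width 1 := right_of_notMem one_notMem_S₂

theorem width_one_pos : 0 < Q.width 1 := by
  have := left_lt_right (Q := Q) one_ne_zero'
  rwa [left_one, right_one] at this

/-- Consecutive vertices have adjacent blocks. Along `S₁` the diagram grows to the right; along `S₂`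
the half-turn makes it grow to the left, as in `right_eq_left_parent`. -/
theorem left_eq_right_parent {p i : Q.V} (hp : p ≠ 0) (h : Q.n p i ≠ 0) (hi : i ∉ Q.S₂) :
    left i = right p := by
  have h1 := width_parent hp h
  rw [left_of_notMem hi, right_of_notMem (parent_notMem_S₂ hp h hi), width, width]
  omega

theorem right_eq_left_parent {p i : Q.V} (hp : p ≠ 0) (h : Q.n p i ≠ 0) (hi : i ∈ Q.S₂) :
    right i = left p := by
  have h1 := width_parent hp h
  rcases parent_of_mem_S₂ hp h hi with rfl | hp2
  · rw [right, left_of_mem hi, left_one, width, width]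
    omega
  · rw [right, left_of_mem hi, left_of_mem hp2, width, width, width]
    omega

theorem left_nonneg {v : Q.V} (hv : v ≠ 0) (h : v ∉ Q.S₂) : 0 ≤ left v := by
  have h1 : Q.Reach 1 v := by
    rcases eq_one_or_one_lt hv with rfl | h1
    · exact Relation.ReflTransGen.refl
    · exact Q.connected v h1
  by_cases hne : 1 = v
  · rw [← hne, left_one]
  · have h2 := width_strict one_ne_zero' h1 hne
    have h3 := width_one_pos (Q := Q)
    rw [left_of_notMem h, width]
    rw [width] at h3
    omega

theorem width_one_le_left {v : Q.V} (h : v ∈ Q.S₁) : Q.width 1 ≤ left v := by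
  have h1 := one_lt_of_mem_S₁ h
  have h2 := width_strict one_ne_zero' (Q.connected v h1) h1.ne
  rw [left_of_notMem (notMem_S₂_of_mem_S₁ h), width, width]
  omega

theorem right_nonpos {v : Q.V} (h : v ∈ Q.S₂) : right v ≤ 0 := by
  have h2 := width_strict one_ne_zero' (Q.connected v h.1) h.1.ne
  rw [right, left_of_mem h, width, width]
  omega

theorem right_le_left_or {u v : Q.V} (hu : u ≠ 0) (hv : v ≠ 0) (hne : u ≠ v) :
    right u ≤ left v ∨ right v ≤ left u := by
  by_cases hu2 : u ∈ Q.S₂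
  · by_cases hv2 : v ∈ Q.S₂
    · rcases reach_total_of_mem_S₂ hu2 hv2 with h | h
      · have := width_strict hu h hne
        right
        rw [right, left_of_mem hu2, left_of_mem hv2, width, width, width]
        omega
      · have := width_strict hv h hne.symm
        left
        rw [right, left_of_mem hu2, left_of_mem hv2, width, width, width]
        omega
    · exact Or.inl ((right_nonpos hu2).trans (left_nonneg hv hv2))
  · by_cases hv2 : v ∈ Q.S₂
    · exact Or.inr ((right_nonpos hv2).trans (left_nonneg hu hu2))
    · have h : Q.Reach u v ∨ Q.Reach v u := by
        rcases (eq_one_or_mem_S₁_iff hu).2 hu2 with rfl | hu1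
        · exact Or.inl ((eq_one_or_one_lt hv).elim (fun h => absurd h.symm hne) (Q.connected v))
        · rcases (eq_one_or_mem_S₁_iff hv).2 hv2 with rfl | hv1
          · exact Or.inr (Q.connected u (one_lt_of_mem_S₁ hu1))
          · exact reach_total_of_mem_S₁ hu1 hv1
      rcases h with h | h
      · have := width_strict hu h hne
        left
        rw [right_of_notMem hu2, left_of_notMem hv2, width, width]
        omega
      · have := width_strict hv h hne.symm
        right
        rw [right_of_notMem hv2, left_of_notMem hu2, width, width]
        omega

/-- The blocks do not overlap. -/
theorem block_unique {u v : Q.V} (hu : u ≠ 0) (hv : v ≠ 0) {x : ℤ} (hu1 : left u ≤ x)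
    (hu2 : x < right u) (hv1 : left v ≤ x) (hv2 : x < right v) : u = v := by
  by_contra hne
  rcases right_le_left_or hu hv hne with h | h <;> omega

variable (Q) in
theorem nonSource_nonempty : Q.nonSource.Nonempty := ⟨1, by simp [nonSource]⟩

theorem mem_nonSource {v : Q.V} : v ∈ Q.nonSource ↔ v ≠ 0 := by simp [nonSource]

variable (Q) in
/-- The left end of the ladder diagram. -/
noncomputable def xMin : ℤ := Q.nonSource.inf' Q.nonSource_nonempty left

variable (Q) in
/-- The right end of the ladder diagram. -/
noncomputable def xMax : ℤ := Q.nonSource.sup' Q.nonSource_nonempty right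

theorem xMin_le {v : Q.V} (hv : v ≠ 0) : Q.xMin ≤ left v :=
  Finset.inf'_le _ (mem_nonSource.2 hv)

theorem le_xMax {v : Q.V} (hv : v ≠ 0) : right v ≤ Q.xMax :=
  Finset.le_sup' _ (mem_nonSource.2 hv)

variable (Q) in
theorem xMin_le_zero : Q.xMin ≤ 0 := (xMin_le one_ne_zero').trans_eq left_one

variable (Q) in
theorem width_one_le_xMax : Q.width 1 ≤ Q.xMax := right_one.symm.trans_le (le_xMax one_ne_zero')

variable (Q) in
theorem exists_left_eq_xMin : ∃ v : Q.V, v ≠ 0 ∧ left v = Q.xMin := by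
  obtain ⟨v, hv, h⟩ := Finset.exists_mem_eq_inf' Q.nonSource_nonempty left
  exact ⟨v, mem_nonSource.1 hv, h.symm⟩

variable (Q) in
theorem exists_right_eq_xMax : ∃ v : Q.V, v ≠ 0 ∧ right v = Q.xMax := by
  obtain ⟨v, hv, h⟩ := Finset.exists_mem_eq_sup' Q.nonSource_nonempty right
  exact ⟨v, mem_nonSource.1 hv, h.symm⟩

/-- The blocks cover all columns. -/
theorem exists_block {x : ℤ} (h1 : Q.xMin ≤ x) (h2 : x < Q.xMax) :
    ∃ v : Q.V, v ≠ 0 ∧ left v ≤ x ∧ x < right v := by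
  classical
  rcases le_or_gt 0 x with hx | hx
  · have hne : (Q.nonSource.filter fun v => x < right v).Nonempty := by
      obtain ⟨v, hv, h⟩ := Q.exists_right_eq_xMax
      exact ⟨v, Finset.mem_filter.2 ⟨mem_nonSource.2 hv, by rwa [h]⟩⟩
    -- Take the first block that ends after `x`. If it began after `x`, the block of the parent,
    -- which ends where this one begins, would be an earlier choice.
    obtain ⟨v, hv, hmin⟩ := Finset.exists_min_image _ right hne
    rw [Finset.mem_filter, mem_nonSource] at hv
    refine ⟨v, hv.1, ?_, hv.2⟩
    rcases eq_one_or_one_lt hv.1 with rfl | hv1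
    · rwa [left_one]
    · obtain ⟨p, hp, hpv⟩ := exists_parent hv1
      by_contra hcon
      have hv2 : v ∉ Q.S₂ := fun h => by
        have := right_nonpos h
        omega
      have e := left_eq_right_parent hp hpv hv2
      have := hmin p (Finset.mem_filter.2 ⟨mem_nonSource.2 hp, by omega⟩)
      have := left_lt_right hv.1
      omega
  · have hne : (Q.nonSource.filter fun v => left v ≤ x).Nonempty := by
      obtain ⟨v, hv, h⟩ := Q.exists_left_eq_xMin
      exact ⟨v, Finset.mem_filter.2 ⟨mem_nonSource.2 hv, by rwa [h]⟩⟩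
    obtain ⟨v, hv, hmax⟩ := Finset.exists_max_image _ left hne
    rw [Finset.mem_filter, mem_nonSource] at hv
    refine ⟨v, hv.1, hv.2, ?_⟩
    have hv2 : v ∈ Q.S₂ := by
      by_contra h
      have := left_nonneg hv.1 h
      omega
    obtain ⟨p, hp, hpv⟩ := exists_parent hv2.1
    by_contra hcon
    have e := right_eq_left_parent hp hpv hv2
    have := hmax p (Finset.mem_filter.2 ⟨mem_nonSource.2 hp, by omega⟩)
    have := left_lt_right hv.1
    omega

open scoped Classical in
variable (Q) in
/-- The vertex to whose block the column `x` belongs (`1` outside the diagram). -/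
noncomputable def block (x : ℤ) : Q.V :=
  if h : ∃ v : Q.V, v ≠ 0 ∧ left v ≤ x ∧ x < right v then h.choose else 1

theorem block_eq {v : Q.V} (hv : v ≠ 0) {x : ℤ} (h1 : left v ≤ x) (h2 : x < right v) :
    Q.block x = v := by
  have h : ∃ v : Q.V, v ≠ 0 ∧ left v ≤ x ∧ x < right v := ⟨v, hv, h1, h2⟩
  rw [block, dif_pos h]
  exact block_unique h.choose_spec.1 hv h.choose_spec.2.1 h.choose_spec.2.2 h1 h2

theorem block_ne_zero (x : ℤ) : Q.block x ≠ 0 := by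
  rw [block]
  split_ifs with h
  · exact h.choose_spec.1
  · exact one_ne_zero'

theorem left_block_le {x : ℤ} (h1 : Q.xMin ≤ x) (h2 : x < Q.xMax) : left (Q.block x) ≤ x := by
  obtain ⟨v, hv, h3, h4⟩ := exists_block h1 h2
  rwa [block_eq hv h3 h4]

theorem lt_right_block {x : ℤ} (h1 : Q.xMin ≤ x) (h2 : x < Q.xMax) : x < right (Q.block x) := by
  obtain ⟨v, hv, h3, h4⟩ := exists_block h1 h2
  rwa [block_eq hv h3 h4]

theorem block_eq_one_of_not {x : ℤ} (h : ¬ (Q.xMin ≤ x ∧ x < Q.xMax)) : Q.block x = 1 := by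
  rw [block, dif_neg]
  rintro ⟨v, hv, h1, h2⟩
  exact h ⟨(xMin_le hv).trans h1, h2.trans_le (le_xMax hv)⟩

theorem block_mem_S₂_iff {x : ℤ} : Q.block x ∈ Q.S₂ ↔ Q.xMin ≤ x ∧ x < 0 := by
  by_cases h : Q.xMin ≤ x ∧ x < Q.xMax
  · have h1 := left_block_le h.1 h.2
    have h2 := lt_right_block h.1 h.2
    constructor
    · intro h3
      exact ⟨h.1, h2.trans_le (right_nonpos h3)⟩
    · intro h3
      by_contra h4
      have := left_nonneg (block_ne_zero x) h4
      omega
  · rw [block_eq_one_of_not h]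
    refine iff_of_false one_notMem_S₂ fun h1 => h ⟨h1.1, ?_⟩
    have := width_one_pos (Q := Q)
    have := Q.width_one_le_xMax
    omega

theorem block_eq_one_of_lt {x : ℤ} (h1 : 0 ≤ x) (h2 : x < Q.width 1) : Q.block x = 1 :=
  block_eq one_ne_zero' (by rwa [left_one]) (by rwa [right_one])

variable (Q) in
/-- The height of the bottom of the diagram in column `x`. -/
noncomputable def lo (x : ℤ) : ℤ := bottom (Q.block x)

variable (Q) in
/-- The height of the top of the diagram in column `x`. -/
noncomputable def hi (x : ℤ) : ℤ := top (Q.block x)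

theorem lo_lt_hi (x : ℤ) : Q.lo x < Q.hi x := bottom_lt_top _

theorem lo_eq_zero {x : ℤ} (h : 0 ≤ x) : Q.lo x = 0 :=
  bottom_of_notMem fun h1 => by
    have := (block_mem_S₂_iff.1 h1).2
    omega

/-- To the left of `width 1` there are only the blocks of vertex `1` and of `S₂`, and the half-turn
aligns the tops of the latter with `r 1`. Outside the diagram the default block `1` keeps the
formula valid. -/
theorem hi_eq {x : ℤ} (h : x < Q.width 1) : Q.hi x = Q.r 1 := by
  by_cases h1 : Q.block x ∈ Q.S₂
  · exact top_of_mem h1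
  · have h2 : Q.block x = 1 := by
      rcases le_or_gt 0 x with h0 | h0
      · exact block_eq_one_of_lt h0 h
      · refine block_eq_one_of_not fun h3 => h1 (block_mem_S₂_iff.2 ⟨h3.1, h0⟩)
    rw [hi, h2, top_of_notMem one_notMem_S₂]

theorem lo_block {v : Q.V} (hv : v ≠ 0) {x : ℤ} (h1 : left v ≤ x) (h2 : x < right v) :
    Q.lo x = bottom v := by rw [lo, block_eq hv h1 h2]

theorem hi_block {v : Q.V} (hv : v ≠ 0) {x : ℤ} (h1 : left v ≤ x) (h2 : x < right v) :
    Q.hi x = top v := by rw [hi, block_eq hv h1 h2]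

/-- The two branches are now treated uniformly: the diagram is the region between the heights `lo`
and `hi` over an interval of columns. -/
theorem mem_boxes {x y : ℤ} :
    (x, y) ∈ Q.boxes ↔ Q.xMin ≤ x ∧ x < Q.xMax ∧ Q.lo x ≤ y ∧ y < Q.hi x := by
  constructor
  · intro h
    have h' : ∃ v : Q.V, v ≠ 0 ∧ left v ≤ x ∧ x < right v ∧ bottom v ≤ y ∧ y < top v := by
      rcases h with ⟨v, hv, h⟩ | ⟨v, hv, h⟩
      · have hv0 : v ≠ 0 := by
          rcases hv with rfl | hv
          · exact one_ne_zero'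
          · exact ne_zero_of_one_lt (one_lt_of_mem_S₁ hv)
        have hv2 := (eq_one_or_mem_S₁_iff hv0).1 hv
        simp only [branchBoxes, Set.mem_ofPred_eq] at h
        refine ⟨v, hv0, ?_⟩
        rw [right_of_notMem hv2, left_of_notMem hv2, bottom_of_notMem hv2, top_of_notMem hv2]
        omega
      · have hv0 := ne_zero_of_one_lt hv.1
        simp only [branchBoxes, Set.mem_ofPred_eq] at h
        refine ⟨v, hv0, ?_⟩
        rw [right, left_of_mem hv, bottom_of_mem hv, top_of_mem hv]
        omega
    obtain ⟨v, hv, h1, h2, h3, h4⟩ := h'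
    rw [lo_block hv h1 h2, hi_block hv h1 h2]
    exact ⟨(xMin_le hv).trans h1, h2.trans_le (le_xMax hv), h3, h4⟩
  · rintro ⟨h1, h2, h3, h4⟩
    have h5 := left_block_le h1 h2
    have h6 := lt_right_block h1 h2
    rw [lo] at h3
    rw [hi] at h4
    have hv := block_ne_zero (Q := Q) x
    generalize Q.block x = v at *
    by_cases hv2 : v ∈ Q.S₂
    · refine Or.inr ⟨v, hv2, ?_⟩
      rw [right, left_of_mem hv2] at h6
      rw [left_of_mem hv2] at h5
      rw [bottom_of_mem hv2] at h3
      rw [top_of_mem hv2] at h4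
      simp only [branchBoxes, Set.mem_ofPred_eq]
      omega
    · refine Or.inl ⟨v, (eq_one_or_mem_S₁_iff hv).2 hv2, ?_⟩
      rw [right_of_notMem hv2] at h6
      rw [left_of_notMem hv2] at h5
      rw [bottom_of_notMem hv2] at h3
      rw [top_of_notMem hv2] at h4
      simp only [branchBoxes, Set.mem_ofPred_eq]
      omega

end Blocks

end YShapedQuiver

namespace YShapedQuiver

/-! ### The vertices of the ladder quiver in terms of heights -/

section Vertices

variable {Q : YShapedQuiver}

open scoped Classical in
/-- The first coordinate of the point where the lattice paths of `v` start. -/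
noncomputable def srcX (v : Q.V) : ℤ := if v ∈ Q.S₂ then left v else 0

open scoped Classical in
/-- The first coordinate of the point where the lattice paths of `v` end. -/
noncomputable def tgtX (v : Q.V) : ℤ := if v ∈ Q.S₂ then Q.width 1 else right v

theorem srcX_of_mem {v : Q.V} (h : v ∈ Q.S₂) : srcX v = left v := if_pos h
theorem srcX_of_notMem {v : Q.V} (h : v ∉ Q.S₂) : srcX v = 0 := if_neg h
theorem tgtX_of_mem {v : Q.V} (h : v ∈ Q.S₂) : tgtX v = Q.width 1 := if_pos h
theorem tgtX_of_notMem {v : Q.V} (h : v ∉ Q.S₂) : tgtX v = right v := if_neg h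

theorem srcX_nonpos {v : Q.V} : srcX v ≤ 0 := by
  by_cases h : v ∈ Q.S₂
  · rw [srcX_of_mem h]
    exact (left_lt_right (ne_zero_of_one_lt h.1)).le.trans (right_nonpos h)
  · rw [srcX_of_notMem h]

theorem width_one_le_right {v : Q.V} (hv : v ≠ 0) (h : v ∉ Q.S₂) : Q.width 1 ≤ right v := by
  rcases (eq_one_or_mem_S₁_iff hv).2 h with rfl | h1
  · rw [right_one]
  · exact (width_one_le_left h1).trans (left_lt_right hv).le

theorem width_one_le_tgtX {v : Q.V} (hv : v ≠ 0) : Q.width 1 ≤ tgtX v := by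
  by_cases h : v ∈ Q.S₂
  · rw [tgtX_of_mem h]
  · rw [tgtX_of_notMem h]
    exact width_one_le_right hv h

theorem xMin_le_srcX {v : Q.V} (hv : v ≠ 0) : Q.xMin ≤ srcX v := by
  by_cases h : v ∈ Q.S₂
  · rw [srcX_of_mem h]
    exact xMin_le hv
  · rw [srcX_of_notMem h]
    exact Q.xMin_le_zero

theorem tgtX_le_xMax {v : Q.V} (hv : v ≠ 0) : tgtX v ≤ Q.xMax := by
  by_cases h : v ∈ Q.S₂
  · rw [tgtX_of_mem h]
    exact Q.width_one_le_xMax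
  · rw [tgtX_of_notMem h]
    exact le_xMax hv

variable (Q) in
/-- The abscissae of the vertices at the top of the diagram. -/
def topXs : Set ℤ := {x | ∃ v : Q.V, v ≠ 0 ∧ x = tgtX v}

variable (Q) in
/-- The abscissae of the vertices at the bottom of the diagram. -/
def bottomXs : Set ℤ := {x | ∃ v : Q.V, v ≠ 0 ∧ x = srcX v}

/-- The paths of all vertices of `S₂` end at the external vertex of vertex `1`, so `S₂` contributes
no further abscissae at the top. -/
theorem mem_topXs_iff {x : ℤ} : x ∈ Q.topXs ↔ ∃ v : Q.V, v ≠ 0 ∧ v ∉ Q.S₂ ∧ x = right v := by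
  constructor
  · rintro ⟨v, hv, rfl⟩
    by_cases h : v ∈ Q.S₂
    · exact ⟨1, one_ne_zero', one_notMem_S₂, by rw [tgtX_of_mem h, right_one]⟩
    · exact ⟨v, hv, h, tgtX_of_notMem h⟩
  · rintro ⟨v, hv, h, rfl⟩
    exact ⟨v, hv, (tgtX_of_notMem h).symm⟩

theorem mem_bottomXs_iff {x : ℤ} :
    x ∈ Q.bottomXs ↔ ∃ v : Q.V, (v = 1 ∨ v ∈ Q.S₂) ∧ x = left v := by
  constructor
  · rintro ⟨v, hv, rfl⟩
    by_cases h : v ∈ Q.S₂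
    · exact ⟨v, Or.inr h, srcX_of_mem h⟩
    · exact ⟨1, Or.inl rfl, by rw [srcX_of_notMem h, left_one]⟩
  · rintro ⟨v, rfl | h, rfl⟩
    · exact ⟨1, one_ne_zero', by rw [srcX_of_notMem one_notMem_S₂, left_one]⟩
    · exact ⟨v, ne_zero_of_one_lt h.1, (srcX_of_mem h).symm⟩

theorem block_change {x : ℤ} (h1 : Q.xMin < x) (h2 : x < Q.xMax)
    (h : Q.block (x - 1) ≠ Q.block x) : right (Q.block (x - 1)) = x ∧ left (Q.block x) = x := by
  have h3 := left_block_le (Q := Q) (x := x - 1) (by omega) (by omega)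
  have h4 := lt_right_block (Q := Q) (x := x - 1) (by omega) (by omega)
  have h5 := left_block_le (Q := Q) (x := x) (by omega) (by omega)
  have h6 := lt_right_block (Q := Q) (x := x) (by omega) (by omega)
  constructor
  · by_contra hne
    exact h (block_eq (block_ne_zero _) (by omega) (by omega)).symm
  · by_contra hne
    exact h (block_eq (block_ne_zero _) (by omega) (by omega))

/-- Consecutive blocks belong to consecutive vertices of a branch. -/
theorem parent_of_change {x : ℤ} (h1 : Q.xMin < x) (h2 : x < Q.xMax)
    (h : Q.block (x - 1) ≠ Q.block x) :
    if 0 < x then Q.n (Q.block (x - 1)) (Q.block x) ≠ 0 ∧ Q.block x ∉ Q.S₂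
    else Q.n (Q.block x) (Q.block (x - 1)) ≠ 0 ∧ Q.block (x - 1) ∈ Q.S₂ := by
  obtain ⟨h3, h4⟩ := block_change h1 h2 h
  split_ifs with hx
  · have hn : Q.block x ∉ Q.S₂ := fun h5 => by
      have := (block_mem_S₂_iff.1 h5).2
      omega
    refine ⟨?_, hn⟩
    have h1 : 1 < Q.block x := by
      refine (eq_one_or_one_lt (block_ne_zero x)).resolve_left fun h1 => ?_
      rw [h1, left_one] at h4
      omega
    obtain ⟨p, hp, hpx⟩ := exists_parent h1
    have h5 := left_eq_right_parent hp hpx hn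
    have h6 := left_lt_right hp
    have : Q.block (x - 1) = p := block_eq hp (by omega) (by omega)
    rwa [this]
  · have hn : Q.block (x - 1) ∈ Q.S₂ := block_mem_S₂_iff.2 ⟨by omega, by omega⟩
    refine ⟨?_, hn⟩
    obtain ⟨p, hp, hpx⟩ := exists_parent hn.1
    have h5 := right_eq_left_parent hp hpx hn
    have h6 := left_lt_right hp
    have : Q.block x = p := block_eq hp (by omega) (by omega)
    rwa [this]

/-- The top is constant over vertex `1` and `S₂`, so a jump can only occur at the right end of a
block outside `S₂`. -/
theorem mem_topXs_of_hi_ne {x : ℤ} (h1 : Q.xMin < x) (h2 : x < Q.xMax) (h : Q.hi (x - 1) ≠ Q.hi x) :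
    x ∈ Q.topXs := by
  have h3 := block_change h1 h2 fun e => h (by rw [hi, hi, e])
  refine mem_topXs_iff.2 ⟨_, block_ne_zero _, fun h4 => h ?_, h3.1.symm⟩
  have h5 := right_nonpos h4
  have := width_one_pos (Q := Q)
  rw [hi_eq (by omega), hi_eq (by omega)]

theorem mem_bottomXs_of_lo_ne {x : ℤ} (h1 : Q.xMin < x) (h2 : x < Q.xMax)
    (h : Q.lo (x - 1) ≠ Q.lo x) : x ∈ Q.bottomXs := by
  have h3 := block_change h1 h2 fun e => h (by rw [lo, lo, e])
  refine mem_bottomXs_iff.2 ⟨_, ?_, h3.2.symm⟩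
  by_contra h4
  rw [not_or] at h4
  have h5 := left_nonneg (block_ne_zero x) h4.2
  rcases h5.eq_or_lt with h5 | h5
  · refine h4.1 (block_eq one_ne_zero' ?_ ?_)
    · rw [left_one]
      omega
    · have := width_one_pos (Q := Q)
      rw [right_one]
      omega
  · exact h (by rw [lo_eq_zero (by omega), lo_eq_zero (by omega)])

theorem xMax_mem_topXs : Q.xMax ∈ Q.topXs := by
  obtain ⟨v, hv, h⟩ := Q.exists_right_eq_xMax
  refine mem_topXs_iff.2 ⟨v, hv, fun h2 => ?_, h.symm⟩
  have := right_nonpos h2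
  have := width_one_pos (Q := Q)
  have := Q.width_one_le_xMax
  omega

theorem xMin_mem_bottomXs : Q.xMin ∈ Q.bottomXs := by
  obtain ⟨v, hv, h⟩ := Q.exists_left_eq_xMin
  by_cases h2 : v ∈ Q.S₂
  · exact mem_bottomXs_iff.2 ⟨v, Or.inr h2, h.symm⟩
  · refine mem_bottomXs_iff.2 ⟨1, Or.inl rfl, ?_⟩
    have := left_nonneg hv h2
    have := Q.xMin_le_zero
    rw [left_one]
    omega

theorem zero_mem_bottomXs : (0 : ℤ) ∈ Q.bottomXs :=
  mem_bottomXs_iff.2 ⟨1, Or.inl rfl, left_one.symm⟩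

theorem hi_right {v : Q.V} (hv : v ≠ 0) : Q.hi (right v - 1) = top v := by
  have := left_lt_right hv
  exact hi_block hv (by omega) (by omega)

theorem lo_left {v : Q.V} (hv : v ≠ 0) : Q.lo (left v) = bottom v :=
  lo_block hv le_rfl (left_lt_right hv)

theorem externalVertex_of_notMem {v : Q.V} (hv : v ≠ 0) (h : v ∉ Q.S₂) :
    Q.externalVertex v = (right v, Q.hi (right v - 1)) := by
  rw [externalVertex, place, if_neg h, hi_right hv, top_of_notMem h, right_of_notMem h]

theorem externalVertex_of_mem {v : Q.V} (h : v ∈ Q.S₂) :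
    Q.externalVertex v = (left v, Q.lo (left v)) := by
  rw [externalVertex, place, if_pos h, lo_left (ne_zero_of_one_lt h.1), bottom_of_mem h,
    left_of_mem h]

theorem top_mem_vertices {x : ℤ} (h : x ∈ Q.topXs) : (x, Q.hi (x - 1)) ∈ Q.vertices := by
  obtain ⟨v, hv, h2, rfl⟩ := mem_topXs_iff.1 h
  exact Or.inl (Or.inl (Or.inr ⟨v, hv, (externalVertex_of_notMem hv h2).symm⟩))

theorem bottom_mem_vertices {x : ℤ} (h : x ∈ Q.bottomXs) : (x, Q.lo x) ∈ Q.vertices := by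
  obtain ⟨v, rfl | h2, rfl⟩ := mem_bottomXs_iff.1 h
  · rw [left_one, lo_eq_zero le_rfl]
    exact Or.inl (Or.inl (Or.inl rfl))
  · exact Or.inl (Or.inl (Or.inr ⟨v, ne_zero_of_one_lt h2.1, (externalVertex_of_mem h2).symm⟩))

theorem min_mem_vertices {x : ℤ} (h : x ∈ Q.topXs) (h2 : x < Q.xMax) :
    (x, min (Q.hi (x - 1)) (Q.hi x)) ∈ Q.vertices := by
  obtain ⟨v, hv, hv2, rfl⟩ := mem_topXs_iff.1 h
  have h0 := left_lt_right hv
  have h1 : Q.block (right v - 1) = v := block_eq hv (by omega) (by omega)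
  have h3 : Q.block (right v - 1) ≠ Q.block (right v) := by
    rw [h1]
    intro e
    have h4 := lt_right_block (Q := Q) (x := right v)
      ((xMin_le hv).trans (left_lt_right hv).le) h2
    rw [← e] at h4
    exact lt_irrefl _ h4
  have hpos : 0 < right v := by
    have := left_nonneg hv hv2
    omega
  have h5 := parent_of_change (by have := Q.xMin_le_zero; omega) h2 h3
  rw [if_pos hpos, h1] at h5
  refine Or.inr ⟨v, _, hv, h5.1, ?_⟩
  rw [place, if_neg h5.2, hi, hi, h1, top_of_notMem hv2, top_of_notMem h5.2, right_of_notMem hv2]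

/-- On `S₂` the half-turn makes the minimum of two heights into a maximum and right ends of blocks
into left ends. -/
theorem max_mem_vertices {x : ℤ} (h : x ∈ Q.bottomXs) (h2 : Q.xMin < x) :
    (x, max (Q.lo (x - 1)) (Q.lo x)) ∈ Q.vertices := by
  obtain ⟨v, hv2, rfl⟩ := mem_bottomXs_iff.1 h
  have hv : v ≠ 0 := by
    rcases hv2 with rfl | hv2
    · exact one_ne_zero'
    · exact ne_zero_of_one_lt hv2.1
  have h0 := left_lt_right hv
  have h1 : Q.block (left v) = v := block_eq hv (by omega) (by omega)
  have hmax : left v < Q.xMax := h0.trans_le (le_xMax hv)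
  have h3 : Q.block (left v - 1) ≠ Q.block (left v) := by
    rw [h1]
    intro e
    have h4 := left_block_le (Q := Q) (x := left v - 1) (by omega) (by omega)
    rw [e] at h4
    omega
  have hpos : ¬ 0 < left v := by
    rcases hv2 with rfl | hv2
    · rw [left_one]
      exact lt_irrefl 0
    · have := right_nonpos hv2
      omega
  have h5 := parent_of_change h2 hmax h3
  have h6 := (block_change h2 hmax h3).1
  rw [if_neg hpos, h1] at h5
  refine Or.inr ⟨v, _, hv, h5.1, ?_⟩
  have hb : bottom v = (Q.r 1 : ℤ) - Q.r v := by
    rcases hv2 with rfl | hv2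
    · rw [bottom_of_notMem one_notMem_S₂]
      ring
    · exact bottom_of_mem hv2
  have hx := right_eq_left_parent hv h5.1 h5.2
  have hw := width_parent hv h5.1
  have hl : left v = Q.width 1 - Q.width v := by
    rcases hv2 with rfl | hv2
    · rw [left_one]
      ring
    · exact left_of_mem hv2
  rw [place, if_pos h5.2, lo, lo, h1, hb, bottom_of_mem h5.2]
  refine Prod.ext hl ?_
  simp only
  omega

theorem interior_mem_vertices {x y : ℤ} (h1 : Q.xMin < x) (h2 : x < Q.xMax) (h3 : Q.lo (x - 1) < y)
    (h4 : Q.lo x < y) (h5 : y < Q.hi (x - 1)) (h6 : y < Q.hi x) : (x, y) ∈ Q.vertices := by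
  refine Or.inl (Or.inr ?_)
  simp only [interiorPoints, Set.mem_ofPred_eq, mem_boxes]
  omega

/-- With this description, in which the half-turn no longer appears, questions about single steps
become linear integer arithmetic in `lo` and `hi`. -/
theorem mem_vertices_iff {x y : ℤ} : (x, y) ∈ Q.vertices ↔
    (x ∈ Q.topXs ∧ y = Q.hi (x - 1)) ∨ (x ∈ Q.bottomXs ∧ y = Q.lo x) ∨
    ((Q.xMin < x ∧ x < Q.xMax) ∧ Q.lo (x - 1) < y ∧ Q.lo x < y ∧ y < Q.hi (x - 1) ∧ y < Q.hi x) ∨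
    (x ∈ Q.topXs ∧ x < Q.xMax ∧ y = min (Q.hi (x - 1)) (Q.hi x)) ∨
    (x ∈ Q.bottomXs ∧ Q.xMin < x ∧ y = max (Q.lo (x - 1)) (Q.lo x)) := by
  constructor
  · rintro (((h | ⟨v, hv, h⟩) | h) | ⟨p, i, hp, hpi, h⟩)
    · obtain ⟨rfl, rfl⟩ := Prod.mk.inj h
      exact Or.inr (Or.inl ⟨zero_mem_bottomXs, (lo_eq_zero le_rfl).symm⟩)
    · by_cases hv2 : v ∈ Q.S₂
      · rw [externalVertex_of_mem hv2] at h
        obtain ⟨rfl, rfl⟩ := Prod.mk.inj h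
        exact Or.inr (Or.inl ⟨mem_bottomXs_iff.2 ⟨v, Or.inr hv2, rfl⟩, rfl⟩)
      · rw [externalVertex_of_notMem hv hv2] at h
        obtain ⟨rfl, rfl⟩ := Prod.mk.inj h
        exact Or.inl ⟨mem_topXs_iff.2 ⟨v, hv, hv2, rfl⟩, rfl⟩
    · simp only [interiorPoints, Set.mem_ofPred_eq, mem_boxes] at h
      exact Or.inr (Or.inr (Or.inl (by omega)))
    · have hi0 := ne_zero_of_one_lt (one_lt_of_n_ne_zero hp hpi)
      have hi1 := left_lt_right hi0
      have hi2 := left_lt_right hp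
      by_cases hi : i ∈ Q.S₂
      · have e := right_eq_left_parent hp hpi hi
        have e1 : Q.lo (right i - 1) = bottom i := lo_block hi0 (by omega) (by omega)
        have e2 : Q.lo (right i) = bottom p := by rw [e, lo_left hp]
        have hbp : bottom p = (Q.r 1 : ℤ) - Q.r p ∧ left p = Q.width 1 - Q.width p := by
          rcases parent_of_mem_S₂ hp hpi hi with rfl | hp2
          · rw [bottom_of_notMem one_notMem_S₂, left_one]
            exact ⟨by ring, by ring⟩
          · exact ⟨bottom_of_mem hp2, left_of_mem hp2⟩
        rw [place, if_pos hi] at h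
        obtain ⟨hx, hy⟩ := Prod.mk.inj h
        simp only at hx hy
        have hx' : x = right i := by omega
        subst hx'
        have hm := xMin_le hi0
        refine Or.inr (Or.inr (Or.inr (Or.inr ⟨mem_bottomXs_iff.2 ⟨p, parent_of_mem_S₂ hp hpi hi, e⟩,
          by omega, ?_⟩)))
        rw [e1, e2, hbp.1, bottom_of_mem hi, hy]
        omega
      · have hp2 := parent_notMem_S₂ hp hpi hi
        have e := left_eq_right_parent hp hpi hi
        rw [place, if_neg hi, ← right_of_notMem hp2] at h
        obtain ⟨rfl, hy⟩ := Prod.mk.inj h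
        have hm := le_xMax hi0
        have e2 : Q.hi (right p) = top i := hi_block hi0 (by omega) (by omega)
        refine Or.inr (Or.inr (Or.inr (Or.inl ⟨mem_topXs_iff.2 ⟨p, hp, hp2, rfl⟩, by omega, ?_⟩)))
        rw [hi_right hp, e2, top_of_notMem hp2, top_of_notMem hi, hy]
  · rintro (⟨h, rfl⟩ | ⟨h, rfl⟩ | h | ⟨h, h2, rfl⟩ | ⟨h, h2, rfl⟩)
    · exact top_mem_vertices h
    · exact bottom_mem_vertices h
    · exact interior_mem_vertices h.1.1 h.1.2 h.2.1 h.2.2.1 h.2.2.2.1 h.2.2.2.2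
    · exact min_mem_vertices h h2
    · exact max_mem_vertices h h2

/-- These are the inequalities on which the case distinctions below rely: interior points, the
corners where the top or the bottom jumps, and the two extreme corners are vertices and thus
excluded. -/
theorem arith_of_notMem {x y : ℤ} (h : (x, y) ∉ Q.vertices) :
    ¬ (Q.xMin < x ∧ x < Q.xMax ∧ Q.lo (x - 1) < y ∧ Q.lo x < y ∧ y < Q.hi (x - 1) ∧ y < Q.hi x) ∧
    (Q.xMin < x → x < Q.xMax → Q.hi (x - 1) ≠ Q.hi x →
      y ≠ Q.hi (x - 1) ∧ (Q.hi x < Q.hi (x - 1) → y ≠ Q.hi x)) ∧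
    (Q.xMin < x → x < Q.xMax → Q.lo (x - 1) ≠ Q.lo x →
      y ≠ Q.lo x ∧ (Q.lo x < Q.lo (x - 1) → y ≠ Q.lo (x - 1))) ∧
    (x = Q.xMax → y ≠ Q.hi (x - 1)) ∧ (x = Q.xMin → y ≠ Q.lo x) := by
  refine ⟨fun h1 => h (interior_mem_vertices h1.1 h1.2.1 h1.2.2.1 h1.2.2.2.1 h1.2.2.2.2.1
    h1.2.2.2.2.2), fun h1 h2 h3 => ⟨?_, ?_⟩, fun h1 h2 h3 => ⟨?_, ?_⟩, ?_, ?_⟩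
  · rintro rfl
    exact h (top_mem_vertices (mem_topXs_of_hi_ne h1 h2 h3))
  · rintro h4 rfl
    have := min_mem_vertices (mem_topXs_of_hi_ne h1 h2 h3) h2
    rw [min_eq_right h4.le] at this
    exact h this
  · rintro rfl
    exact h (bottom_mem_vertices (mem_bottomXs_of_lo_ne h1 h2 h3))
  · rintro h4 rfl
    have := max_mem_vertices (mem_bottomXs_of_lo_ne h1 h2 h3) h1
    rw [max_eq_left h4.le] at this
    exact h this
  · rintro rfl rfl
    exact h (top_mem_vertices xMax_mem_topXs)
  · rintro rfl rfl
    exact h (bottom_mem_vertices xMin_mem_bottomXs)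

theorem column_arith (x : ℤ) : Q.lo x < Q.hi x ∧ (0 ≤ x → Q.lo x = 0) ∧
    (x < Q.width 1 → Q.hi x = Q.r 1) :=
  ⟨lo_lt_hi x, lo_eq_zero, hi_eq⟩

variable (Q) in
theorem range_arith : Q.xMin ≤ 0 ∧ 0 < Q.width 1 ∧ Q.width 1 ≤ Q.xMax :=
  ⟨Q.xMin_le_zero, width_one_pos, Q.width_one_le_xMax⟩

theorem step_right_iff {x y : ℤ} : Q.Step (x, y) (x + 1, y) ↔
    Q.xMin ≤ x ∧ x < Q.xMax ∧ Q.lo x ≤ y ∧ y ≤ Q.hi x := by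
  have := lo_lt_hi (Q := Q) x
  constructor
  · rintro (⟨_, h⟩ | ⟨h, _⟩)
    · simp only [mem_boxes] at h
      omega
    · have := (Prod.mk.inj h).1
      simp only at this
      omega
  · intro h
    refine Or.inl ⟨rfl, ?_⟩
    simp only [mem_boxes]
    omega

theorem step_up_iff {x y : ℤ} : Q.Step (x, y) (x, y + 1) ↔
    (Q.xMin ≤ x ∧ x < Q.xMax ∧ Q.lo x ≤ y ∧ y < Q.hi x) ∨
    (Q.xMin < x ∧ x ≤ Q.xMax ∧ Q.lo (x - 1) ≤ y ∧ y < Q.hi (x - 1)) := by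
  constructor
  · rintro (⟨h, _⟩ | ⟨_, h⟩)
    · have := (Prod.mk.inj h).1
      simp only at this
      omega
    · simp only [mem_boxes] at h
      omega
  · intro h
    refine Or.inr ⟨rfl, ?_⟩
    simp only [mem_boxes]
    omega

theorem step_cases {x y : ℤ} {P : ℤ × ℤ} (h : Q.Step (x, y) P) :
    (P = (x + 1, y) ∧ Q.xMin ≤ x ∧ x < Q.xMax ∧ Q.lo x ≤ y ∧ y ≤ Q.hi x) ∨
    (P = (x, y + 1) ∧ ((Q.xMin ≤ x ∧ x < Q.xMax ∧ Q.lo x ≤ y ∧ y < Q.hi x) ∨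
    (Q.xMin < x ∧ x ≤ Q.xMax ∧ Q.lo (x - 1) ≤ y ∧ y < Q.hi (x - 1)))) := by
  have h' := h
  rcases h with ⟨rfl, _⟩ | ⟨rfl, _⟩
  · exact Or.inl ⟨rfl, step_right_iff.1 h'⟩
  · exact Or.inr ⟨rfl, step_up_iff.1 h'⟩

theorem step_cases' {x y : ℤ} {P : ℤ × ℤ} (h : Q.Step P (x, y)) :
    (P = (x - 1, y) ∧ Q.xMin ≤ x - 1 ∧ x - 1 < Q.xMax ∧ Q.lo (x - 1) ≤ y ∧ y ≤ Q.hi (x - 1)) ∨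
    (P = (x, y - 1) ∧ ((Q.xMin ≤ x ∧ x < Q.xMax ∧ Q.lo x ≤ y - 1 ∧ y - 1 < Q.hi x) ∨
    (Q.xMin < x ∧ x ≤ Q.xMax ∧ Q.lo (x - 1) ≤ y - 1 ∧ y - 1 < Q.hi (x - 1)))) := by
  obtain ⟨a, b⟩ := P
  rcases step_cases h with ⟨h1, h2⟩ | ⟨h1, h2⟩ <;> obtain ⟨rfl, rfl⟩ := Prod.mk.inj h1
  · refine Or.inl ⟨?_, ?_⟩
    · rw [add_sub_cancel_right]
    · rwa [add_sub_cancel_right]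
  · refine Or.inr ⟨?_, ?_⟩
    · rw [add_sub_cancel_right]
    · rwa [add_sub_cancel_right]

/-- The box at `(x, y)`. -/
def Box (Q : YShapedQuiver) (x y : ℤ) : Prop := Q.xMin ≤ x ∧ x < Q.xMax ∧ Q.lo x ≤ y ∧ y < Q.hi x

variable (Q) in
/-- The points that are not vertices, at which at most one edge leaves. -/
def merging : Set (ℤ × ℤ) :=
  {P | P ∉ Q.vertices ∧ ¬ Q.Box P.1 P.2 ∧
    ((Q.Box (P.1 - 1) (P.2 - 1) ∧ (¬ Q.Box P.1 (P.2 - 1) ∨ ¬ Q.Box (P.1 - 1) P.2)) ∨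
    (Q.Box (P.1 - 1) P.2 ∧ ¬ Q.Box P.1 (P.2 - 1)))}

theorem mem_merging {x y : ℤ} : (x, y) ∈ Q.merging ↔ (x, y) ∉ Q.vertices ∧ ¬ Q.Box x y ∧
    ((Q.Box (x - 1) (y - 1) ∧ (¬ Q.Box x (y - 1) ∨ ¬ Q.Box (x - 1) y)) ∨
    (Q.Box (x - 1) y ∧ ¬ Q.Box x (y - 1))) := Iff.rfl

theorem step_exists_out {P P' : ℤ × ℤ} (hv : P' ∉ Q.vertices) (hs : Q.Step P P') :
    ∃ P'', Q.Step P' P'' := by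
  obtain ⟨x, y⟩ := P'
  by_contra! hcon
  have h1 := mt step_right_iff.2 (hcon (x + 1, y))
  have h2 := mt step_up_iff.2 (hcon (x, y + 1))
  have h3 := arith_of_notMem hv
  have h4 := column_arith (Q := Q) x
  have h5 := column_arith (Q := Q) (x - 1)
  have h6 := Q.range_arith
  rcases step_cases' hs with ⟨-, h⟩ | ⟨-, h⟩ <;> grind

theorem step_exists_in {P P' : ℤ × ℤ} (hv : P ∉ Q.vertices) (hs : Q.Step P P') :
    ∃ P'', Q.Step P'' P := by
  obtain ⟨x, y⟩ := P
  by_contra! hcon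
  have h1 : ¬ Q.Step (x - 1, y) (x - 1 + 1, y) := by
    rw [sub_add_cancel]
    exact hcon _
  have h2 : ¬ Q.Step (x, y - 1) (x, y - 1 + 1) := by
    rw [sub_add_cancel]
    exact hcon _
  rw [step_right_iff] at h1
  rw [step_up_iff] at h2
  have h3 := arith_of_notMem hv
  have h4 := column_arith (Q := Q) x
  have h5 := column_arith (Q := Q) (x - 1)
  have h6 := Q.range_arith
  rcases step_cases hs with ⟨-, h⟩ | ⟨-, h⟩ <;> grind

variable (Q) in
-- A point of the diagram that is not a vertex lies on its boundary, and the four boxes around it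
-- determine which edges enter and leave. As the corners that would allow two entries together with
-- two exits are vertices, what remains is arithmetic with the heights of neighbouring columns.
theorem isForked : Q.IsForked Q.merging where
  notMem P h := h.1
  out_unique := by
    rintro ⟨x, y⟩ h P₁ P₂ h1 h2
    have h3 := arith_of_notMem h.1
    obtain ⟨-, h⟩ := mem_merging.1 h
    simp only [Box] at h
    have h4 := column_arith (Q := Q) x
    have h5 := column_arith (Q := Q) (x - 1)
    have h6 := Q.range_arith
    rcases step_cases h1 with ⟨rfl, h1⟩ | ⟨rfl, h1⟩ <;>
      rcases step_cases h2 with ⟨rfl, h2⟩ | ⟨rfl, h2⟩ <;> first | rfl | (exfalso; grind)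
  in_unique := by
    rintro ⟨x, y⟩ hv h P₁ P₂ h1 h2
    have h3 := arith_of_notMem hv
    have h := not_and.1 (mt mem_merging.2 h) hv
    simp only [Box] at h
    have h4 := column_arith (Q := Q) x
    have h5 := column_arith (Q := Q) (x - 1)
    have h6 := Q.range_arith
    rcases step_cases' h1 with ⟨rfl, h1⟩ | ⟨rfl, h1⟩ <;>
      rcases step_cases' h2 with ⟨rfl, h2⟩ | ⟨rfl, h2⟩ <;> first | rfl | (exfalso; grind)
  next := by
    rintro ⟨x, y⟩ h P' h1
    have h3 := arith_of_notMem h.1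
    obtain ⟨-, h⟩ := mem_merging.1 h
    simp only [Box] at h
    have h4 := column_arith (Q := Q) x
    have h5 := column_arith (Q := Q) (x - 1)
    have h6 := Q.range_arith
    by_contra hcon
    rw [not_or] at hcon
    obtain ⟨hv, hM⟩ := hcon
    rcases step_cases h1 with ⟨rfl, h1⟩ | ⟨rfl, h1⟩
    · have h7 := arith_of_notMem hv
      have h8 := not_and.1 (mt mem_merging.2 hM) hv
      have h9 := column_arith (Q := Q) (x + 1)
      simp only [Box, add_sub_cancel_right] at h7 h8
      grind
    · have h7 := arith_of_notMem hv
      have h8 := not_and.1 (mt mem_merging.2 hM) hv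
      simp only [Box, add_sub_cancel_right] at h7 h8
      grind
  exists_out _ _ := step_exists_out
  exists_in _ _ := step_exists_in

end Vertices

end YShapedQuiver

namespace YShapedQuiver

/-! ### Sums of differences over intervals of integers -/

theorem _root_.Int.sum_Ico_sub {M : Type} [AddCommGroup M] (G : ℤ → M) {a b : ℤ} (h : a ≤ b) :
    ∑ y ∈ Finset.Ico a b, (G (y + 1) - G y) = G b - G a := by
  induction b, h using Int.leInduction with
  | base => simp
  | succ n hn ih =>
    rw [← Finset.insert_Ico_right_eq_Ico_add_one hn, Finset.sum_insert (by simp), ih]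
    abel

theorem _root_.Int.exists_antiderivative {M : Type} [AddCommGroup M] (g : ℤ → M) :
    ∃ G : ℤ → M, ∀ y, G (y + 1) - G y = g y := by
  refine ⟨fun y => ∑ z ∈ Finset.Ico 0 y, g z - ∑ z ∈ Finset.Ico y 0, g z, fun y => ?_⟩
  rcases lt_or_ge y 0 with h | h
  · simp only
    rw [← Finset.insert_Ico_add_one_left_eq_Ico h, Finset.sum_insert (by simp),
      Finset.Ico_eq_empty (a := 0) (b := y + 1) (by omega),
      Finset.Ico_eq_empty (a := 0) (b := y) (by omega)]
    simp
  · simp only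
    rw [← Finset.insert_Ico_right_eq_Ico_add_one h, Finset.sum_insert (by simp),
      Finset.Ico_eq_empty (a := y + 1) (by omega), Finset.Ico_eq_empty (a := y) (by omega)]
    simp

/-- Both orders of `a` and `b` are allowed, so that a rise and a fall of the boundary are covered by
one formula. -/
theorem _root_.Int.antiderivative_const {M : Type} [AddCommGroup M] {g G : ℤ → M}
    (hG : ∀ y, G (y + 1) - G y = g y) {a b : ℤ} {t : M}
    (h : ∀ y, (a ≤ y ∧ y < b) ∨ (b ≤ y ∧ y < a) → g y = t) : G b - G a = (b - a) • t := by
  have key : ∀ a b : ℤ, a ≤ b → (∀ y, a ≤ y ∧ y < b → g y = t) → G b - G a = (b - a) • t := by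
    intro a b hab h
    rw [← Int.sum_Ico_sub G hab, Finset.sum_congr rfl fun y hy =>
      (hG y).trans (h y (Finset.mem_Ico.1 hy)), Finset.sum_const, Int.card_Ico, ← natCast_zsmul,
      Int.toNat_of_nonneg (by omega)]
  rcases le_total a b with hab | hab
  · exact key a b hab fun y hy => h y (Or.inl hy)
  · rw [← neg_sub, key b a hab fun y hy => h y (Or.inr hy), ← neg_smul, neg_sub]

/-! ### A potential that concentrates the weight of an arrow on its private edge -/

section Potential

variable {Q : YShapedQuiver}

variable (Q) in
/-- The basis vector of the character lattice that belongs to a point. -/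
def eAt (P : ℤ × ℤ) : Q.CharacterLattice := fun P' => if P'.1.1 = P then 1 else 0

theorem eAt_zero : Q.eAt (0, 0) = 0 := funext fun P' => if_neg P'.2

/-- The point where the lattice paths of `v` start. -/
noncomputable def srcPoint (v : Q.V) : ℤ × ℤ := (srcX v, Q.lo (srcX v))

/-- The point where the lattice paths of `v` end. -/
noncomputable def tgtPoint (v : Q.V) : ℤ × ℤ := (tgtX v, Q.hi (tgtX v - 1))

theorem srcPoint_mem {v : Q.V} (hv : v ≠ 0) : srcPoint v ∈ Q.vertices :=
  bottom_mem_vertices ⟨v, hv, rfl⟩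

theorem tgtPoint_mem {v : Q.V} (hv : v ≠ 0) : tgtPoint v ∈ Q.vertices :=
  top_mem_vertices ⟨v, hv, rfl⟩

theorem srcPoint_of_notMem {v : Q.V} (h : v ∉ Q.S₂) : srcPoint v = (0, 0) := by
  rw [srcPoint, srcX_of_notMem h, lo_eq_zero le_rfl]

theorem tgtPoint_of_notMem_S₁ {v : Q.V} (hv : v ≠ 0) (h : v ∉ Q.S₁) :
    tgtPoint v = (Q.width 1, Q.hi (Q.width 1 - 1)) := by
  rcases eq_one_or_one_lt hv with rfl | h1
  · rw [tgtPoint, tgtX_of_notMem one_notMem_S₂, right_one]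
  · rw [tgtPoint, tgtX_of_mem ⟨h1, h⟩]

theorem block_notMem_S₁ {x : ℤ} (h : x < Q.width 1) : Q.block x ∉ Q.S₁ := by
  intro h1
  have h2 := width_one_le_left h1
  have h3 : Q.block x ∉ Q.S₂ := notMem_S₂_of_mem_S₁ h1
  by_cases hx : Q.xMin ≤ x ∧ x < Q.xMax
  · have := left_block_le hx.1 hx.2
    omega
  · rw [block_eq_one_of_not hx] at h1
    exact one_notMem_S₁ h1

variable (Q) in
/-- The target of the lattice paths of the block to the left of the line `x`. -/
noncomputable def topE (x : ℤ) : Q.CharacterLattice := Q.eAt (tgtPoint (Q.block (x - 1)))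

variable (Q) in
/-- The source of the lattice paths of the block to the right of the line `x`. -/
noncomputable def bottomE (x : ℤ) : Q.CharacterLattice := Q.eAt (srcPoint (Q.block x))

theorem bottomE_of_nonneg {x : ℤ} (h : 0 ≤ x) : Q.bottomE x = 0 := by
  rw [bottomE, srcPoint_of_notMem, eAt_zero]
  intro h1
  have := (block_mem_S₂_iff.1 h1).2
  omega

theorem topE_of_le {x : ℤ} (h : x ≤ Q.width 1) : Q.topE x = Q.eAt (tgtPoint (1 : Q.V)) := by
  rw [topE, tgtPoint_of_notMem_S₁ (block_ne_zero _) (block_notMem_S₁ (by omega)),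
    tgtPoint_of_notMem_S₁ one_ne_zero' one_notMem_S₁]

theorem topE_of_mem {x : ℤ} (h : x ∈ Q.topXs) : Q.topE x = Q.eAt (x, Q.hi (x - 1)) := by
  obtain ⟨v, hv, h2, rfl⟩ := mem_topXs_iff.1 h
  have := left_lt_right hv
  rw [topE, block_eq hv (by omega) (by omega), tgtPoint, tgtX_of_notMem h2]

theorem bottomE_of_mem {x : ℤ} (h : x ∈ Q.bottomXs) : Q.bottomE x = Q.eAt (x, Q.lo x) := by
  obtain ⟨v, h2, rfl⟩ := mem_bottomXs_iff.1 h
  have hv : v ≠ 0 := h2.elim (fun h => h ▸ one_ne_zero') fun h => ne_zero_of_one_lt h.1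
  rw [bottomE, block_eq hv le_rfl (left_lt_right hv), srcPoint]
  rcases h2 with rfl | h2
  · rw [srcX_of_notMem one_notMem_S₂, left_one]
  · rw [srcX_of_mem h2]

theorem topE_add_one {x : ℤ} (h1 : Q.xMin < x) (h2 : x < Q.xMax) (h : x ∉ Q.topXs) :
    Q.topE (x + 1) = Q.topE x := by
  by_cases hb : Q.block (x - 1) = Q.block x
  · rw [topE, topE, add_sub_cancel_right, hb]
  · have h3 := (block_change h1 h2 hb).1
    by_cases hS : Q.block (x - 1) ∈ Q.S₂
    · have := right_nonpos hS
      have := width_one_pos (Q := Q)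
      rw [topE_of_le (by omega), topE_of_le (by omega)]
    · exact absurd (mem_topXs_iff.2 ⟨_, block_ne_zero _, hS, h3.symm⟩) h

theorem bottomE_sub_one {x : ℤ} (h1 : Q.xMin < x) (h2 : x < Q.xMax) (h : x ∉ Q.bottomXs) :
    Q.bottomE (x - 1) = Q.bottomE x := by
  by_cases hb : Q.block (x - 1) = Q.block x
  · rw [bottomE, bottomE, hb]
  · have h3 := (block_change h1 h2 hb).2
    by_cases hS : Q.block x = 1 ∨ Q.block x ∈ Q.S₂
    · exact absurd (mem_bottomXs_iff.2 ⟨_, hS, h3.symm⟩) h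
    · rw [not_or] at hS
      have h4 := (eq_one_or_mem_S₁_iff (block_ne_zero x)).2 hS.2
      have := width_one_le_left (h4.resolve_left hS.1)
      have := width_one_pos (Q := Q)
      rw [bottomE_of_nonneg (by omega), bottomE_of_nonneg (by omega)]

open scoped Classical in
variable (Q) in
/-- A function on the points of the diagram that extends the standard basis of the character lattice,
and is constant along every arrow up to one edge. -/
noncomputable def potential (P : ℤ × ℤ) : Q.CharacterLattice :=
  if P ∈ Q.vertices then Q.eAt P
  -- A merging point gets the value of the vertex ahead, a splitting point that of the vertex
  -- behind. The exceptional cases are vertical walls: a merging point below the bottom of the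
  -- column to its right is led up to a bottom vertex, and a splitting point above the top of the
  -- column to its left comes up from a top vertex.
  else if P ∈ Q.merging then if P.2 < Q.lo P.1 then Q.bottomE P.1 else Q.topE P.1
  else if Q.hi (P.1 - 1) < P.2 then Q.topE P.1 else Q.bottomE P.1

theorem potential_of_mem {P : ℤ × ℤ} (h : P ∈ Q.vertices) : Q.potential P = Q.eAt P := if_pos h

theorem mem_topXs_le {x : ℤ} (h : x ∈ Q.topXs) : Q.width 1 ≤ x := by
  obtain ⟨v, hv, rfl⟩ := h
  exact width_one_le_tgtX hv

theorem mem_bottomXs_le {x : ℤ} (h : x ∈ Q.bottomXs) : x ≤ 0 := by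
  obtain ⟨v, hv, rfl⟩ := h
  exact srcX_nonpos

/-- The points on the line `x` at the top boundary of the diagram. -/
def IsTop (Q : YShapedQuiver) (x y : ℤ) : Prop :=
  (Q.xMin < x ∧ x < Q.xMax ∧
    ((Q.hi x < y ∧ y ≤ Q.hi (x - 1)) ∨ (Q.hi (x - 1) ≤ y ∧ y ≤ Q.hi x))) ∨
  (x = Q.xMax ∧ Q.lo (x - 1) ≤ y ∧ y ≤ Q.hi (x - 1))

/-- The points on the line `x` at the bottom boundary of the diagram. -/
def IsBottom (Q : YShapedQuiver) (x y : ℤ) : Prop :=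
  (Q.xMin < x ∧ x < Q.xMax ∧
    ((Q.lo (x - 1) ≤ y ∧ y ≤ Q.lo x) ∨ (Q.lo x ≤ y ∧ y < Q.lo (x - 1)))) ∨
  (x = Q.xMin ∧ Q.lo x ≤ y ∧ y ≤ Q.hi x)

/-- The only possible vertex among these points is the one at height `hi (x - 1)`, whose basis
vector is `topE x`. The strict inequality in `IsTop` leaves out the foot of a descending wall, an
intersection point with a basis vector of its own. -/
theorem IsTop.potential_eq {x y : ℤ} (h : Q.IsTop x y) : Q.potential (x, y) = Q.topE x := by
  have h4 := column_arith (Q := Q) x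
  have h5 := column_arith (Q := Q) (x - 1)
  have h6 := Q.range_arith
  rw [IsTop] at h
  by_cases hv : (x, y) ∈ Q.vertices
  · rw [potential_of_mem hv]
    have key : x ∈ Q.topXs ∧ y = Q.hi (x - 1) := by
      have hT := mem_topXs_le (Q := Q) (x := x)
      have hB := mem_bottomXs_le (Q := Q) (x := x)
      rw [mem_vertices_iff] at hv
      grind
    rw [topE_of_mem key.1, key.2]
  · have h3 := arith_of_notMem hv
    rw [potential, if_neg hv]
    by_cases hM : (x, y) ∈ Q.merging
    · rw [if_pos hM, if_neg]
      simp only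
      grind
    · rw [if_neg hM, if_pos]
      have h8 := not_and.1 (mt mem_merging.2 hM) hv
      simp only [Box] at h8
      simp only
      grind

theorem IsBottom.potential_eq {x y : ℤ} (h : Q.IsBottom x y) : Q.potential (x, y) = Q.bottomE x := by
  have h4 := column_arith (Q := Q) x
  have h5 := column_arith (Q := Q) (x - 1)
  have h6 := Q.range_arith
  rw [IsBottom] at h
  by_cases hv : (x, y) ∈ Q.vertices
  · rw [potential_of_mem hv]
    have key : x ∈ Q.bottomXs ∧ y = Q.lo x := by
      have hT := mem_topXs_le (Q := Q) (x := x)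
      have hB := mem_bottomXs_le (Q := Q) (x := x)
      rw [mem_vertices_iff] at hv
      grind
    rw [bottomE_of_mem key.1, key.2]
  · have h3 := arith_of_notMem hv
    rw [potential, if_neg hv]
    by_cases hM : (x, y) ∈ Q.merging
    · rw [if_pos hM, if_pos]
      have h8 := (mem_merging.1 hM).2
      simp only [Box] at h8
      simp only
      grind
    · rw [if_neg hM, if_neg]
      simp only
      grind

/-- An edge that is not private starts at a merging point or ends at a splitting point. In the first
case both ends share the vertex ahead, in the second case the vertex behind. -/
theorem potential_eq_of_step {P P' : ℤ × ℤ} (hs : Q.Step P P') (h : ¬ Q.IsPrivate Q.merging (P, P')) :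
    Q.potential P' = Q.potential P := by
  have h6 := Q.range_arith
  obtain ⟨x, y⟩ := P
  by_cases hM : (x, y) ∈ Q.merging
  · have h3 := arith_of_notMem hM.1
    have hM' := (mem_merging.1 hM).2
    simp only [Box] at hM'
    have h4 := column_arith (Q := Q) x
    have h5 := column_arith (Q := Q) (x - 1)
    rcases step_cases hs with ⟨rfl, h1⟩ | ⟨rfl, h1⟩
    · have hy : y = Q.hi (x - 1) ∧ Q.xMin < x := by grind
      have h9 := column_arith (Q := Q) (x + 1)
      have ht : Q.IsTop x y := by rw [IsTop]; grind
      have ht' : Q.IsTop (x + 1) y := by rw [IsTop, add_sub_cancel_right]; grind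
      rw [ht.potential_eq, ht'.potential_eq]
      refine topE_add_one hy.2 h1.2.1 fun hx => hM.1 ?_
      rw [hy.1]
      exact top_mem_vertices hx
    · have key : (Q.IsTop x y ∧ Q.IsTop x (y + 1)) ∨ (Q.IsBottom x y ∧ Q.IsBottom x (y + 1)) := by
        simp only [IsTop, IsBottom]
        grind (splits := 30)
      rcases key with ⟨h1, h2⟩ | ⟨h1, h2⟩
      · rw [h1.potential_eq, h2.potential_eq]
      · rw [h1.potential_eq, h2.potential_eq]
  · obtain ⟨x', y'⟩ := P'
    have h0 : (x', y') ∉ Q.vertices ∧ (x', y') ∉ Q.merging := by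
      rw [← not_or]
      exact fun h' => h ⟨hs, hM, h'⟩
    have h3 := arith_of_notMem h0.1
    have h8 := not_and.1 (mt mem_merging.2 h0.2) h0.1
    simp only [Box] at h8
    have h4 := column_arith (Q := Q) x'
    have h5 := column_arith (Q := Q) (x' - 1)
    rcases step_cases' hs with ⟨h', h1⟩ | ⟨h', h1⟩
    · rw [h']
      have hy : y' = Q.lo x' ∧ x' < Q.xMax := by grind
      have h9 := column_arith (Q := Q) (x' - 1 - 1)
      have ht : Q.IsBottom x' y' := by rw [IsBottom]; grind
      have ht' : Q.IsBottom (x' - 1) y' := by rw [IsBottom]; grind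
      rw [ht.potential_eq, ht'.potential_eq]
      refine (bottomE_sub_one (by omega) hy.2 fun hx => h0.1 ?_).symm
      rw [hy.1]
      exact bottom_mem_vertices hx
    · rw [h']
      have key : (Q.IsTop x' y' ∧ Q.IsTop x' (y' - 1)) ∨
          (Q.IsBottom x' y' ∧ Q.IsBottom x' (y' - 1)) := by
        simp only [IsTop, IsBottom]
        grind (splits := 30)
      rcases key with ⟨h1, h2⟩ | ⟨h1, h2⟩
      · rw [h1.potential_eq, h2.potential_eq]
      · rw [h1.potential_eq, h2.potential_eq]

/-- A horizontal edge. -/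
def hEdge (x y : ℤ) : (ℤ × ℤ) × (ℤ × ℤ) := ((x, y), (x + 1, y))

/-- A vertical edge. -/
def vEdge (x y : ℤ) : (ℤ × ℤ) × (ℤ × ℤ) := ((x, y), (x, y + 1))

variable (Q) in
/-- The lower end of the diagram on the line `x`. -/
noncomputable def lineLo (x : ℤ) : ℤ :=
  if x = Q.xMin then Q.lo x else if x = Q.xMax then Q.lo (x - 1) else min (Q.lo (x - 1)) (Q.lo x)

variable (Q) in
/-- The upper end of the diagram on the line `x`. -/
noncomputable def lineHi (x : ℤ) : ℤ :=
  if x = Q.xMin then Q.hi x else if x = Q.xMax then Q.hi (x - 1) else max (Q.hi (x - 1)) (Q.hi x)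

theorem step_vEdge_iff {x y : ℤ} : Q.Step (x, y) (x, y + 1) ↔
    (Q.xMin ≤ x ∧ x ≤ Q.xMax) ∧ Q.lineLo x ≤ y ∧ y < Q.lineHi x := by
  rw [step_up_iff, lineLo, lineHi]
  have h4 := column_arith (Q := Q) x
  have h5 := column_arith (Q := Q) (x - 1)
  have h6 := Q.range_arith
  grind

theorem weight_eq_sub (a : Q.Arrow) :
    Q.arrowWeight a = Q.potential a.tgt.1 - Q.potential a.src.1 := by
  rw [potential_of_mem a.tgt.2, potential_of_mem a.src.2]
  rfl

/-- The differences of the potential along an arrow add up to its weight, and all of them except the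
one at the private edge are zero. -/
theorem weight_eq_privateEdge (a : Q.Arrow) : Q.arrowWeight a =
    Q.potential (Q.isForked.privateEdge a).2 - Q.potential (Q.isForked.privateEdge a).1 := by
  classical
  have h := boundary_edgeList Q.potential a.src.1 a.tgt.1 a.inner
  rw [weight_eq_sub, ← h]
  change Finsupp.linearCombination ℕ _ a.edgeVec = _
  rw [Finsupp.linearCombination_apply, Finsupp.sum_eq_single (Q.isForked.privateEdge a)]
  · rw [a.edgeVec_apply, if_pos (Q.isForked.privateEdge_mem a), one_smul]
  · intro e he hne
    rw [a.edgeVec_apply] at he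
    have hm : e ∈ edgeList a.points := by
      by_contra hm
      exact he (if_neg hm)
    obtain ⟨_, _, _, _, hs, _⟩ := a.split (R := e.1) (R' := e.2) hm
    rw [potential_eq_of_step hs fun hp => hne ((Q.isForked.mem_edgeList_iff hp).1 hm).symm, sub_self,
      smul_zero]
  · intro _
    rw [zero_smul]

variable (Q) in
-- Private edges correspond to the arrows and all other edges contribute zero. So the sum over the
-- arrows, whose shapes are complicated, becomes a sum over all edges of the diagram.
theorem sum_weight_eq : ∑ a, Q.arrowWeight a =
    ∑ x ∈ Finset.Ico Q.xMin Q.xMax, ∑ y ∈ Finset.Ico (Q.lo x) (Q.hi x + 1),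
      (Q.potential (x + 1, y) - Q.potential (x, y)) +
    ∑ x ∈ Finset.Ico Q.xMin (Q.xMax + 1), ∑ y ∈ Finset.Ico (Q.lineLo x) (Q.lineHi x),
      (Q.potential (x, y + 1) - Q.potential (x, y)) := by
  classical
  rw [Finset.sum_sigma', Finset.sum_sigma']
  refine Eq.trans ?_ (Finset.sum_disjSum _ _
    (Sum.elim (fun p : Σ _ : ℤ, ℤ => Q.potential (p.1 + 1, p.2) - Q.potential (p.1, p.2))
      (fun p : Σ _ : ℤ, ℤ => Q.potential (p.1, p.2 + 1) - Q.potential (p.1, p.2))))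
  have hcode : ∀ e : (ℤ × ℤ) × (ℤ × ℤ), Q.Step e.1 e.2 →
      (e = hEdge e.1.1 e.1.2 ∧ e.2.1 ≠ e.1.1) ∨ (e = vEdge e.1.1 e.1.2 ∧ e.2.1 = e.1.1) := by
    rintro ⟨⟨x, y⟩, P⟩ hs
    rcases step_cases hs with ⟨rfl, _⟩ | ⟨rfl, _⟩
    · exact Or.inl ⟨rfl, by simp⟩
    · exact Or.inr ⟨rfl, rfl⟩
  let c : (ℤ × ℤ) × (ℤ × ℤ) → (Σ _ : ℤ, ℤ) ⊕ (Σ _ : ℤ, ℤ) := fun e =>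
    if e.2.1 = e.1.1 then Sum.inr ⟨e.1.1, e.1.2⟩ else Sum.inl ⟨e.1.1, e.1.2⟩
  have hc : ∀ e e', Q.Step e.1 e.2 → Q.Step e'.1 e'.2 → c e = c e' → e = e' := by
    intro e e' hs hs' h
    simp only [c] at h
    rcases hcode e hs with ⟨h1, h2⟩ | ⟨h1, h2⟩ <;> rcases hcode e' hs' with ⟨h3, h4⟩ | ⟨h3, h4⟩
    · rw [if_neg h2, if_neg h4] at h
      simp only [Sum.inl.injEq, Sigma.mk.injEq, heq_eq_eq] at h
      rw [h1, h3, h.1, h.2]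
    · rw [if_neg h2, if_pos h4] at h
      cases h
    · rw [if_pos h2, if_neg h4] at h
      cases h
    · rw [if_pos h2, if_pos h4] at h
      simp only [Sum.inr.injEq, Sigma.mk.injEq, heq_eq_eq] at h
      rw [h1, h3, h.1, h.2]
  refine Finset.sum_of_injOn (fun a => c (Q.isForked.privateEdge a)) ?_ ?_ ?_ ?_
  · intro a _ b _ h
    exact Q.isForked.privateEdge_injective (hc _ _ (Q.isForked.isPrivate_privateEdge a).1
      (Q.isForked.isPrivate_privateEdge b).1 h)
  · intro a _
    have hs := (Q.isForked.isPrivate_privateEdge a).1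
    beta_reduce
    generalize Q.isForked.privateEdge a = e at hs ⊢
    rw [Finset.mem_coe, Finset.mem_disjSum]
    simp only [c]
    rcases hcode e hs with ⟨h1, h2⟩ | ⟨h1, h2⟩
    · refine Or.inl ⟨_, ?_, (if_neg h2).symm⟩
      rw [h1] at hs
      have := step_right_iff.1 hs
      simp only [Finset.mem_sigma, Finset.mem_Ico]
      omega
    · refine Or.inr ⟨_, ?_, (if_pos h2).symm⟩
      rw [h1] at hs
      have := step_vEdge_iff.1 hs
      simp only [Finset.mem_sigma, Finset.mem_Ico]
      omega
  · have hz : ∀ P P' : ℤ × ℤ, Q.Step P P' →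
        c (P, P') ∉ (fun a => c (Q.isForked.privateEdge a)) '' ((Finset.univ : Finset Q.Arrow) : Set _) →
        Q.potential P' - Q.potential P = 0 := by
      intro P P' hs hn
      rw [potential_eq_of_step hs, sub_self]
      intro hp
      obtain ⟨a, ha⟩ := Q.isForked.exists_privateEdge_eq hp
      exact hn ⟨a, Finset.mem_coe.2 (Finset.mem_univ a), congrArg c ha⟩
    intro p hp hn
    rw [Finset.mem_disjSum] at hp
    rcases hp with ⟨⟨x, y⟩, hp, rfl⟩ | ⟨⟨x, y⟩, hp, rfl⟩
    · simp only [Finset.mem_sigma, Finset.mem_Ico] at hp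
      refine hz (x, y) (x + 1, y) (step_right_iff.2 (by omega)) ?_
      have : c ((x, y), (x + 1, y)) = Sum.inl ⟨x, y⟩ := if_neg (by simp)
      rwa [this]
    · simp only [Finset.mem_sigma, Finset.mem_Ico] at hp
      refine hz (x, y) (x, y + 1) (step_vEdge_iff.2 (by omega)) ?_
      have : c ((x, y), (x, y + 1)) = Sum.inr ⟨x, y⟩ := if_pos rfl
      rwa [this]
  · intro a _
    rw [weight_eq_privateEdge]
    have hs := (Q.isForked.isPrivate_privateEdge a).1
    generalize Q.isForked.privateEdge a = e at hs ⊢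
    simp only [c]
    rcases hcode e hs with ⟨h1, h2⟩ | ⟨h1, h2⟩
    · rw [if_neg h2, Sum.elim_inl]
      conv_lhs => rw [h1]
      rfl
    · rw [if_pos h2, Sum.elim_inr]
      conv_lhs => rw [h1]
      rfl

end Potential

end YShapedQuiver

namespace YShapedQuiver

/-! ### The stability condition as a combination of path weights -/

section AnticanonicalWeight

variable {Q : YShapedQuiver}

open scoped Classical in
variable (Q) in
/-- The height of the top to the right of the line `x`, with the value `0` after the last column. -/
noncomputable def hiNext (x : ℤ) : ℤ := if x < Q.xMax then Q.hi x else 0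

open scoped Classical in
variable (Q) in
/-- The height of the bottom in column `x`, with the value `r 1` before the first column. -/
noncomputable def loPrev (x : ℤ) : ℤ := if Q.xMin ≤ x then Q.lo x else Q.r 1

variable (Q) in
-- Terms are collected by vertical lines. On the line `x`, the horizontal edges contribute the sum
-- of the potential over the height range of the column on the left minus the sum over that of the
-- column on the right. These ranges differ in boundary points only, where the potential is `topE x`
-- or `bottomE x`. The vertical edges telescope to the difference of the ends of the line. The
-- values of `hiNext` and `loPrev` outside the diagram are those that make the first and the last
-- line fit.
theorem sum_weight_eq_lines : ∑ a, Q.arrowWeight a = ∑ x ∈ Finset.Ico Q.xMin Q.xMax,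
    ((1 + Q.hi x - Q.hiNext (x + 1)) • Q.topE (x + 1) -
      (1 + Q.loPrev (x - 1) - Q.lo x) • Q.bottomE x) := by
  -- With an antiderivative in `y`, sums over intervals become differences of values at the ends,
  -- also if neither interval contains the other.
  choose G hG using fun x => Int.exists_antiderivative fun y => Q.potential (x, y)
  have h6 := Q.range_arith
  have hle : Q.xMin ≤ Q.xMax := by omega
  set b : ℤ → Q.CharacterLattice := fun x => G x (Q.hi (x - 1) + 1) - G x (Q.lo (x - 1)) with hb
  set a : ℤ → Q.CharacterLattice := fun x => G x (Q.hi x + 1) - G x (Q.lo x) with ha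
  set c : ℤ → Q.CharacterLattice := fun x =>
    Q.potential (x, Q.lineHi x) - Q.potential (x, Q.lineLo x) with hc
  set t : ℤ → Q.CharacterLattice := fun x => (1 + Q.hi (x - 1) - Q.hiNext x) • Q.topE x with ht
  set u : ℤ → Q.CharacterLattice := fun x => (1 + Q.loPrev (x - 1) - Q.lo x) • Q.bottomE x with hu
  have h1 : ∀ x ∈ Finset.Ico Q.xMin Q.xMax, ∑ y ∈ Finset.Ico (Q.lo x) (Q.hi x + 1),
      (Q.potential (x + 1, y) - Q.potential (x, y)) = b (x + 1) - a x := by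
    intro x _
    have h4 := lo_lt_hi (Q := Q) x
    rw [Finset.sum_sub_distrib, hb, ha]
    simp only [← hG]
    rw [Int.sum_Ico_sub _ (by omega), Int.sum_Ico_sub _ (by omega), add_sub_cancel_right]
  have h2 : ∀ x ∈ Finset.Ico Q.xMin (Q.xMax + 1),
      ∑ y ∈ Finset.Ico (Q.lineLo x) (Q.lineHi x),
        (Q.potential (x, y + 1) - Q.potential (x, y)) = c x := by
    intro x _
    have h4 := lo_lt_hi (Q := Q) x
    have h5 := lo_lt_hi (Q := Q) (x - 1)
    rw [Int.sum_Ico_sub (fun y => Q.potential (x, y))]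
    rw [lineLo, lineHi]
    split_ifs <;> omega
  have h3 : ∀ x, (1 + Q.hi x - Q.hiNext (x + 1)) • Q.topE (x + 1) -
      (1 + Q.loPrev (x - 1) - Q.lo x) • Q.bottomE x = t (x + 1) - u x := by
    intro x
    simp only [ht, hu, add_sub_cancel_right]
  have hmid : ∀ x, Q.xMin < x → x < Q.xMax → b x - a x + c x = t x - u x := by
    intro x hx1 hx2
    have e1 : G x (Q.hi (x - 1) + 1) - G x (Q.hi x + 1) =
        (Q.hi (x - 1) + 1 - (Q.hi x + 1)) • Q.topE x :=
      Int.antiderivative_const (hG x) fun y hy => IsTop.potential_eq (Or.inl ⟨hx1, hx2, by omega⟩)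
    have e2 : G x (Q.lo (x - 1)) - G x (Q.lo x) = (Q.lo (x - 1) - Q.lo x) • Q.bottomE x :=
      Int.antiderivative_const (hG x) fun y hy => IsBottom.potential_eq (Or.inl ⟨hx1, hx2, by omega⟩)
    have e3 : Q.potential (x, Q.lineHi x) = Q.topE x := IsTop.potential_eq (Or.inl ⟨hx1, hx2, by
      rw [lineHi, if_neg (by omega), if_neg (by omega)]
      omega⟩)
    have e4 : Q.potential (x, Q.lineLo x) = Q.bottomE x := IsBottom.potential_eq (Or.inl ⟨hx1, hx2, by
      rw [lineLo, if_neg (by omega), if_neg (by omega)]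
      omega⟩)
    have e5 : b x - a x = (G x (Q.hi (x - 1) + 1) - G x (Q.hi x + 1)) -
        (G x (Q.lo (x - 1)) - G x (Q.lo x)) := by
      simp only [hb, ha]
      abel
    rw [e5, e1, e2]
    simp only [hc, ht, hu]
    rw [e3, e4, hiNext, loPrev, if_pos hx2, if_pos (by omega)]
    module
  have hmax : b Q.xMax + c Q.xMax = t Q.xMax := by
    have h4 := column_arith (Q := Q) (Q.xMax - 1)
    have e1 : b Q.xMax = (Q.hi (Q.xMax - 1) + 1 - Q.lo (Q.xMax - 1)) • Q.topE Q.xMax :=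
      Int.antiderivative_const (hG _) fun y hy => IsTop.potential_eq (Or.inr ⟨rfl, by omega⟩)
    have e3 : Q.potential (Q.xMax, Q.lineHi Q.xMax) = Q.topE Q.xMax :=
      IsTop.potential_eq (Or.inr ⟨rfl, by
        rw [lineHi, if_neg (by omega), if_pos rfl]
        omega⟩)
    have e4 : Q.potential (Q.xMax, Q.lineLo Q.xMax) = Q.topE Q.xMax :=
      IsTop.potential_eq (Or.inr ⟨rfl, by
        rw [lineLo, if_neg (by omega), if_pos rfl]
        omega⟩)
    rw [e1]
    simp only [hc, ht]
    rw [e3, e4, hiNext, if_neg (lt_irrefl _), h4.2.1 (by omega)]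
    module
  have hmin : c Q.xMin - a Q.xMin = - u Q.xMin := by
    have h4 := column_arith (Q := Q) Q.xMin
    have e1 : a Q.xMin = (Q.hi Q.xMin + 1 - Q.lo Q.xMin) • Q.bottomE Q.xMin :=
      Int.antiderivative_const (hG _) fun y hy => IsBottom.potential_eq (Or.inr ⟨rfl, by omega⟩)
    have e3 : Q.potential (Q.xMin, Q.lineHi Q.xMin) = Q.bottomE Q.xMin :=
      IsBottom.potential_eq (Or.inr ⟨rfl, by
        rw [lineHi, if_pos rfl]
        omega⟩)
    have e4 : Q.potential (Q.xMin, Q.lineLo Q.xMin) = Q.bottomE Q.xMin :=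
      IsBottom.potential_eq (Or.inr ⟨rfl, by
        rw [lineLo, if_pos rfl]
        omega⟩)
    rw [e1]
    simp only [hc, hu]
    rw [e3, e4, loPrev, if_neg (by omega), h4.2.2 (by omega)]
    module
  clear_value b a c t u
  rw [Q.sum_weight_eq, Finset.sum_congr rfl h1, Finset.sum_congr rfl h2,
    Finset.sum_congr rfl fun x _ => h3 x, ← Finset.insert_Ico_right_eq_Ico_add_one hle,
    Finset.sum_insert (by simp), ← sub_eq_zero]
  have hshift : ∀ f : ℤ → Q.CharacterLattice, ∑ x ∈ Finset.Ico Q.xMin Q.xMax, f (x + 1) =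
      ∑ x ∈ Finset.Ico Q.xMin Q.xMax, f x + (f Q.xMax - f Q.xMin) := by
    intro f
    rw [← Int.sum_Ico_sub f hle, ← Finset.sum_add_distrib]
    exact Finset.sum_congr rfl fun x _ => by abel
  have hsum : ∑ x ∈ Finset.Ico Q.xMin Q.xMax, (b x - a x + c x - (t x - u x)) =
      b Q.xMin - t Q.xMin := by
    rw [Finset.sum_eq_single Q.xMin]
    · have : b Q.xMin - a Q.xMin + c Q.xMin - (t Q.xMin - u Q.xMin) =
          b Q.xMin - t Q.xMin + (c Q.xMin - a Q.xMin + u Q.xMin) := by abel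
      rw [this, hmin]
      abel
    · intro x hx hne
      rw [Finset.mem_Ico] at hx
      rw [hmid x (by omega) hx.2, sub_self]
    · intro h
      exact absurd (Finset.mem_Ico.2 ⟨le_rfl, by omega⟩) h
  simp only [Finset.sum_sub_distrib, Finset.sum_add_distrib] at hsum ⊢
  rw [hshift b, hshift t, ← hmax]
  have e : ∀ B A C T U b1 b0 t0 c1 : Q.CharacterLattice, B - A + C - (T - U) = b0 - t0 →
      B + (b1 - b0) - A + (c1 + C) - (T + (b1 + c1 - t0) - U) = 0 := by
    intro B A C T U b1 b0 t0 c1 h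
    have : B + (b1 - b0) - A + (c1 + C) - (T + (b1 + c1 - t0) - U) =
      (B - A + C - (T - U)) - (b0 - t0) := by abel
    rw [this, h, sub_self]
  exact e _ _ _ _ _ _ _ _ _ hsum

theorem sum_columns {M : Type} [AddCommMonoid M] (f : ℤ → M) :
    ∑ x ∈ Finset.Ico Q.xMin Q.xMax, f x =
      ∑ v ∈ Q.nonSource, ∑ x ∈ Finset.Ico (left v) (right v), f x := by
  classical
  rw [← Finset.sum_fiberwise_of_maps_to (g := Q.block) (t := Q.nonSource) fun x _ =>
    mem_nonSource.2 (block_ne_zero x)]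
  refine Finset.sum_congr rfl fun v hv => Finset.sum_congr ?_ fun _ _ => rfl
  rw [mem_nonSource] at hv
  ext x
  rw [Finset.mem_filter, Finset.mem_Ico, Finset.mem_Ico]
  constructor
  · rintro ⟨h, rfl⟩
    exact ⟨left_block_le h.1 h.2, lt_right_block h.1 h.2⟩
  · rintro ⟨h1, h2⟩
    exact ⟨⟨(xMin_le hv).trans h1, h2.trans_le (le_xMax hv)⟩, block_eq hv h1 h2⟩

theorem sOut_of_child {v j : Q.V} (hv : 1 < v) (h : Q.n v j ≠ 0) : Q.sOut v = Q.r j := by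
  have h1 : ∑ j, Q.n v j ≤ 1 := Q.arrows_from v hv
  have h2 := Finset.single_le_sum (f := fun j => Q.n v j) (fun _ _ => Nat.zero_le _)
    (Finset.mem_univ j)
  have h3 : Q.n v j = 1 := by
    omega
  rw [QuiverFlagData.sOut, Finset.sum_eq_single j, h3, one_mul]
  · intro k _ hk
    have : Q.n v k = 0 := by
      by_contra h4
      exact hk (child_unique hv h4 h)
    rw [this, zero_mul]
  · intro h4
    exact absurd (Finset.mem_univ j) h4

/-- The next block belongs to the only child, and its height is the dimension of the child. Without
a child the block is the last one, and both sides are `0`. -/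
theorem hiNext_right {v : Q.V} (hv : v ∈ Q.S₁) : Q.hiNext (right v) = Q.sOut v := by
  have hv1 := one_lt_of_mem_S₁ hv
  have hv0 := ne_zero_of_one_lt hv1
  have hv2 := notMem_S₂_of_mem_S₁ hv
  by_cases h : ∃ j, Q.n v j ≠ 0
  · obtain ⟨j, hj⟩ := h
    have hj0 := ne_zero_of_one_lt (one_lt_of_n_ne_zero hv0 hj)
    have hj1 : j ∉ Q.S₂ := notMem_S₂_of_mem_S₁ (mem_S₁_of_reach hv (Relation.ReflTransGen.single hj))
    have e := left_eq_right_parent hv0 hj hj1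
    have := left_lt_right hj0
    have := le_xMax hj0
    rw [sOut_of_child hv1 hj, hiNext, if_pos (by omega), hi_block hj0 e.le (by omega),
      top_of_notMem hj1]
  · push Not at h
    obtain ⟨u, hu, hux⟩ := Q.exists_right_eq_xMax
    have huv : u = v := by
      by_contra hne
      have hlt := left_lt_right hv0
      have hle := le_xMax hv0
      have hu2 : u ∉ Q.S₂ := fun hu2 => by
        have := right_nonpos hu2
        have := Q.range_arith
        omega
      rcases right_le_left_or hu hv0 hne with h1 | h1
      · omega
      · have hr : Q.Reach u v ∨ Q.Reach v u := by
          rcases (eq_one_or_mem_S₁_iff hu).2 hu2 with rfl | hu1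
          · exact Or.inl (Q.connected v hv1)
          · exact reach_total_of_mem_S₁ hu1 hv
        rcases hr with hr | hr
        · have := width_strict hu hr hne
          rw [right_of_notMem hv2, left_of_notMem hu2, width, width] at h1
          have := r_lt_s hu
          have := r_lt_s hv0
          omega
        · rcases Relation.ReflTransGen.cases_head hr with e | ⟨j, hj, _⟩
          · exact hne e.symm
          · exact hj (h j)
    rw [hiNext, if_neg (by rw [← hux, huv]; exact lt_irrefl _), QuiverFlagData.sOut,
      Finset.sum_eq_zero fun j _ => by rw [h j, zero_mul], Nat.cast_zero]

/-- The mirror image of `hiNext_right`: the drop from `r 1` to the bottom of the next block on the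
left is the dimension of the child, or `0` if there is none. -/
theorem loPrev_left {v : Q.V} (hv : v ∈ Q.S₂) : (Q.r 1 : ℤ) - Q.loPrev (left v - 1) = Q.sOut v := by
  have hv1 := hv.1
  have hv0 := ne_zero_of_one_lt hv1
  by_cases h : ∃ j, Q.n v j ≠ 0
  · obtain ⟨j, hj⟩ := h
    have hj0 := ne_zero_of_one_lt (one_lt_of_n_ne_zero hv0 hj)
    have hj1 : j ∈ Q.S₂ := by
      by_contra hj1
      exact parent_notMem_S₂ hv0 hj hj1 hv
    have e := right_eq_left_parent hv0 hj hj1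
    have := left_lt_right hj0
    have := xMin_le hj0
    rw [sOut_of_child hv1 hj, loPrev, if_pos (by omega), lo_block hj0 (by omega) (by omega),
      bottom_of_mem hj1]
    ring
  · push Not at h
    obtain ⟨u, hu, hux⟩ := Q.exists_left_eq_xMin
    have huv : u = v := by
      by_contra hne
      have hlt := left_lt_right hv0
      have hlt' := left_lt_right hu
      have hle := xMin_le hv0
      have hnp := right_nonpos hv
      have hu2 : u ∈ Q.S₂ := by
        by_contra hu2
        have := left_nonneg hu hu2
        omega
      rcases reach_total_of_mem_S₂ hu2 hv with hr | hr
      · have := width_strict hu hr hne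
        rw [← hux, left_of_mem hu2, left_of_mem hv, width, width, width] at hle
        have := r_lt_s hv0
        omega
      · rcases Relation.ReflTransGen.cases_head hr with e | ⟨j, hj, _⟩
        · exact hne e.symm
        · exact hj (h j)
    rw [loPrev, if_neg (by rw [← hux, huv]; omega), QuiverFlagData.sOut,
      Finset.sum_eq_zero fun j _ => by rw [h j, zero_mul], Nat.cast_zero, sub_self]

theorem sum_parents (j : Q.V) : ∑ v ∈ Q.nonSource, Q.n v j = if 1 < j then 1 else 0 := by
  split_ifs with h
  · refine le_antisymm (Q.arrows_into j) ?_
    obtain ⟨p, hp, hpj⟩ := exists_parent h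
    exact (Nat.one_le_iff_ne_zero.2 hpj).trans (Finset.single_le_sum (f := fun v => Q.n v j)
      (fun _ _ => Nat.zero_le _) (mem_nonSource.2 hp))
  · refine Finset.sum_eq_zero fun v hv => ?_
    by_contra hn
    exact h (one_lt_of_n_ne_zero (mem_nonSource.1 hv) hn)

/-- Every vertex beyond `1` has exactly one incoming arrow that does not start at the source, so
each dimension except `r 1` is counted once. -/
theorem sum_sOut : ∑ v ∈ Q.nonSource, Q.sOut v + Q.r 1 = ∑ v ∈ Q.nonSource, Q.r v := by
  classical
  have h1 : ∑ v ∈ Q.nonSource, Q.sOut v = ∑ j, (if 1 < j then 1 else 0) * Q.r j := by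
    simp only [QuiverFlagData.sOut]
    rw [Finset.sum_comm]
    exact Finset.sum_congr rfl fun j _ => by rw [← Finset.sum_mul, sum_parents]
  rw [h1, sum_split (Q := Q), if_neg (by simp), zero_mul, zero_add]
  rw [← Finset.add_sum_erase _ _ (mem_nonSource.2 one_ne_zero'),
    ← Finset.add_sum_erase (a := (1 : Q.V)) _ (fun v => Q.r v) (mem_nonSource.2 one_ne_zero'),
    if_neg (lt_irrefl _), zero_mul, zero_add, add_comm]
  congr 1
  refine Finset.sum_congr rfl fun j hj => ?_
  rw [Finset.mem_erase, mem_nonSource] at hj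
  rw [if_pos ((eq_one_or_one_lt hj.2).resolve_left hj.1), one_mul]

variable (Q) in
/-- The weight of the lattice paths that belong to `v`. -/
noncomputable def pathWeight (v : Q.V) : Q.CharacterLattice :=
  Q.eAt (tgtPoint v) - Q.eAt (srcPoint v)

/-- Over a block of `S₁`, the coefficients of the target add up to the number `s v - r v` of columns
plus the telescoping sum `r v - s'_v`; the sources over `S₂` behave in the same way. This does not
settle vertex `1`, which may have two children. But all blocks outside `S₁` have the same target, so
the sum of all coefficients is enough for them. -/
theorem sum_weight_eq_sum_pathWeight : ∑ a, Q.arrowWeight a =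
    ∑ v ∈ Q.nonSource, ((Q.s v : ℤ) - Q.sOut v) • Q.pathWeight v := by
  have h6 := Q.range_arith
  -- Subtracting the target of vertex `1` makes both sides vanish for blocks outside `S₁`.
  have hT : ∀ v ∈ Q.nonSource, ∑ x ∈ Finset.Ico (left v) (right v),
      (1 + Q.hi x - Q.hiNext (x + 1)) • (Q.eAt (tgtPoint v) - Q.eAt (tgtPoint (1 : Q.V))) =
      ((Q.s v : ℤ) - Q.sOut v) • (Q.eAt (tgtPoint v) - Q.eAt (tgtPoint (1 : Q.V))) := by
    intro v hv
    have hv0 := mem_nonSource.1 hv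
    by_cases h1 : v ∈ Q.S₁
    · rw [← Finset.sum_smul]
      congr 1
      have hlt := left_lt_right hv0
      have hle := le_xMax hv0
      obtain ⟨F, hF⟩ : ∃ F : ℤ → ℤ, ∀ x, F x = - (if x < right v then top v else Q.hiNext x) :=
        ⟨_, fun _ => rfl⟩
      have e : ∀ x ∈ Finset.Ico (left v) (right v), 1 + Q.hi x - Q.hiNext (x + 1) =
          1 + (F (x + 1) -
            F x) := by
        intro x hx
        rw [Finset.mem_Ico] at hx
        rw [hF, hF]
        rw [if_pos hx.2, hi_block hv0 hx.1 hx.2]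
        split_ifs with h
        · rw [hiNext, if_pos (by omega), hi_block hv0 (by omega) h]
          ring
        · ring
      rw [Finset.sum_congr rfl e, Finset.sum_add_distrib, Int.sum_Ico_sub _ hlt.le, hF, hF]
      simp only [lt_irrefl, if_false, if_pos hlt, Finset.sum_const, Int.card_Ico, nsmul_eq_mul, mul_one]
      rw [Int.toNat_of_nonneg (by omega), hiNext_right h1, top_of_notMem (notMem_S₂_of_mem_S₁ h1), right]
      ring
    · rw [tgtPoint_of_notMem_S₁ hv0 h1, tgtPoint_of_notMem_S₁ one_ne_zero' one_notMem_S₁]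
      simp
  have hS : ∀ v ∈ Q.nonSource, ∑ x ∈ Finset.Ico (left v) (right v),
      (1 + Q.loPrev (x - 1) - Q.lo x) • Q.eAt (srcPoint v) =
      ((Q.s v : ℤ) - Q.sOut v) • Q.eAt (srcPoint v) := by
    intro v hv
    have hv0 := mem_nonSource.1 hv
    by_cases h2 : v ∈ Q.S₂
    · rw [← Finset.sum_smul]
      congr 1
      have hlt := left_lt_right hv0
      have hle := xMin_le hv0
      obtain ⟨F, hF⟩ : ∃ F : ℤ → ℤ, ∀ x, F x = - (if left v < x then bottom v else Q.loPrev (x - 1)) :=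
        ⟨_, fun _ => rfl⟩
      have e : ∀ x ∈ Finset.Ico (left v) (right v), 1 + Q.loPrev (x - 1) - Q.lo x =
          1 + (F (x + 1) -
            F x) := by
        intro x hx
        rw [Finset.mem_Ico] at hx
        rw [hF, hF]
        rw [if_pos (by omega), lo_block hv0 hx.1 hx.2]
        split_ifs with h
        · rw [loPrev, if_pos (by omega), lo_block hv0 (by omega) (by omega)]
          ring
        · ring
      rw [Finset.sum_congr rfl e, Finset.sum_add_distrib, Int.sum_Ico_sub _ hlt.le, hF, hF]
      simp only [lt_irrefl, if_false, if_pos hlt, Finset.sum_const, Int.card_Ico, nsmul_eq_mul, mul_one]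
      have := loPrev_left h2
      rw [Int.toNat_of_nonneg (by omega), bottom_of_mem h2, right]
      linarith
    · rw [srcPoint_of_notMem h2, eAt_zero]
      simp
  -- The telescoping sum over the whole diagram leaves the number of columns and `r 1`, and
  -- `sum_sOut` expresses this by the numbers `s v - s'_v`.
  have hone : ∑ x ∈ Finset.Ico Q.xMin Q.xMax, (1 + Q.hi x - Q.hiNext (x + 1)) =
      ∑ v ∈ Q.nonSource, ((Q.s v : ℤ) - Q.sOut v) := by
    obtain ⟨F, hF⟩ : ∃ F : ℤ → ℤ, ∀ x, F x = - Q.hiNext x := ⟨_, fun _ => rfl⟩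
    have e : ∀ x ∈ Finset.Ico Q.xMin Q.xMax, 1 + Q.hi x - Q.hiNext (x + 1) =
        1 + (F (x + 1) - F x) := by
      intro x hx
      rw [Finset.mem_Ico] at hx
      rw [hF, hF, hiNext, hiNext, if_pos hx.2]
      ring
    have h3 := sum_sOut (Q := Q)
    have h4 : ∑ v ∈ Q.nonSource, (Q.s v : ℤ) - ∑ v ∈ Q.nonSource, (Q.sOut v : ℤ) =
        ∑ v ∈ Q.nonSource, ((Q.s v : ℤ) - Q.r v) + Q.r 1 := by
      rw [Finset.sum_sub_distrib]
      have : (∑ v ∈ Q.nonSource, (Q.sOut v : ℤ)) + Q.r 1 = ∑ v ∈ Q.nonSource, (Q.r v : ℤ) := by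
        exact_mod_cast h3
      linarith
    rw [Finset.sum_congr rfl e, Finset.sum_add_distrib, Int.sum_Ico_sub _ (by omega),
      Finset.sum_sub_distrib, h4, sum_columns]
    congr 1
    · refine Finset.sum_congr rfl fun v hv => ?_
      have hlt := left_lt_right (mem_nonSource.1 hv)
      simp only [Finset.sum_const, Int.card_Ico, nsmul_eq_mul, mul_one]
      rw [Int.toNat_of_nonneg (by omega), right]
      ring
    · rw [hF, hF, hiNext, hiNext, if_neg (lt_irrefl _), if_pos (by omega), hi_eq (by omega)]
      ring
  have hcol : ∀ x ∈ Finset.Ico Q.xMin Q.xMax, (1 + Q.hi x - Q.hiNext (x + 1)) • Q.topE (x + 1) -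
      (1 + Q.loPrev (x - 1) - Q.lo x) • Q.bottomE x =
      (1 + Q.hi x - Q.hiNext (x + 1)) • (Q.eAt (tgtPoint (Q.block x)) - Q.eAt (tgtPoint (1 : Q.V))) +
      (1 + Q.hi x - Q.hiNext (x + 1)) • Q.eAt (tgtPoint (1 : Q.V)) -
      (1 + Q.loPrev (x - 1) - Q.lo x) • Q.eAt (srcPoint (Q.block x)) := by
    intro x _
    rw [topE, bottomE, add_sub_cancel_right]
    module
  have hfib : ∀ (f : ℤ → ℤ) (g : Q.V → Q.CharacterLattice),
      ∑ x ∈ Finset.Ico Q.xMin Q.xMax, f x • g (Q.block x) =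
        ∑ v ∈ Q.nonSource, ∑ x ∈ Finset.Ico (left v) (right v), f x • g v := by
    intro f g
    rw [sum_columns]
    refine Finset.sum_congr rfl fun v hv => Finset.sum_congr rfl fun x hx => ?_
    rw [Finset.mem_Ico] at hx
    rw [block_eq (mem_nonSource.1 hv) hx.1 hx.2]
  rw [Q.sum_weight_eq_lines, Finset.sum_congr rfl hcol, Finset.sum_sub_distrib,
    Finset.sum_add_distrib, ← Finset.sum_smul,
    hfib _ (fun v => Q.eAt (tgtPoint v) - Q.eAt (tgtPoint (1 : Q.V))),
    hfib _ (fun v => Q.eAt (srcPoint v)), Finset.sum_congr rfl hT, Finset.sum_congr rfl hS, hone,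
    Finset.sum_smul, ← Finset.sum_add_distrib, ← Finset.sum_sub_distrib]
  refine Finset.sum_congr rfl fun v _ => ?_
  rw [pathWeight]
  module

end AnticanonicalWeight

end YShapedQuiver

namespace YShapedQuiver

/-! ### Rows of the matrices as columns of the diagram, and minors as lattice paths -/

section Columns

variable {Q : YShapedQuiver}

/-- Priority runs through the blocks from right to left: the far end of `S₁` is the rightmost block,
the far end of `S₂` the leftmost one. -/
theorem rank_lt_of_right_le {u v : Q.V} (hu : u ≠ 0) (hv : v ≠ 0) (h : right u ≤ left v) :
    rank v < rank u := by
  have h6 := Q.range_arith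
  have hlu := left_lt_right hu
  have hlv := left_lt_right hv
  have hu0 : u.val ≠ 0 := fun h => hu (Fin.ext h)
  have hv0 : v.val ≠ 0 := fun h => hv (Fin.ext h)
  have hlt : ∀ a b : Q.V, Q.Reach a b → a.val ≤ b.val := fun a b h => Fin.le_def.1 (reach_le h)
  unfold rank
  by_cases hu2 : u ∈ Q.S₂
  · rw [if_neg hu2.2]
    by_cases hv2 : v ∈ Q.S₂
    · rw [if_neg hv2.2]
      have hne : u ≠ v := by
        rintro rfl
        omega
      have hne' : u.val ≠ v.val := fun h => hne (Fin.ext h)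
      rcases reach_total_of_mem_S₂ hu2 hv2 with hr | hr
      · have := width_strict hu hr hne
        rw [right, left_of_mem hu2, left_of_mem hv2, width, width, width] at h
        have := r_lt_s hv
        have := r_lt_s hu
        omega
      · have := hlt _ _ hr
        omega
    · have hu1 := hu2.1
      rw [Fin.lt_def, Fin.val_one] at hu1
      split_ifs with hv1
      · omega
      · have hv1' := ((eq_one_or_mem_S₁_iff hv).2 hv2).resolve_right hv1
        rw [hv1', Fin.val_one]
        omega
  · by_cases hv2 : v ∈ Q.S₂
    · have := right_nonpos hv2
      have := width_one_le_right hu hu2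
      omega
    · have hv1 : v ∈ Q.S₁ := by
        rcases (eq_one_or_mem_S₁_iff hv).2 hv2 with rfl | hv1
        · rw [left_one] at h
          have := width_one_le_right hu hu2
          omega
        · exact hv1
      rw [if_pos hv1]
      split_ifs with hu1
      · have hne : u ≠ v := by
          rintro rfl
          omega
        have hne' : u.val ≠ v.val := fun h => hne (Fin.ext h)
        rcases reach_total_of_mem_S₁ hu1 hv1 with hr | hr
        · have := hlt _ _ hr
          omega
        · have := width_strict hv hr hne.symm
          rw [right_of_notMem hu2, left_of_notMem hv2, width, width] at h
          have := r_lt_s hv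
          have := r_lt_s hu
          omega
      · omega

/-- The column of the diagram that belongs to a row of the matrices. -/
noncomputable def NewRow.column (p : Q.NewRow) : ℤ := right p.v - 1 - p.row.val

theorem NewRow.left_le_column (p : Q.NewRow) : left p.v ≤ p.column := by
  have := p.row.2
  have := r_lt_s p.hv
  rw [column, right]
  omega

theorem NewRow.column_lt_right (p : Q.NewRow) : p.column < right p.v := by
  rw [column]
  omega

theorem NewRow.column_strictAnti : StrictAnti (NewRow.column (Q := Q)) := by
  intro p q h
  rw [newRow_lt_iff] at h
  have hp := p.left_le_column
  have hq := q.column_lt_right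
  rcases h with h | ⟨h, h'⟩
  · rcases right_le_left_or p.hv q.hv (fun e => by rw [e] at h; exact lt_irrefl _ h) with h1 | h1
    · exact absurd (rank_lt_of_right_le p.hv q.hv h1) (by omega)
    · omega
  · have e := congrArg right h
    rw [column, column]
    omega

/-- The row of the matrices that belongs to a column of the diagram. -/
theorem exists_column_eq {x : ℤ} (h1 : Q.xMin ≤ x) (h2 : x < Q.xMax) :
    ∃ p : Q.NewRow, p.column = x ∧ p.v = Q.block x := by
  have h3 := left_block_le h1 h2
  have h4 := lt_right_block h1 h2
  have h5 := r_lt_s (block_ne_zero (Q := Q) x)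
  refine ⟨⟨Q.block x, block_ne_zero x, ⟨(right (Q.block x) - 1 - x).toNat, ?_⟩⟩, ?_, rfl⟩
  · rw [right] at h4 ⊢
    omega
  · rw [NewRow.column]
    simp only
    omega

theorem srcX_le_left_of_reach {v i : Q.V} (hv : v ≠ 0) (h : Q.Reach v i) :
    srcX i ≤ left v ∧ right v ≤ tgtX i := by
  have h6 := Q.range_arith
  have hi := ne_zero_of_reach hv h
  by_cases hi2 : i ∈ Q.S₂
  · rw [srcX_of_mem hi2, tgtX_of_mem hi2]
    have hvS : v ∉ Q.S₁ := fun hS => hi2.2 (mem_S₁_of_reach hS h)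
    rcases eq_one_or_one_lt hv with rfl | hv1
    · have := left_lt_right hi
      have := right_nonpos hi2
      rw [left_one, right_one]
      omega
    · have := right_nonpos ⟨hv1, hvS⟩
      have := width_mono hv h
      refine ⟨?_, by omega⟩
      rw [left_of_mem hi2, left_of_mem ⟨hv1, hvS⟩, width, width, width]
      omega
  · rw [srcX_of_notMem hi2, tgtX_of_notMem hi2]
    have hv2 : v ∉ Q.S₂ := by
      intro hv2
      have hv1 := hv2.1
      rcases (eq_one_or_mem_S₁_iff hi).2 hi2 with rfl | hi1
      · exact absurd (reach_le h) (not_le.2 hv1)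
      · clear hi hi2
        induction h with
        | refl => exact hv2.2 hi1
        | @tail b c hb hbc ih =>
          have hb0 := ne_zero_of_reach hv hb
          have hb2 := parent_notMem_S₂ hb0 hbc (notMem_S₂_of_mem_S₁ hi1)
          rcases (eq_one_or_mem_S₁_iff hb0).2 hb2 with rfl | hb1
          · exact absurd (reach_le hb) (not_le.2 hv1)
          · exact ih hb1
    refine ⟨left_nonneg hv hv2, ?_⟩
    have := width_mono hv h
    rw [right_of_notMem hv2, right_of_notMem hi2, width, width]
    omega

theorem reach_of_srcX_le {v i : Q.V} (hv : v ≠ 0) (hi : i ≠ 0) (h1 : srcX i ≤ left v)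
    (h2 : right v ≤ tgtX i) : Q.Reach v i := by
  have h6 := Q.range_arith
  have hlv := left_lt_right hv
  have hsv := r_lt_s hv
  have hsi := r_lt_s hi
  by_cases hi2 : i ∈ Q.S₂
  · rw [srcX_of_mem hi2] at h1
    rw [tgtX_of_mem hi2] at h2
    have hvS : v ∉ Q.S₁ := fun hS => by
      have := width_one_le_left hS
      omega
    rcases eq_one_or_one_lt hv with rfl | hv1
    · exact Q.connected i hi2.1
    · rcases reach_total_of_mem_S₂ ⟨hv1, hvS⟩ hi2 with h | h
      · exact h
      · by_cases hne : i = v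
        · rw [hne]
          exact Relation.ReflTransGen.refl
        · have := width_strict hi h hne
          rw [left_of_mem hi2, left_of_mem ⟨hv1, hvS⟩, width, width, width] at h1
          omega
  · rw [srcX_of_notMem hi2] at h1
    rw [tgtX_of_notMem hi2] at h2
    have hv2 : v ∉ Q.S₂ := fun hv2 => by
      have := right_nonpos hv2
      omega
    rcases (eq_one_or_mem_S₁_iff hv).2 hv2 with rfl | hv1
    · rcases eq_one_or_one_lt hi with rfl | hi1
      · exact Relation.ReflTransGen.refl
      · exact Q.connected i hi1
    · rcases (eq_one_or_mem_S₁_iff hi).2 hi2 with rfl | hi1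
      · have := width_one_le_left hv1
        rw [right_one] at h2
        omega
      · rcases reach_total_of_mem_S₁ hv1 hi1 with h | h
        · exact h
        · by_cases hne : i = v
          · rw [hne]
            exact Relation.ReflTransGen.refl
          · have := width_strict hi h hne
            rw [right_of_notMem hv2, right_of_notMem hi2, width, width] at h2
            omega

/-- The numbers `srcX i` and `tgtX i` are ends of blocks, so a block lies between them as a whole or
not at all. The rows of `A_i` thus correspond to the columns over which the lattice paths of `i`
run. -/
theorem reach_block_iff {x : ℤ} {i : Q.V} (hi : i ≠ 0) (h1 : Q.xMin ≤ x) (h2 : x < Q.xMax) :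
    Q.Reach (Q.block x) i ↔ srcX i ≤ x ∧ x < tgtX i := by
  have h3 := left_block_le h1 h2
  have h4 := lt_right_block h1 h2
  have hv := block_ne_zero (Q := Q) x
  generalize Q.block x = v at h3 h4 hv
  constructor
  · intro h
    have := srcX_le_left_of_reach hv h
    omega
  · rintro ⟨h5, h6⟩
    refine reach_of_srcX_le hv hi ?_ ?_
    · obtain ⟨w, hw, hwx⟩ : ∃ w : Q.V, w ≠ 0 ∧ srcX i = left w := by
        by_cases hi2 : i ∈ Q.S₂
        · exact ⟨i, hi, srcX_of_mem hi2⟩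
        · exact ⟨1, one_ne_zero', by rw [srcX_of_notMem hi2, left_one]⟩
      by_cases hwv : w = v
      · rw [hwx, hwv]
      · have := left_lt_right hw
        rcases right_le_left_or hw hv hwv with h | h <;> omega
    · obtain ⟨w, hw, hwx⟩ : ∃ w : Q.V, w ≠ 0 ∧ tgtX i = right w := by
        by_cases hi2 : i ∈ Q.S₂
        · exact ⟨1, one_ne_zero', by rw [tgtX_of_mem hi2, right_one]⟩
        · exact ⟨i, hi, tgtX_of_notMem hi2⟩
      by_cases hwv : w = v
      · rw [hwx, hwv]
      · have := left_lt_right hw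
        rcases right_le_left_or hw hv hwv with h | h <;> omega

theorem Row.column_mem {i : Q.V} (p : Q.Row i) : srcX i ≤ p.1.column ∧ p.1.column < tgtX i := by
  have h1 := p.1.left_le_column
  have h2 := p.1.column_lt_right
  have := srcX_le_left_of_reach p.1.hv p.2
  omega

theorem exists_row {i : Q.V} (hi : i ≠ 0) {x : ℤ} (h1 : srcX i ≤ x) (h2 : x < tgtX i) :
    ∃ p : Q.Row i, p.1.column = x := by
  have h3 := (xMin_le_srcX hi).trans h1
  have h4 := h2.trans_le (tgtX_le_xMax hi)
  obtain ⟨p, hp, hpv⟩ := exists_column_eq h3 h4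
  exact ⟨⟨p, by rw [hpv]; exact (reach_block_iff hi h3 h4).2 ⟨h1, h2⟩⟩, hp⟩

open scoped Classical in
/-- The sum of the coordinates of a box and the number of a column of the matrix `A_v` that
corresponds to it. -/
noncomputable def offset (v : Q.V) : ℤ :=
  if v ∈ Q.S₂ then (Q.sTilde 1 : ℤ) - 1 else (Q.sTilde v : ℤ) - 1

theorem offset_of_mem {v : Q.V} (h : v ∈ Q.S₂) : offset v = (Q.sTilde 1 : ℤ) - 1 := if_pos h
theorem offset_of_notMem {v : Q.V} (h : v ∉ Q.S₂) : offset v = (Q.sTilde v : ℤ) - 1 := if_neg h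

theorem offset_of_notMem_S₁ {v : Q.V} (hv : v ≠ 0) (h : v ∉ Q.S₁) :
    offset v = (Q.sTilde 1 : ℤ) - 1 := by
  rcases eq_one_or_one_lt hv with rfl | h1
  · exact offset_of_notMem one_notMem_S₂
  · exact offset_of_mem ⟨h1, h⟩

/-- The height of the horizontal edge of the diagram that belongs to a coordinate. -/
noncomputable def Coord.height (c : Q.Coord) : ℤ :=
  offset c.newRow.v - c.newRow.column - c.col.val

/-- The horizontal edge of the diagram that belongs to a coordinate. -/
noncomputable def Coord.edge (c : Q.Coord) : (ℤ × ℤ) × (ℤ × ℤ) := hEdge c.newRow.column c.height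

/-- A column number in the matrix and the height of the edge determine each other through `offset`.
The flow through all horizontal edges can therefore be recorded as the exponents of a Laurent
monomial. -/
theorem exists_coord_edge_eq {x y : ℤ} (h : Q.Step (x, y) (x + 1, y)) :
    ∃ c : Q.Coord, c.edge = hEdge x y := by
  obtain ⟨h1, h2, h3, h4⟩ := step_right_iff.1 h
  obtain ⟨p, hp, hpv⟩ := exists_column_eq h1 h2
  have h5 := left_block_le h1 h2
  have h6 := lt_right_block h1 h2
  have hv := block_ne_zero (Q := Q) x
  have h7 := Q.range_arith
  have hk : 0 ≤ offset p.v - x - y ∧ offset p.v - x - y < Q.sTilde p.v := by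
    rw [lo] at h3
    rw [hi] at h4
    rw [← hpv] at h3 h4 h5 h6 hv
    by_cases hv2 : p.v ∈ Q.S₂
    · have := right_nonpos hv2
      rw [bottom_of_mem hv2] at h3
      rw [top_of_mem hv2] at h4
      rw [left_of_mem hv2] at h5
      rw [offset_of_mem hv2]
      simp only [width] at h5 h7
      omega
    · have := left_nonneg hv hv2
      rw [bottom_of_notMem hv2] at h3
      rw [top_of_notMem hv2] at h4
      rw [right_of_notMem hv2, width] at h6
      rw [offset_of_notMem hv2]
      omega
  refine ⟨⟨p, ⟨(offset p.v - x - y).toNat, by omega⟩⟩, ?_⟩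
  rw [Coord.edge, Coord.height]
  simp only [hp]
  congr 1
  omega

theorem Coord.edge_injective : Function.Injective (Coord.edge (Q := Q)) := by
  rintro ⟨p, k⟩ ⟨p', k'⟩ h
  have h1 : p.column = p'.column := congrArg (fun e => e.1.1) h
  obtain rfl := NewRow.column_strictAnti.injective h1
  have h2 : height ⟨p, k⟩ = height ⟨p, k'⟩ := congrArg (fun e => e.1.2) h
  simp only [height] at h2
  have : k = k' := Fin.ext (by omega)
  rw [this]

/-- The height of the lattice path of `σ` in the column of `p`. -/
noncomputable def rowHeight {i : Q.V} (σ : Q.Plucker i) (p : Q.Row i) : ℤ :=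
  offset i - p.1.column - (σ p).val

/-- The minor with columns `σ` does not vanish. -/
def IsValid {i : Q.V} (σ : Q.Plucker i) : Prop := ∀ p, Q.A i p (σ p) ≠ 0

/-- The padding by zeros on the left in `S₁` is absorbed by the dependence of `offset` on the
vertex, so a coordinate gives the same edge in every matrix in which it occurs. -/
theorem height_eq_rowHeight {i : Q.V} (hi : i ≠ 0) (σ : Q.Plucker i) (p : Q.Row i) {c : Q.Coord}
    (h1 : c.newRow = p.1) (h2 : (c.col.val : ℤ) = (σ p).val + Q.colShift i p.1.v) :
    c.height = rowHeight σ p := by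
  classical
  rw [Coord.height, rowHeight, h2, h1, colShift]
  by_cases hS : i ∈ Q.S₁
  · have hv2 : p.1.v ∉ Q.S₂ := fun hv2 => by
      have := srcX_le_left_of_reach p.1.hv p.2
      rw [srcX_of_notMem (notMem_S₂_of_mem_S₁ hS)] at this
      have := right_nonpos hv2
      have := left_lt_right p.1.hv
      omega
    rw [if_pos hS, offset_of_notMem hv2, offset_of_notMem (notMem_S₂_of_mem_S₁ hS)]
    ring
  · have hv1 : p.1.v ∉ Q.S₁ := fun hv1 => hS (mem_S₁_of_reach hv1 p.2)
    rw [if_neg hS, offset_of_notMem_S₁ hi hS, offset_of_notMem_S₁ p.1.hv hv1]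
    ring

/-- From one column of the diagram to the next on the right, the row index goes back by one and the
matrix column decreases by at least one. Subtracting the diagram column leaves a weak increase. -/
theorem rowHeight_mono {i : Q.V} (hi : i ≠ 0) (σ : Q.Plucker i) {p q : Q.Row i}
    (h : p.1.column ≤ q.1.column) : rowHeight σ p ≤ rowHeight σ q := by
  have key : ∀ n : ℕ, ∀ p q : Q.Row i, q.1.column = p.1.column + n →
      (σ q).val + (n : ℤ) ≤ (σ p).val := by
    intro n
    induction n with
    | zero =>
      intro p q h
      rw [Nat.cast_zero, add_zero] at h
      have : p = q := Subtype.ext (NewRow.column_strictAnti.injective h.symm)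
      rw [this, Nat.cast_zero, add_zero]
    | succ n ih =>
      intro p q h
      have hp := p.column_mem
      have hq := q.column_mem
      obtain ⟨p', hp'⟩ := exists_row hi (x := p.1.column + 1) (by omega) (by push_cast at h; omega)
      have h1 := ih p' q (by rw [hp', h]; push_cast; ring)
      have h2 : p' < p := by
        change p'.1 < p.1
        rw [← NewRow.column_strictAnti.lt_iff_gt]
        omega
      have h3 := σ.strictMono h2
      rw [Fin.lt_def] at h3
      push_cast
      omega
  have := key (q.1.column - p.1.column).toNat p q (by omega)
  rw [rowHeight, rowHeight]
  omega

/-- By monotonicity, each bound needs to be checked at one place only. One of them comes from the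
entry at an end of the block, which must not lie among the zeros; the other comes from the range of
the column numbers at an end of the whole path. -/
theorem IsValid.le_rowHeight {i : Q.V} (hi : i ≠ 0) {σ : Q.Plucker i} (h : IsValid σ)
    (p : Q.Row i) : Q.lo p.1.column ≤ rowHeight σ p ∧ rowHeight σ p ≤ Q.hi p.1.column := by
  have h7 := Q.range_arith
  have hpx := p.column_mem
  have h0 := p.1.left_le_column
  have h1 := p.1.column_lt_right
  have hr := srcX_le_left_of_reach p.1.hv p.2
  have hlt := left_lt_right p.1.hv
  by_cases hS : i ∈ Q.S₁
  · have hi2 := notMem_S₂_of_mem_S₁ hS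
    rw [srcX_of_notMem hi2, tgtX_of_notMem hi2] at hpx hr
    have hv2 : p.1.v ∉ Q.S₂ := fun hv2 => by
      have := right_nonpos hv2
      omega
    constructor
    · obtain ⟨q, hq⟩ := exists_row hi (x := 0) (by rw [srcX_of_notMem hi2])
        (by rw [tgtX_of_notMem hi2]; omega)
      have h2 := rowHeight_mono hi σ (p := q) (q := p) (by omega)
      have h3 := (σ q).2
      rw [lo_eq_zero (by omega)]
      rw [rowHeight, offset_of_notMem hi2, hq] at h2
      omega
    · obtain ⟨q, hq, hqv⟩ := exists_column_eq (Q := Q) (x := right p.1.v - 1)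
        (by omega) (by have := le_xMax p.1.hv; omega)
      rw [block_eq p.1.hv (by omega) (by omega)] at hqv
      have h2 := rowHeight_mono hi σ (p := p) (q := ⟨q, by rw [hqv]; exact p.2⟩) (by
        rw [hq]
        omega)
      have h3 := (A_ne_zero_iff_of_mem hS _ _).1 (h ⟨q, by rw [hqv]; exact p.2⟩)
      rw [hi_block p.1.hv h0 h1, top_of_notMem hv2]
      refine h2.trans ?_
      rw [rowHeight, offset_of_notMem hi2, hq, right_of_notMem hv2, width]
      simp only [hqv] at h3
      omega
  · rw [offset_of_notMem_S₁ hi hS |> fun e => show rowHeight σ p = _ by rw [rowHeight, e]]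
    have htgt : tgtX i = Q.width 1 := by
      rcases eq_one_or_one_lt hi with rfl | h1
      · rw [tgtX_of_notMem one_notMem_S₂, right_one]
      · rw [tgtX_of_mem ⟨h1, hS⟩]
    have hoff := offset_of_notMem_S₁ hi hS
    have hrh : ∀ q : Q.Row i, rowHeight σ q = (Q.sTilde 1 : ℤ) - 1 - q.1.column - (σ q).val :=
      fun q => by rw [rowHeight, hoff]
    rw [← hrh]
    constructor
    · obtain ⟨q, hq, hqv⟩ := exists_column_eq (Q := Q) (x := left p.1.v)
        (xMin_le p.1.hv) (by have := le_xMax p.1.hv; omega)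
      rw [block_eq p.1.hv (by omega) (by omega)] at hqv
      have h2 := rowHeight_mono hi σ (q := p) (p := ⟨q, by rw [hqv]; exact p.2⟩) (by
        rw [hq]
        omega)
      have h3 := (A_ne_zero_iff_of_notMem hS _ _).1 (h ⟨q, by rw [hqv]; exact p.2⟩)
      refine le_trans ?_ h2
      rw [hrh, hq, lo_block p.1.hv h0 h1]
      simp only [hqv] at h3
      by_cases hv2 : p.1.v ∈ Q.S₂
      · rw [bottom_of_mem hv2, left_of_mem hv2, width, width]
        omega
      · have hv1 : p.1.v = 1 := ((eq_one_or_mem_S₁_iff p.1.hv).2 hv2).resolve_right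
          fun hv1 => hS (mem_S₁_of_reach hv1 p.2)
        have e := congrArg Q.sTilde hv1
        have e' : left p.1.v = 0 := by rw [hv1, left_one]
        rw [bottom_of_notMem hv2]
        omega
    · obtain ⟨q, hq⟩ := exists_row hi (x := Q.width 1 - 1) (by omega) (by omega)
      have h2 := rowHeight_mono hi σ (p := p) (q := q) (by omega)
      rw [hrh q, hq] at h2
      refine h2.trans ?_
      rw [hi_eq (by omega)]
      simp only [width]
      omega

/-- The heights determine the column numbers. Their weak increase makes these numbers strictly
monotone, and the bounds in each block keep the entries out of the zero part. -/
theorem exists_valid_of_heights {i : Q.V} (hi0 : i ≠ 0) (Y : ℤ → ℤ)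
    (hY : ∀ x, srcX i ≤ x → x < tgtX i → Q.lo x ≤ Y x ∧ Y x ≤ Q.hi x)
    (hmono : ∀ x, srcX i < x → x < tgtX i → Y (x - 1) ≤ Y x) :
    ∃ σ : Q.Plucker i, IsValid σ ∧ ∀ p, rowHeight σ p = Y p.1.column := by
  have h7 := Q.range_arith
  have hmono' : ∀ n : ℕ, ∀ x, srcX i ≤ x → x + n < tgtX i → Y x ≤ Y (x + n) := by
    intro n
    induction n with
    | zero => intro x _ _; simp
    | succ n ih =>
      intro x h1 h2
      push_cast at h2 ⊢
      have h3 := ih x h1 (by omega)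
      have h4 := hmono (x + (n + 1)) (by omega) (by omega)
      have : x + ((n : ℤ) + 1) - 1 = x + n := by ring
      rw [this] at h4
      omega
  have hmono'' : ∀ x x', srcX i ≤ x → x ≤ x' → x' < tgtX i → Y x ≤ Y x' := by
    intro x x' h1 h2 h3
    have := hmono' (x' - x).toNat x h1 (by omega)
    rwa [Int.toNat_of_nonneg (by omega), add_sub_cancel] at this
  have hsx : srcX i ≤ 0 := srcX_nonpos
  have htx := width_one_le_tgtX hi0
  have hrange : ∀ p : Q.Row i, 0 ≤ offset i - p.1.column - Y p.1.column ∧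
      offset i - p.1.column - Y p.1.column < Q.sTilde i := by
    intro p
    obtain ⟨h1, h2⟩ := p.column_mem
    have h3 := hmono'' _ _ le_rfl h1 h2
    have h4 := hmono'' p.1.column (tgtX i - 1) h1 (by omega) (by omega)
    have h5 := hY (srcX i) le_rfl (by omega)
    have h6 := hY (tgtX i - 1) (by omega) (by omega)
    by_cases hi2 : i ∈ Q.S₂
    · rw [srcX_of_mem hi2] at h1 h3 h5
      rw [tgtX_of_mem hi2] at h2 h4 h6
      rw [lo_left hi0, bottom_of_mem hi2] at h5
      rw [hi_eq (by omega)] at h6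
      rw [left_of_mem hi2] at h1 h3 h5
      rw [offset_of_mem hi2]
      simp only [width] at *
      omega
    · rw [srcX_of_notMem hi2] at h1 h3 h5
      rw [tgtX_of_notMem hi2] at h2 h4 h6
      rw [lo_eq_zero le_rfl] at h5
      rw [hi_right hi0, top_of_notMem hi2] at h6
      rw [right_of_notMem hi2] at h2 h4 h6
      rw [offset_of_notMem hi2]
      simp only [width] at *
      omega
  let σ : Q.Plucker i := OrderEmbedding.ofStrictMono
    (fun p => (⟨(offset i - p.1.column - Y p.1.column).toNat, by
      have := hrange p
      omega⟩ : Fin (Q.sTilde i))) (by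
    intro p q hpq
    have h1 : q.1.column < p.1.column := NewRow.column_strictAnti hpq
    have h2 := hmono'' _ _ q.column_mem.1 h1.le p.column_mem.2
    have h3 := hrange p
    have h4 := hrange q
    rw [Fin.lt_def]
    simp only
    omega)
  have hσ : ∀ p, ((σ p).val : ℤ) = offset i - p.1.column - Y p.1.column := fun p =>
    Int.toNat_of_nonneg (hrange p).1
  have hrh : ∀ p, rowHeight σ p = Y p.1.column := fun p => by
    rw [rowHeight, hσ]
    ring
  refine ⟨σ, fun p => ?_, hrh⟩
  have hp := hσ p
  obtain ⟨h1, h2⟩ := p.column_mem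
  have h3 := hY _ h1 h2
  have h4 := p.1.left_le_column
  have h5 := p.1.column_lt_right
  have hr := srcX_le_left_of_reach p.1.hv p.2
  have hlt := left_lt_right p.1.hv
  rw [lo_block p.1.hv h4 h5, hi_block p.1.hv h4 h5] at h3
  by_cases hS : i ∈ Q.S₁
  · have hi2 := notMem_S₂_of_mem_S₁ hS
    have hv2 : p.1.v ∉ Q.S₂ := fun hv2 => by
      have := right_nonpos hv2
      rw [srcX_of_notMem hi2] at hr
      omega
    rw [A_ne_zero_iff_of_mem hS]
    rw [offset_of_notMem hi2] at hp
    rw [top_of_notMem hv2] at h3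
    rw [right_of_notMem hv2, width] at h5
    omega
  · rw [A_ne_zero_iff_of_notMem hS]
    rw [offset_of_notMem_S₁ hi0 hS] at hp
    by_cases hv2 : p.1.v ∈ Q.S₂
    · rw [bottom_of_mem hv2] at h3
      rw [left_of_mem hv2, width, width] at h4
      omega
    · have hv1 : p.1.v = 1 := ((eq_one_or_mem_S₁_iff p.1.hv).2 hv2).resolve_right
        fun hv1 => hS (mem_S₁_of_reach hv1 p.2)
      rw [bottom_of_notMem hv2] at h3
      rw [hv1, left_one] at h4
      rw [hv1]
      omega

end Columns

end YShapedQuiver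

namespace YShapedQuiver

/-! ### Counting the flow across columns and along lines -/

section Counting

open scoped Classical in
/-- The total value of a flow on the edges with a given property. -/
noncomputable def count (f : ((ℤ × ℤ) × (ℤ × ℤ)) →₀ ℕ) (p : (ℤ × ℤ) × (ℤ × ℤ) → Prop) : ℤ :=
  ((f.filter p).degree : ℤ)

variable {f f' : ((ℤ × ℤ) × (ℤ × ℤ)) →₀ ℕ} {p q : (ℤ × ℤ) × (ℤ × ℤ) → Prop}

theorem count_nonneg : 0 ≤ count f p := Int.natCast_nonneg _

theorem count_congr' (h : ∀ e, p e → f e = f' e) : count f p = count f' p := by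
  classical
  rw [count, count]
  congr 2
  ext e
  rw [Finsupp.filter_apply, Finsupp.filter_apply]
  split_ifs with he
  · exact h e he
  · rfl

theorem count_congr (h : ∀ e, f e ≠ 0 → (p e ↔ q e)) : count f p = count f q := by
  classical
  rw [count, count]
  congr 2
  ext e
  rw [Finsupp.filter_apply, Finsupp.filter_apply]
  by_cases he : f e = 0
  · rw [he, ite_self, ite_self]
  · simp only [h e he]

theorem count_eq_zero (h : ∀ e, p e → f e = 0) : count f p = 0 := by
  rw [count_congr' (f' := 0) h, count, Finsupp.filter_zero, map_zero, Nat.cast_zero]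

theorem le_count {e : (ℤ × ℤ) × (ℤ × ℤ)} (h : p e) : (f e : ℤ) ≤ count f p := by
  classical
  rw [count, ← Finsupp.filter_apply_pos p f h]
  exact_mod_cast Finsupp.le_degree e _

open scoped Classical in
theorem count_eq_sum : count f p = ∑ e ∈ f.support, f e • (if p e then (1 : ℤ) else 0) := by
  rw [count, Finsupp.degree_apply, Finsupp.support_filter, Finset.sum_filter]
  push_cast
  refine Finset.sum_congr rfl fun e _ => ?_
  split_ifs with h
  · rw [Finsupp.filter_apply_pos _ _ h]
    simp
  · simp

theorem count_or (h : ∀ e, p e → ¬ q e) : count f (fun e => p e ∨ q e) = count f p + count f q := by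
  classical
  rw [count_eq_sum, count_eq_sum, count_eq_sum, ← Finset.sum_add_distrib]
  refine Finset.sum_congr rfl fun e _ => ?_
  by_cases hp : p e
  · simp [hp, h e hp]
  · simp [hp]

theorem count_eq (e : (ℤ × ℤ) × (ℤ × ℤ)) : count f (fun e' => e' = e) = f e := by
  classical
  rw [count_eq_sum]
  simp only [smul_ite, smul_zero, Finset.sum_ite_eq', Finsupp.mem_support_iff, ne_eq]
  split_ifs with h
  · rw [h, Nat.cast_zero]
  · simp

/-- The difference of the flow into a set and the flow out of it. -/
theorem boundary_indicator (S : Set (ℤ × ℤ)) :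
    boundary (S.indicator fun _ => (1 : ℤ)) f =
      count f (fun e => e.2 ∈ S ∧ e.1 ∉ S) - count f (fun e => e.1 ∈ S ∧ e.2 ∉ S) := by
  rw [count_eq_sum, count_eq_sum, boundary, Finsupp.linearCombination_apply, Finsupp.sum,
    ← Finset.sum_sub_distrib]
  refine Finset.sum_congr rfl fun e _ => ?_
  by_cases h1 : e.1 ∈ S <;> by_cases h2 : e.2 ∈ S <;> simp [h1, h2, Set.indicator]

/-- The total value of a flow on the horizontal edges in a column whose heights have a given
property. -/
noncomputable def hCount (f : ((ℤ × ℤ) × (ℤ × ℤ)) →₀ ℕ) (x : ℤ) (p : ℤ → Prop) : ℤ :=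
  count f fun e => ∃ y, e = hEdge x y ∧ p y

theorem hEdge_injective {x x' y y' : ℤ} (h : hEdge x y = hEdge x' y') : x = x' ∧ y = y' :=
  Prod.mk.inj (Prod.mk.inj h).1

theorem vEdge_injective {x x' y y' : ℤ} (h : vEdge x y = vEdge x' y') : x = x' ∧ y = y' :=
  Prod.mk.inj (Prod.mk.inj h).1

theorem hEdge_ne_vEdge {x x' y y' : ℤ} : hEdge x y ≠ vEdge x' y' := by
  intro h
  obtain ⟨h1, h2⟩ := Prod.mk.inj h
  have h3 := (Prod.mk.inj h1).1
  have h4 := (Prod.mk.inj h2).1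
  omega

theorem hCount_nonneg {x : ℤ} {p : ℤ → Prop} : 0 ≤ hCount f x p := count_nonneg

theorem hCount_eq_zero {x : ℤ} {p : ℤ → Prop} (h : ∀ y, p y → f (hEdge x y) = 0) :
    hCount f x p = 0 :=
  count_eq_zero (by
    rintro e ⟨y, rfl, hy⟩
    exact h y hy)

theorem le_hCount {x y : ℤ} {p : ℤ → Prop} (h : p y) : (f (hEdge x y) : ℤ) ≤ hCount f x p :=
  le_count ⟨y, rfl, h⟩

theorem hCount_congr {x : ℤ} {p q : ℤ → Prop} (h : ∀ y, f (hEdge x y) ≠ 0 → (p y ↔ q y)) :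
    hCount f x p = hCount f x q := by
  refine count_congr fun e he => ?_
  constructor
  · rintro ⟨y, rfl, hy⟩
    exact ⟨y, rfl, (h y he).1 hy⟩
  · rintro ⟨y, rfl, hy⟩
    exact ⟨y, rfl, (h y he).2 hy⟩

theorem hCount_congr' {x : ℤ} {p : ℤ → Prop} (h : ∀ y, f (hEdge x y) = f' (hEdge x y)) :
    hCount f x p = hCount f' x p :=
  count_congr' (by
    rintro e ⟨y, rfl, _⟩
    exact h y)

variable {Q : YShapedQuiver}

theorem IsFlow.eq_edge (hf : Q.IsFlow f) {e : (ℤ × ℤ) × (ℤ × ℤ)} (he : f e ≠ 0) :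
    ∃ x y, e = hEdge x y ∨ e = vEdge x y := by
  obtain ⟨⟨x, y⟩, P⟩ := e
  refine ⟨x, y, ?_⟩
  rcases hf.step _ he with ⟨h, _⟩ | ⟨h, _⟩
  · exact Or.inl (congrArg _ h)
  · exact Or.inr (congrArg _ h)

/-- No step leads to the left, so the flow into the half-plane is the total flow in one column. In
particular this total depends on the boundary only. -/
theorem IsFlow.boundary_right (hf : Q.IsFlow f) (x : ℤ) :
    boundary ({P : ℤ × ℤ | x < P.1}.indicator fun _ => (1 : ℤ)) f =
      hCount f x fun _ => True := by
  rw [boundary_indicator, count_eq_zero (p := fun e => e.1 ∈ _ ∧ e.2 ∉ _), sub_zero]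
  · refine count_congr fun e he => ?_
    obtain ⟨a, b, rfl | rfl⟩ := hf.eq_edge he
    · constructor
      · rintro ⟨h1, h2⟩
        simp only [hEdge, Set.mem_ofPred_eq] at h1 h2
        have : a = x := by omega
        exact ⟨b, by rw [this], trivial⟩
      · rintro ⟨y, h1, -⟩
        obtain ⟨rfl, rfl⟩ := hEdge_injective h1
        simp [hEdge]
    · refine iff_of_false (fun h1 => h1.2 h1.1) ?_
      rintro ⟨y, h1, -⟩
      exact hEdge_ne_vEdge h1.symm
  · rintro e ⟨h1, h2⟩
    by_contra he
    obtain ⟨a, b, rfl | rfl⟩ := hf.eq_edge he <;>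
      simp only [hEdge, vEdge, Set.mem_ofPred_eq] at h1 h2 <;> omega

/-- Flow enters the lower part of a line only from the left, and leaves it to the right or through
the vertical edge at its upper end. -/
theorem IsFlow.boundary_line (hf : Q.IsFlow f) (x y : ℤ) :
    boundary ({P : ℤ × ℤ | P.1 = x ∧ P.2 ≤ y}.indicator fun _ => (1 : ℤ)) f =
      hCount f (x - 1) (· ≤ y) - hCount f x (· ≤ y) - f (vEdge x y) := by
  rw [boundary_indicator, sub_sub, ← count_eq, hCount, hCount, ← count_or]
  · congr 1
    · refine count_congr fun e he => ?_
      obtain ⟨a, b, rfl | rfl⟩ := hf.eq_edge he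
      · constructor
        · rintro ⟨h1, h2⟩
          simp only [hEdge, Set.mem_ofPred_eq] at h1 h2
          exact ⟨b, by rw [← h1.1, add_sub_cancel_right], h1.2⟩
        · rintro ⟨y', h1, h2⟩
          obtain ⟨rfl, rfl⟩ := hEdge_injective h1
          simp only [hEdge, Set.mem_ofPred_eq]
          omega
      · refine iff_of_false ?_ ?_
        · rintro ⟨h1, h2⟩
          simp only [vEdge, Set.mem_ofPred_eq] at h1 h2
          omega
        · rintro ⟨y, h1, -⟩
          exact hEdge_ne_vEdge h1.symm
    · refine count_congr fun e he => ?_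
      obtain ⟨a, b, rfl | rfl⟩ := hf.eq_edge he
      · constructor
        · rintro ⟨h1, h2⟩
          simp only [hEdge, Set.mem_ofPred_eq] at h1 h2
          exact Or.inl ⟨b, by rw [← h1.1], h1.2⟩
        · rintro (⟨y', h1, h2⟩ | h1)
          · obtain ⟨rfl, rfl⟩ := hEdge_injective h1
            refine ⟨⟨rfl, h2⟩, ?_⟩
            simp [hEdge]
          · exact absurd h1 hEdge_ne_vEdge
      · constructor
        · rintro ⟨h1, h2⟩
          simp only [vEdge, Set.mem_ofPred_eq] at h1 h2
          have : b = y := by omega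
          exact Or.inr (by rw [← h1.1, ← this])
        · rintro (⟨y', h1, h2⟩ | h1)
          · exact absurd h1.symm hEdge_ne_vEdge
          · obtain ⟨rfl, rfl⟩ := vEdge_injective h1
            simp [vEdge]
  · rintro e ⟨y', rfl, _⟩ h
    exact hEdge_ne_vEdge h

/-- A flow is determined by its values on the horizontal edges and its boundary. -/
theorem IsFlow.eq_of_hEdge (hf : Q.IsFlow f) (hf' : Q.IsFlow f')
    (h : ∀ x y, f (hEdge x y) = f' (hEdge x y))
    (hb : ∀ φ : ℤ × ℤ → ℤ, boundary φ f = boundary φ f') : f = f' := by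
  -- The balance of the lower part of a line expresses each vertical edge by horizontal edges and
  -- the boundary.
  have hv : ∀ x y, f (vEdge x y) = f' (vEdge x y) := by
    intro x y
    have h1 := hf.boundary_line x y
    have h2 := hf'.boundary_line x y
    rw [hb, h2, hCount_congr' (h (x - 1)), hCount_congr' (h x)] at h1
    omega
  ext e
  by_cases he : f e = 0
  · by_cases he' : f' e = 0
    · rw [he, he']
    · obtain ⟨x, y, rfl | rfl⟩ := hf'.eq_edge he'
      · exact h x y
      · exact hv x y
  · obtain ⟨x, y, rfl | rfl⟩ := hf.eq_edge he
    · exact h x y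
    · exact hv x y

end Counting

/-! ### Flows along lattice paths -/

section PathFlows

/-- The flow along the lattice path with height `Y x` in column `x`. -/
noncomputable def pathFlow (a b : ℤ) (Y : ℤ → ℤ) : ((ℤ × ℤ) × (ℤ × ℤ)) →₀ ℕ :=
  ∑ x ∈ Finset.Ico a b, Finsupp.single (hEdge x (Y x)) 1 +
    -- The lines `a` and `b` are both included, so `Y (a - 1)` and `Y b`, which belong to no column
    -- of the path, are the heights of its start and end.
    ∑ x ∈ Finset.Ico a (b + 1), ∑ y ∈ Finset.Ico (Y (x - 1)) (Y x), Finsupp.single (vEdge x y) 1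

theorem pathFlow_hEdge (a b : ℤ) (Y : ℤ → ℤ) (x y : ℤ) : pathFlow a b Y (hEdge x y) =
    if (a ≤ x ∧ x < b) ∧ y = Y x then 1 else 0 := by
  classical
  rw [pathFlow, Finsupp.add_apply, Finsupp.finsetSum_apply, Finsupp.finsetSum_apply]
  rw [Finset.sum_eq_zero (s := Finset.Ico a (b + 1)), add_zero]
  · simp only [Finsupp.single_apply]
    split_ifs with h
    · rw [Finset.sum_eq_single x, if_pos (by rw [h.2])]
      · intro x' _ hne
        exact if_neg fun he => hne (hEdge_injective he).1
      · intro hn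
        exact absurd (Finset.mem_Ico.2 h.1) hn
    · refine Finset.sum_eq_zero fun x' hx' => if_neg fun he => h ?_
      obtain ⟨rfl, rfl⟩ := hEdge_injective he
      exact ⟨Finset.mem_Ico.1 hx', rfl⟩
  · intro x' _
    rw [Finsupp.finsetSum_apply]
    exact Finset.sum_eq_zero fun y' _ => Finsupp.single_eq_of_ne hEdge_ne_vEdge

theorem pathFlow_vEdge (a b : ℤ) (Y : ℤ → ℤ) (x y : ℤ) : pathFlow a b Y (vEdge x y) =
    if (a ≤ x ∧ x ≤ b) ∧ Y (x - 1) ≤ y ∧ y < Y x then 1 else 0 := by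
  classical
  rw [pathFlow, Finsupp.add_apply, Finsupp.finsetSum_apply, Finsupp.finsetSum_apply]
  rw [Finset.sum_eq_zero (s := Finset.Ico a b), zero_add]
  · have h1 : ∀ x' y', (Finsupp.single (vEdge x' y') 1 : ((ℤ × ℤ) × (ℤ × ℤ)) →₀ ℕ) (vEdge x y) =
        if x' = x ∧ y' = y then 1 else 0 := by
      intro x' y'
      rw [Finsupp.single_apply]
      refine if_congr ⟨vEdge_injective, ?_⟩ rfl rfl
      rintro ⟨rfl, rfl⟩
      rfl
    simp only [Finsupp.finsetSum_apply, h1]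
    split_ifs with h
    · rw [Finset.sum_eq_single x, Finset.sum_eq_single y, if_pos ⟨rfl, rfl⟩]
      · intro y' _ hne
        exact if_neg fun he => hne he.2
      · intro hn
        exact absurd (Finset.mem_Ico.2 h.2) hn
      · intro x' _ hne
        exact Finset.sum_eq_zero fun y' _ => if_neg fun he => hne he.1
      · intro hn
        exact absurd (Finset.mem_Ico.2 ⟨h.1.1, by omega⟩) hn
    · refine Finset.sum_eq_zero fun x' hx' => Finset.sum_eq_zero fun y' hy' => if_neg ?_
      rintro ⟨rfl, rfl⟩
      rw [Finset.mem_Ico] at hx' hy'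
      exact h ⟨⟨hx'.1, by omega⟩, hy'⟩
  · intro x' _
    exact Finsupp.single_eq_of_ne hEdge_ne_vEdge.symm

theorem pathFlow_ne_zero {a b : ℤ} {Y : ℤ → ℤ} {e : (ℤ × ℤ) × (ℤ × ℤ)} (h : pathFlow a b Y e ≠ 0) :
    (∃ x, a ≤ x ∧ x < b ∧ e = hEdge x (Y x)) ∨
    ∃ x y, a ≤ x ∧ x ≤ b ∧ Y (x - 1) ≤ y ∧ y < Y x ∧ e = vEdge x y := by
  classical
  rw [pathFlow, Finsupp.add_apply, Finsupp.finsetSum_apply, Finsupp.finsetSum_apply] at h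
  by_cases h1 : ∑ x ∈ Finset.Ico a b, (Finsupp.single (hEdge x (Y x)) 1 : _ →₀ ℕ) e = 0
  · rw [h1, zero_add] at h
    obtain ⟨x, hx, h⟩ := Finset.exists_ne_zero_of_sum_ne_zero h
    rw [Finsupp.finsetSum_apply] at h
    obtain ⟨y, hy, h⟩ := Finset.exists_ne_zero_of_sum_ne_zero h
    rw [Finset.mem_Ico] at hx hy
    refine Or.inr ⟨x, y, hx.1, by omega, hy.1, hy.2, ?_⟩
    by_contra hne
    exact h (Finsupp.single_eq_of_ne hne)
  · obtain ⟨x, hx, h⟩ := Finset.exists_ne_zero_of_sum_ne_zero h1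
    rw [Finset.mem_Ico] at hx
    refine Or.inl ⟨x, hx.1, hx.2, ?_⟩
    by_contra hne
    exact h (Finsupp.single_eq_of_ne hne)

theorem boundary_pathFlow {M : Type} [AddCommGroup M] (φ : ℤ × ℤ → M) {a b : ℤ} {Y : ℤ → ℤ}
    (hab : a ≤ b) (hY : ∀ x, a ≤ x → x ≤ b → Y (x - 1) ≤ Y x) :
    boundary φ (pathFlow a b Y) = φ (b, Y b) - φ (a, Y (a - 1)) := by
  have h1 : ∀ e, boundary φ (Finsupp.single e 1) = φ e.2 - φ e.1 := fun e => by
    rw [boundary, Finsupp.linearCombination_single, one_smul]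
  rw [pathFlow, map_add, map_sum, map_sum]
  simp only [map_sum, h1, hEdge, vEdge]
  have h2 : ∀ x ∈ Finset.Ico a (b + 1), ∑ y ∈ Finset.Ico (Y (x - 1)) (Y x),
      (φ (x, y + 1) - φ (x, y)) = φ (x, Y x) - φ (x, Y (x - 1)) := by
    intro x hx
    rw [Finset.mem_Ico] at hx
    exact Int.sum_Ico_sub (fun y => φ (x, y)) (hY x hx.1 (by omega))
  obtain ⟨g, hg⟩ : ∃ g : ℤ → M, ∀ x, g x = φ (x, Y (x - 1)) := ⟨_, fun _ => rfl⟩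
  rw [Finset.sum_congr rfl h2, ← Finset.insert_Ico_right_eq_Ico_add_one hab,
    Finset.sum_insert (by simp), add_left_comm, ← Finset.sum_add_distrib]
  have h3 : ∀ x ∈ Finset.Ico a b, φ (x + 1, Y x) - φ (x, Y x) + (φ (x, Y x) - φ (x, Y (x - 1))) =
      g (x + 1) - g x := by
    intro x _
    rw [hg, hg, add_sub_cancel_right]
    abel
  rw [Finset.sum_congr rfl h3, Int.sum_Ico_sub _ hab, hg, hg]
  abel

variable {Q : YShapedQuiver}

/-- The function `Y` gives the heights of a lattice path for `i`. -/
structure IsPath (i : Q.V) (Y : ℤ → ℤ) : Prop where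
  start : Y (srcX i - 1) = Q.lo (srcX i)
  finish : Y (tgtX i) = Q.hi (tgtX i - 1)
  bounds : ∀ x, srcX i ≤ x → x < tgtX i → Q.lo x ≤ Y x ∧ Y x ≤ Q.hi x
  mono : ∀ x, srcX i < x → x < tgtX i → Y (x - 1) ≤ Y x

theorem srcX_lt_tgtX {i : Q.V} (hi : i ≠ 0) : srcX i < tgtX i := by
  have := width_one_le_tgtX hi
  have := srcX_nonpos (v := i)
  have := width_one_pos (Q := Q)
  omega

theorem IsPath.mono' {i : Q.V} (hi0 : i ≠ 0) {Y : ℤ → ℤ} (h : IsPath i Y) {x : ℤ}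
    (h1 : srcX i ≤ x) (h2 : x ≤ tgtX i) : Y (x - 1) ≤ Y x := by
  have := srcX_lt_tgtX hi0
  rcases h1.eq_or_lt with rfl | h1
  · rw [h.start]
    exact (h.bounds _ le_rfl this).1
  · rcases h2.eq_or_lt with rfl | h2
    · rw [h.finish]
      exact (h.bounds _ (by omega) (by omega)).2
    · exact h.mono x h1 h2

theorem IsPath.boundary {M : Type} [AddCommGroup M] (φ : ℤ × ℤ → M) {i : Q.V} (hi0 : i ≠ 0)
    {Y : ℤ → ℤ} (h : IsPath i Y) : boundary φ (pathFlow (srcX i) (tgtX i) Y) =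
      φ (tgtPoint i) - φ (srcPoint i) := by
  rw [boundary_pathFlow φ (srcX_lt_tgtX hi0).le fun x h1 h2 => h.mono' hi0 h1 h2, h.start, h.finish,
    tgtPoint, srcPoint]

theorem IsPath.isFlow {i : Q.V} (hi0 : i ≠ 0) {Y : ℤ → ℤ} (h : IsPath i Y) :
    Q.IsFlow (pathFlow (srcX i) (tgtX i) Y) where
  step e he := by
    have h7 := Q.range_arith
    have h1 := xMin_le_srcX hi0
    have h2 := tgtX_le_xMax hi0
    have h8 := srcX_lt_tgtX hi0
    have hs := srcX_nonpos (v := i)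
    have ht := width_one_le_tgtX hi0
    rcases pathFlow_ne_zero he with ⟨x, h3, h4, rfl⟩ | ⟨x, y, h3, h4, h5, h6, rfl⟩
    · refine step_right_iff.2 ⟨by omega, by omega, h.bounds x h3 h4⟩
    · refine step_up_iff.2 ?_
      have c1 := column_arith (Q := Q) x
      have c2 := column_arith (Q := Q) (x - 1)
      rcases h3.eq_or_lt with e | h3
      · have := h.bounds x (by omega) (by omega)
        have e2 := h.start
        rw [e] at e2
        omega
      · have b2 := h.bounds (x - 1) (by omega) (by omega)
        rcases h4.eq_or_lt with e | h4
        · have e2 := h.finish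
          rw [← e] at e2
          omega
        · have := h.bounds x (by omega) (by omega)
          omega
  conserved φ hφ := by
    rw [h.boundary φ hi0, hφ _ (tgtPoint_mem hi0), hφ _ (srcPoint_mem hi0), sub_zero]

theorem IsPath.congr {i : Q.V} {Y Y' : ℤ → ℤ} (h : IsPath i Y) (h' : IsPath i Y')
    (hY : ∀ x, srcX i ≤ x → x < tgtX i → Y x = Y' x) :
    pathFlow (srcX i) (tgtX i) Y = pathFlow (srcX i) (tgtX i) Y' := by
  have key : ∀ x, srcX i - 1 ≤ x → x ≤ tgtX i → Y x = Y' x := by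
    intro x h1 h2
    by_cases h3 : x = srcX i - 1
    · rw [h3, h.start, h'.start]
    · by_cases h4 : x = tgtX i
      · rw [h4, h.finish, h'.finish]
      · exact hY x (by omega) (by omega)
  rw [pathFlow, pathFlow]
  congr 1
  · refine Finset.sum_congr rfl fun x hx => ?_
    rw [Finset.mem_Ico] at hx
    rw [key x (by omega) (by omega)]
  · refine Finset.sum_congr rfl fun x hx => ?_
    rw [Finset.mem_Ico] at hx
    rw [key x (by omega) (by omega), key (x - 1) (by omega) (by omega)]

/-- The heights of a lattice path for `i`, continued to the left and to the right. -/
noncomputable def extendPath (i : Q.V) (y : ℤ → ℤ) (x : ℤ) : ℤ :=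
  if x < srcX i then Q.lo (srcX i) else if x < tgtX i then y x else Q.hi (tgtX i - 1)

theorem extendPath_of_mem {i : Q.V} {y : ℤ → ℤ} {x : ℤ} (h1 : srcX i ≤ x) (h2 : x < tgtX i) :
    extendPath i y x = y x := by
  rw [extendPath, if_neg (by omega), if_pos h2]

theorem isPath_extendPath {i : Q.V} (hi0 : i ≠ 0) {y : ℤ → ℤ}
    (hb : ∀ x, srcX i ≤ x → x < tgtX i → Q.lo x ≤ y x ∧ y x ≤ Q.hi x)
    (hm : ∀ x, srcX i < x → x < tgtX i → y (x - 1) ≤ y x) : IsPath i (extendPath i y) where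
  start := by rw [extendPath, if_pos (by omega)]
  finish := by
    have := srcX_lt_tgtX hi0
    rw [extendPath, if_neg (by omega), if_neg (lt_irrefl _)]
  bounds x h1 h2 := by
    rw [extendPath_of_mem h1 h2]
    exact hb x h1 h2
  mono x h1 h2 := by
    rw [extendPath_of_mem h1.le h2, extendPath_of_mem (by omega) (by omega)]
    exact hm x h1 h2

end PathFlows

end YShapedQuiver

namespace YShapedQuiver

variable {Q : YShapedQuiver}

/-! ### The monomial in the arrows that belongs to a minor -/

section PluckerPaths

open scoped Classical in
/-- The lattice path of the minor with columns `σ`. -/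
noncomputable def pluckerPath {i : Q.V} (σ : Q.Plucker i) : ℤ → ℤ :=
  extendPath i fun x => if h : ∃ p : Q.Row i, p.1.column = x then rowHeight σ h.choose else 0

theorem pluckerPath_column {i : Q.V} (σ : Q.Plucker i) (p : Q.Row i) :
    pluckerPath σ p.1.column = rowHeight σ p := by
  have h : ∃ q : Q.Row i, q.1.column = p.1.column := ⟨p, rfl⟩
  rw [pluckerPath, extendPath_of_mem p.column_mem.1 p.column_mem.2, dif_pos h]
  congr 1
  exact Subtype.ext (NewRow.column_strictAnti.injective h.choose_spec)

theorem isPath_pluckerPath {i : Q.V} (hi : i ≠ 0) {σ : Q.Plucker i} (h : IsValid σ) :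
    IsPath i (pluckerPath σ) := by
  have key : ∀ x, srcX i ≤ x → x < tgtX i → ∃ p : Q.Row i, p.1.column = x ∧
      (if h : ∃ p : Q.Row i, p.1.column = x then rowHeight σ h.choose else 0) = rowHeight σ p := by
    intro x h1 h2
    obtain ⟨p, rfl⟩ := exists_row hi h1 h2
    refine ⟨p, rfl, ?_⟩
    rw [← pluckerPath_column, pluckerPath, extendPath_of_mem h1 h2]
  refine isPath_extendPath hi (fun x h1 h2 => ?_) fun x h1 h2 => ?_
  · obtain ⟨p, hp, e⟩ := key x h1 h2
    have := h.le_rowHeight hi p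
    rw [hp, ← e] at this
    exact this
  · obtain ⟨p, hp, e⟩ := key x h1.le h2
    obtain ⟨q, hq, e'⟩ := key (x - 1) (by omega) (by omega)
    have := rowHeight_mono hi σ (p := q) (q := p) (by omega)
    rw [← e, ← e'] at this
    exact this

/-- The arrows of the ladder quiver on the lattice path of the minor with columns `σ`. -/
noncomputable def pluckerArrows {i : Q.V} (σ : Q.Plucker i) : Q.Arrow →₀ ℕ :=
  Q.isForked.arrowFlow (pathFlow (srcX i) (tgtX i) (pluckerPath σ))

theorem flow_pluckerArrows {i : Q.V} (hi : i ≠ 0) {σ : Q.Plucker i} (h : IsValid σ) :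
    Q.flow (pluckerArrows σ) = pathFlow (srcX i) (tgtX i) (pluckerPath σ) :=
  Q.isForked.flow_arrowFlow ((isPath_pluckerPath hi h).isFlow hi)

theorem weight_eq_boundary (u : Q.Arrow →₀ ℕ) :
    Finsupp.weight Q.arrowWeight u = boundary Q.eAt (Q.flow u) := by
  rw [boundary_flow]
  rfl

theorem weight_pluckerArrows {i : Q.V} (hi : i ≠ 0) {σ : Q.Plucker i} (h : IsValid σ) :
    Finsupp.weight Q.arrowWeight (pluckerArrows σ) = Q.pathWeight i := by
  rw [weight_eq_boundary, flow_pluckerArrows hi h, (isPath_pluckerPath hi h).boundary _ hi,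
    pathWeight]

/-- The pairing of the character lattice with the functions on the vertices, up to constants. -/
noncomputable def pairing (φ : ℤ × ℤ → ℤ) : Q.CharacterLattice →ₗ[ℤ] ℤ :=
  letI := Fintype.ofFinite {P : Q.vertices // P.1 ≠ (0, 0)}
  -- The value at the origin is subtracted because the basis vector of the origin is `0`.
  ∑ P : {P : Q.vertices // P.1 ≠ (0, 0)}, (φ P.1.1 - φ (0, 0)) • LinearMap.proj P

theorem pairing_eAt (φ : ℤ × ℤ → ℤ) {P : ℤ × ℤ} (h : P ∈ Q.vertices) :
    pairing φ (Q.eAt P) = φ P - φ (0, 0) := by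
  by_cases h0 : P = (0, 0)
  · rw [h0, eAt_zero, map_zero, sub_self]
  · rw [pairing, LinearMap.sum_apply, Finset.sum_eq_single ⟨⟨P, h⟩, h0⟩]
    · simp [eAt]
    · intro P' _ hne
      rw [LinearMap.smul_apply, LinearMap.proj_apply, eAt, if_neg, smul_zero]
      rintro rfl
      exact hne rfl
    · exact fun hn => absurd (@Finset.mem_univ _ (Fintype.ofFinite _) _) hn

/-- The weight of a monomial thus determines the boundary of its flow for every integer-valued test
function. -/
theorem pairing_weight (φ : ℤ × ℤ → ℤ) (u : Q.Arrow →₀ ℕ) :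
    pairing φ (Finsupp.weight Q.arrowWeight u) = boundary φ (Q.flow u) := by
  rw [boundary_flow, Finsupp.weight_apply, Finsupp.linearCombination_apply, Finsupp.sum,
    Finsupp.sum, map_sum]
  refine Finset.sum_congr rfl fun a _ => ?_
  rw [map_nsmul]
  congr 1
  change pairing φ (Q.eAt a.tgt.1 - Q.eAt a.src.1) = _
  rw [map_sub, pairing_eAt φ a.tgt.2, pairing_eAt φ a.src.2]
  ring

theorem pairing_pathWeight (φ : ℤ × ℤ → ℤ) {i : Q.V} (hi : i ≠ 0) :
    pairing φ (Q.pathWeight i) = φ (tgtPoint i) - φ (srcPoint i) := by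
  rw [pathWeight, map_sub, pairing_eAt φ (tgtPoint_mem hi), pairing_eAt φ (srcPoint_mem hi)]
  ring

variable (Q) in
/-- The values of a flow on the horizontal edges. -/
noncomputable def horizontal : (Q.Arrow →₀ ℕ) →+ (Q.Coord →₀ ℤ) where
  toFun u := Finsupp.equivFunOnFinite.symm fun c => (Q.flow u c.edge : ℤ)
  map_zero' := by
    ext c
    simp
  map_add' u u' := by
    ext c
    simp

theorem horizontal_apply (u : Q.Arrow →₀ ℕ) (c : Q.Coord) :
    Q.horizontal u c = (Q.flow u c.edge : ℤ) := rfl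

/-- The weight gives the boundary, the boundary and the horizontal edges give the vertical edges,
and the flow on the edges gives the flow on the arrows. -/
theorem eq_of_horizontal_eq {u u' : Q.Arrow →₀ ℕ}
    (hw : Finsupp.weight Q.arrowWeight u = Finsupp.weight Q.arrowWeight u')
    (h : Q.horizontal u = Q.horizontal u') : u = u' := by
  refine Q.isForked.flow_injective ((isFlow_flow u).eq_of_hEdge (isFlow_flow u') ?_ ?_)
  · intro x y
    by_cases hs : Q.Step (x, y) (x + 1, y)
    · obtain ⟨c, hc⟩ := exists_coord_edge_eq hs
      rw [← hc]
      have h1 := DFunLike.congr_fun h c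
      rw [horizontal_apply, horizontal_apply] at h1
      exact_mod_cast h1
    · have key : ∀ v : Q.Arrow →₀ ℕ, Q.flow v (hEdge x y) = 0 := by
        intro v
        by_contra hv
        exact hs ((isFlow_flow v).step _ hv)
      rw [key, key]
  · intro φ
    rw [← pairing_weight, hw, pairing_weight]

/-- The diagonal entries of the minor are the coordinates on the horizontal edges of its lattice
path, one for each column that the path crosses. -/
theorem toLaurent_initialTerm {i : Q.V} (hi : i ≠ 0) {σ : Q.Plucker i} (h : IsValid σ) :
    Q.toLaurent (Q.initialTerm i σ) =
      AddMonoidAlgebra.single (Q.horizontal (pluckerArrows σ)) 1 := by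
  classical
  choose x hx1 hx2 hx3 using fun p => (Q.A_eq_zero_or i p (σ p)).resolve_left (h p)
  have hedge : ∀ p, (x p).edge = hEdge p.1.column (pluckerPath σ p.1.column) := fun p => by
    rw [pluckerPath_column, Coord.edge, height_eq_rowHeight hi σ p (hx2 p) (hx3 p), hx2]
  have h1 : Q.horizontal (pluckerArrows σ) = ∑ p, Finsupp.single (x p) 1 := by
    ext c
    rw [horizontal_apply, flow_pluckerArrows hi h, Coord.edge, pathFlow_hEdge,
      Finsupp.finsetSum_apply]
    split_ifs with hc
    · obtain ⟨p, hp⟩ := exists_row hi hc.1.1 hc.1.2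
      have hxc : x p = c := Coord.edge_injective (by rw [hedge, hp, ← hc.2, Coord.edge])
      rw [Finset.sum_eq_single p, hxc, Finsupp.single_eq_same, Nat.cast_one]
      · intro q _ hq
        refine Finsupp.single_eq_of_ne fun e => hq (Subtype.ext ?_)
        rw [← hx2, ← hx2, ← e, hxc]
      · exact fun hn => absurd (Finset.mem_univ _) hn
    · rw [Nat.cast_zero, Finset.sum_eq_zero]
      intro p _
      refine Finsupp.single_eq_of_ne fun e => hc ?_
      have h2 := hedge p
      rw [← e] at h2
      obtain ⟨h3, h4⟩ := hEdge_injective h2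
      rw [h3]
      exact ⟨p.column_mem, h4⟩
  rw [initialTerm_eq x hx1 hx2, h1, MvPolynomial.monomial_sum_one, map_prod]
  have key : ∀ t : Finset (Q.Row i), ∏ p ∈ t, Q.toLaurent (MvPolynomial.monomial
      (Finsupp.single (x p) 1) 1) = AddMonoidAlgebra.single (∑ p ∈ t, Finsupp.single (x p) 1) 1 := by
    intro t
    induction t using Finset.induction_on with
    | empty => rfl
    | insert p t hp ih =>
      rw [Finset.prod_insert hp, Finset.sum_insert hp, ih, ← MvPolynomial.X, toLaurent,
        MvPolynomial.aeval_X, AddMonoidAlgebra.single_mul_single, one_mul]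
  exact key _

end PluckerPaths

end YShapedQuiver

namespace YShapedQuiver

variable {Q : YShapedQuiver}

/-! ### Splitting off a lattice path from a flow -/

section Peeling

theorem srcX_eq_zero_or (v : Q.V) : srcX v = 0 ∨ tgtX v = Q.width 1 := by
  by_cases h : v ∈ Q.S₂
  · exact Or.inr (tgtX_of_mem h)
  · exact Or.inl (srcX_of_notMem h)

/-- Every path starts at `0`, the largest possible start, or ends at `width 1`, the smallest
possible end. So a maximal sum of start and end means that both are maximal. -/
theorem srcX_le_and_tgtX_le {i j : Q.V} (hi : i ≠ 0) (hj : j ≠ 0)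
    (h : srcX j + tgtX j ≤ srcX i + tgtX i) : srcX j ≤ srcX i ∧ tgtX j ≤ tgtX i := by
  have h1 := width_one_le_tgtX hi
  have h2 := width_one_le_tgtX hj
  have h3 := srcX_nonpos (v := i)
  have h4 := srcX_nonpos (v := j)
  have h5 := srcX_eq_zero_or i
  have h6 := srcX_eq_zero_or j
  omega

theorem sum_mul_nonneg {I : Type} [Fintype I] {n : I → ℕ} {g : I → ℤ} (h : ∀ j, n j ≠ 0 → 0 ≤ g j) :
    0 ≤ ∑ j, (n j : ℤ) * g j := by
  refine Finset.sum_nonneg fun j _ => ?_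
  by_cases hj : n j = 0
  · simp [hj]
  · exact mul_nonneg (Int.natCast_nonneg _) (h j hj)

theorem sum_mul_eq_zero {I : Type} [Fintype I] {n : I → ℕ} {g : I → ℤ} (h : ∀ j, n j ≠ 0 → g j = 0) :
    ∑ j, (n j : ℤ) * g j = 0 := by
  refine Finset.sum_eq_zero fun j _ => ?_
  by_cases hj : n j = 0
  · simp [hj]
  · rw [h j hj, mul_zero]

theorem one_le_sum_mul {I : Type} [Fintype I] {n : I → ℕ} {g : I → ℤ} {i : I}
    (h : ∀ j, n j ≠ 0 → 0 ≤ g j) (hi : n i ≠ 0) (hg : 1 ≤ g i) : 1 ≤ ∑ j, (n j : ℤ) * g j := by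
  have h1 : (n i : ℤ) * g i ≤ ∑ j, (n j : ℤ) * g j := by
    refine Finset.single_le_sum (f := fun j => (n j : ℤ) * g j) (fun j _ => ?_) (Finset.mem_univ i)
    by_cases hj : n j = 0
    · simp [hj]
    · exact mul_nonneg (Int.natCast_nonneg _) (h j hj)
  have h2 : (1 : ℤ) ≤ n i := by omega
  nlinarith

/-- A flow contains the lattice path of one of the vertices that contribute to its boundary. -/
theorem IsFlow.exists_pathFlow_le {f : ((ℤ × ℤ) × (ℤ × ℤ)) →₀ ℕ} (hf : Q.IsFlow f)
    {n : {i : Q.V // i ≠ 0} → ℕ} (hn : ∃ i, n i ≠ 0)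
    (hb : ∀ φ : ℤ × ℤ → ℤ, boundary φ f =
      ∑ i, (n i : ℤ) * (φ (tgtPoint i.1) - φ (srcPoint i.1))) :
    ∃ i, n i ≠ 0 ∧ ∃ Y, IsPath i.1 Y ∧ pathFlow (srcX i.1) (tgtX i.1) Y ≤ f := by
  classical
  -- Choose `i` so that no path starts later and no path ends later.
  obtain ⟨i, hi, hmax⟩ : ∃ i, n i ≠ 0 ∧
      ∀ j, n j ≠ 0 → srcX j.1 ≤ srcX i.1 ∧ tgtX j.1 ≤ tgtX i.1 := by
    obtain ⟨i0, hi0⟩ := hn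
    obtain ⟨i, hi, h⟩ := Finset.exists_max_image (Finset.univ.filter fun j => n j ≠ 0)
      (fun j => srcX j.1 + tgtX j.1) ⟨i0, by simpa using hi0⟩
    refine ⟨i, by simpa using hi, fun j hj => ?_⟩
    exact srcX_le_and_tgtX_le i.2 j.2 (h j (by simpa using hj))
  have hN : ∀ x, (hCount f x fun _ => True) = ∑ j, (n j : ℤ) *
      ((if x < tgtX j.1 then 1 else 0) - if x < srcX j.1 then 1 else 0) := by
    intro x
    rw [← hf.boundary_right, hb]
    exact Finset.sum_congr rfl fun j _ => congrArg _
      (congrArg₂ _ (@Set.indicator_apply _ _ _ _ _ _ (_)) (@Set.indicator_apply _ _ _ _ _ _ (_)))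
  have hL : ∀ x y, hCount f (x - 1) (· ≤ y) - hCount f x (· ≤ y) - f (vEdge x y) =
      ∑ j, (n j : ℤ) * ((if tgtX j.1 = x ∧ Q.hi (tgtX j.1 - 1) ≤ y then 1 else 0) -
        if srcX j.1 = x ∧ Q.lo (srcX j.1) ≤ y then 1 else 0) := by
    intro x y
    rw [← hf.boundary_line, hb]
    exact Finset.sum_congr rfl fun j _ => congrArg _
      (congrArg₂ _ (@Set.indicator_apply _ _ _ _ _ _ (_)) (@Set.indicator_apply _ _ _ _ _ _ (_)))
  have hab := srcX_lt_tgtX i.2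
  have hw := Q.range_arith.2.1
  have hbw := width_one_le_tgtX i.2
  have hstep : ∀ x y, f (hEdge x y) ≠ 0 → Q.lo x ≤ y ∧ y ≤ Q.hi x := fun x y h =>
    (step_right_iff.1 (hf.step _ h)).2.2
  -- The path follows the lowest edge with positive flow in each column. There is flow in each of
  -- these columns since the paths of `i` contribute.
  have hY : ∀ x, ∃ y, srcX i.1 ≤ x → x < tgtX i.1 →
      f (hEdge x y) ≠ 0 ∧ ∀ z, z < y → f (hEdge x z) = 0 := by
    intro x
    by_cases hx : srcX i.1 ≤ x ∧ x < tgtX i.1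
    · have h1 : 1 ≤ hCount f x fun _ => True := by
        rw [hN]
        refine one_le_sum_mul (i := i) (fun j hj => ?_) hi ?_
        · have := hmax j hj
          split_ifs <;> omega
        · split_ifs <;> omega
      have h2 : ∃ y, f (hEdge x y) ≠ 0 := by
        by_contra hcon
        push Not at hcon
        rw [hCount_eq_zero fun y _ => hcon y] at h1
        omega
      obtain ⟨y, hy, hy'⟩ := Int.exists_least_of_bdd (P := fun y => f (hEdge x y) ≠ 0)
        ⟨Q.lo x, fun z hz => (hstep x z hz).1⟩ h2
      refine ⟨y, fun _ _ => ⟨hy, fun z hz => ?_⟩⟩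
      by_contra hcon
      have := hy' z hcon
      omega
    · exact ⟨0, fun h1 h2 => absurd ⟨h1, h2⟩ hx⟩
  choose Y hY hY0 using hY
  have hC0 : ∀ x y, srcX i.1 ≤ x → x < tgtX i.1 → y < Y x → hCount f x (· ≤ y) = 0 :=
    fun x y h1 h2 h3 => hCount_eq_zero fun z hz => hY0 x h1 h2 z (by omega)
  have hC1 : ∀ x y, srcX i.1 ≤ x → x < tgtX i.1 → Y x ≤ y → 1 ≤ hCount f x (· ≤ y) := by
    intro x y h1 h2 h3
    have := le_hCount (f := f) (x := x) (p := (· ≤ y)) h3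
    have := hY x h1 h2
    omega
  -- If the lowest height dropped, flow would leave the lower part of the line `x` without entering
  -- it from the left, and no path starts on this line by the choice of `i`.
  have hmono : ∀ x, srcX i.1 < x → x < tgtX i.1 → Y (x - 1) ≤ Y x := by
    intro x h1 h2
    by_contra hlt
    have h3 := hL x (Y x)
    rw [hC0 (x - 1) (Y x) (by omega) (by omega) (by omega)] at h3
    have h4 := hC1 x (Y x) h1.le h2 le_rfl
    have h5 : 0 ≤ ∑ j, (n j : ℤ) *
        ((if tgtX j.1 = x ∧ Q.hi (tgtX j.1 - 1) ≤ Y x then 1 else 0) -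
          if srcX j.1 = x ∧ Q.lo (srcX j.1) ≤ Y x then 1 else 0) := by
      refine sum_mul_nonneg fun j hj => ?_
      have := hmax j hj
      split_ifs <;> omega
    omega
  have hpath : IsPath i.1 (extendPath i.1 Y) :=
    isPath_extendPath i.2 (fun x h1 h2 => hstep x _ (hY x h1 h2)) hmono
  refine ⟨i, hi, _, hpath, fun e => ?_⟩
  by_cases he : pathFlow (srcX i.1) (tgtX i.1) (extendPath i.1 Y) e = 0
  · rw [he]
    exact Nat.zero_le _
  rcases pathFlow_ne_zero he with ⟨x, h1, h2, rfl⟩ | ⟨x, y, h1, h2, h3, h4, rfl⟩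
  · rw [pathFlow_hEdge, if_pos ⟨⟨h1, h2⟩, rfl⟩, extendPath_of_mem h1 h2]
    exact Nat.one_le_iff_ne_zero.2 (hY x h1 h2)
  · rw [pathFlow_vEdge, if_pos ⟨⟨h1, h2⟩, h3, h4⟩]
    -- For a vertical edge of the path, consider the balance of the line up to height `y`. It has to
    -- be shown that more flow enters or starts there than leaves to the right or ends.
    have h5 := hL x y
    suffices (1 : ℤ) ≤ f (vEdge x y) by exact_mod_cast this
    rcases h2.eq_or_lt with rfl | h2
    · rw [hpath.finish] at h4
      rw [extendPath_of_mem (by omega) (by omega)] at h3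
      have h6 := hC1 (tgtX i.1 - 1) y (by omega) (by omega) h3
      -- No path continues beyond the end of the paths of `i`.
      have h7 : (hCount f (tgtX i.1) fun _ => True) = 0 := by
        rw [hN]
        refine sum_mul_eq_zero fun j hj => ?_
        have := hmax j hj
        rw [if_neg (by omega), if_neg (by omega), sub_zero]
      have h8 : hCount f (tgtX i.1) (· ≤ y) = 0 := hCount_eq_zero fun z _ => by
        have := le_hCount (f := f) (x := tgtX i.1) (y := z) (p := fun _ => True) trivial
        omega
      rw [sum_mul_eq_zero] at h5
      · omega
      · intro j hj
        have := hmax j hj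
        rw [if_neg, if_neg, sub_zero]
        · omega
        · rintro ⟨h8, h9⟩
          rw [h8] at h9
          omega
    · rw [extendPath_of_mem h1 h2] at h4
      rw [hC0 x y h1 h2 h4] at h5
      rcases h1.eq_or_lt with rfl | h1
      · rw [hpath.start] at h3
        have h6 : 0 ≤ hCount f (srcX i.1 - 1) (· ≤ y) := hCount_nonneg
        -- On the first line the source of `i` itself feeds the edge, and no path ends there since
        -- every end lies further to the right.
        have h7 : 1 ≤ ∑ j, (n j : ℤ) *
            -((if tgtX j.1 = srcX i.1 ∧ Q.hi (tgtX j.1 - 1) ≤ y then 1 else 0) -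
              if srcX j.1 = srcX i.1 ∧ Q.lo (srcX j.1) ≤ y then 1 else 0) := by
          have h8 := srcX_nonpos (v := i.1)
          refine one_le_sum_mul (i := i) (fun j hj => ?_) hi ?_
          · have := width_one_le_tgtX j.2
            split_ifs <;> omega
          · split_ifs <;> omega
        simp only [mul_neg, Finset.sum_neg_distrib] at h7
        omega
      · rw [extendPath_of_mem (by omega) (by omega)] at h3
        -- A sink on this line has height `hi (x - 1)`. From this height on, the whole flow of the
        -- previous column is counted; it exceeds what ends on the line, because the paths of `i` go
        -- on. Below this height there is no sink.
        by_cases h6 : Q.hi (x - 1) ≤ y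
        · have h7 : hCount f (x - 1) (· ≤ y) = hCount f (x - 1) fun _ => True :=
            hCount_congr fun z hz => iff_of_true ((hstep _ z hz).2.trans h6) trivial
          rw [h7, hN] at h5
          have h8 : 1 ≤ ∑ j, (n j : ℤ) *
              (((if x - 1 < tgtX j.1 then 1 else 0) - if x - 1 < srcX j.1 then 1 else 0) -
              ((if tgtX j.1 = x ∧ Q.hi (tgtX j.1 - 1) ≤ y then 1 else 0) -
              if srcX j.1 = x ∧ Q.lo (srcX j.1) ≤ y then 1 else 0)) := by
            refine one_le_sum_mul (i := i) (fun j hj => ?_) hi ?_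
            · have := hmax j hj
              split_ifs <;> omega
            · split_ifs <;> omega
          simp only [mul_sub _ (_ - _), Finset.sum_sub_distrib] at h8
          omega
        · have h7 := hC1 (x - 1) y (by omega) (by omega) h3
          rw [sum_mul_eq_zero] at h5
          · omega
          · intro j hj
            have := hmax j hj
            rw [if_neg, if_neg, sub_zero]
            · omega
            · rintro ⟨h8, h9⟩
              rw [h8] at h9
              omega

end Peeling

end YShapedQuiver

namespace YShapedQuiver

variable {Q : YShapedQuiver}

/-! ### Decomposition into path monomials and the toric embedding -/

section ToricEmbedding

theorem boundary_flow_eq_sum {n : {i : Q.V // i ≠ 0} → ℕ} {v : Q.Arrow →₀ ℕ}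
    (hv : Finsupp.weight Q.arrowWeight v = ∑ i, n i • Q.pathWeight i.1) (φ : ℤ × ℤ → ℤ) :
    boundary φ (Q.flow v) = ∑ i, (n i : ℤ) * (φ (tgtPoint i.1) - φ (srcPoint i.1)) := by
  rw [← pairing_weight, hv, map_sum]
  refine Finset.sum_congr rfl fun i _ => ?_
  rw [map_nsmul, pairing_pathWeight φ i.2, nsmul_eq_mul]

/-- The total flow in each column is determined by the weight, hence zero. So there is no flow
through horizontal edges, and together with the weight they determine the monomial. -/
theorem eq_zero_of_weight_eq_zero {v : Q.Arrow →₀ ℕ}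
    (hv : Finsupp.weight Q.arrowWeight v = 0) : v = 0 := by
  refine eq_of_horizontal_eq (by rw [hv, map_zero]) ?_
  ext c
  have h1 : (hCount (Q.flow v) c.newRow.column fun _ => True) = 0 := by
    rw [← (isFlow_flow v).boundary_right, ← pairing_weight, hv, map_zero]
  have h2 := le_hCount (f := Q.flow v) (x := c.newRow.column) (y := c.height)
    (p := fun _ => True) trivial
  rw [horizontal_apply, Coord.edge, map_zero, Finsupp.zero_apply]
  omega

theorem exists_pluckerArrows_le {n : {i : Q.V // i ≠ 0} → ℕ} {v : Q.Arrow →₀ ℕ}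
    (hv : Finsupp.weight Q.arrowWeight v = ∑ i, n i • Q.pathWeight i.1) (hn : ∃ i, n i ≠ 0) :
    ∃ i, n i ≠ 0 ∧ ∃ σ : Q.Plucker i.1, IsValid σ ∧ pluckerArrows σ ≤ v := by
  obtain ⟨i, hi, Y, hY, hle⟩ := (isFlow_flow v).exists_pathFlow_le hn (boundary_flow_eq_sum hv)
  obtain ⟨σ, hσ, hσY⟩ := exists_valid_of_heights i.2 Y hY.bounds hY.mono
  refine ⟨i, hi, σ, hσ, Q.isForked.le_of_flow_le ?_⟩
  rw [flow_pluckerArrows i.2 hσ, (isPath_pluckerPath i.2 hσ).congr hY]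
  · exact hle
  · intro x h1 h2
    obtain ⟨p, rfl⟩ := exists_row i.2 h1 h2
    rw [pluckerPath_column, hσY]

/-- Induction on the number of paths: `exists_pluckerArrows_le` splits off one path monomial, and
the quotient has the weight of the remaining paths. -/
theorem exists_eq_sum_pluckerArrows (n : {i : Q.V // i ≠ 0} → ℕ) (v : Q.Arrow →₀ ℕ)
    (hv : Finsupp.weight Q.arrowWeight v = ∑ i, n i • Q.pathWeight i.1) :
    ∃ s : ∀ i : {i : Q.V // i ≠ 0}, Multiset (Q.Plucker i.1), (∀ i, (s i).card = n i) ∧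
      (∀ i, ∀ σ ∈ s i, IsValid σ) ∧ v = ∑ i, ((s i).map pluckerArrows).sum := by
  classical
  induction hk : ∑ i, n i generalizing n v with
  | zero =>
    have h0 : ∀ i, n i = 0 := fun i => Finset.sum_eq_zero_iff.1 hk i (Finset.mem_univ i)
    refine ⟨fun _ => 0, fun i => by simp [h0 i], by simp, ?_⟩
    rw [eq_zero_of_weight_eq_zero (hv.trans (Finset.sum_eq_zero fun i _ => by rw [h0, zero_smul]))]
    simp
  | succ k ih =>
    have hn : ∃ i, n i ≠ 0 := by
      by_contra hcon
      push Not at hcon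
      rw [Finset.sum_eq_zero fun i _ => hcon i] at hk
      omega
    obtain ⟨i, hi, σ, hσ, hle⟩ := exists_pluckerArrows_le hv hn
    obtain ⟨v', rfl⟩ := exists_add_of_le hle
    obtain ⟨n', rfl⟩ : ∃ n', n = (Pi.single i 1 : {i : Q.V // i ≠ 0} → ℕ) + n' := by
      refine exists_add_of_le (Pi.le_def.2 fun j => ?_)
      rcases eq_or_ne j i with rfl | hj
      · rw [Pi.single_eq_same]
        omega
      · rw [Pi.single_eq_of_ne hj]
        omega
    have hs1 : ∑ j, (Pi.single i 1 : {i : Q.V // i ≠ 0} → ℕ) j • Q.pathWeight j.1 =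
        Q.pathWeight i.1 := by
      rw [Finset.sum_eq_single i]
      · simp
      · intro j _ hj
        simp [hj]
      · exact fun h => absurd (Finset.mem_univ _) h
    simp only [Pi.add_apply, add_smul, Finset.sum_add_distrib] at hv hk
    rw [hs1, map_add, weight_pluckerArrows i.2 hσ, add_right_inj] at hv
    rw [Finset.sum_pi_single', if_pos (Finset.mem_univ _), add_comm, Nat.add_right_cancel_iff] at hk
    obtain ⟨s, hs, hsv, hs2⟩ := ih n' v' hv hk
    refine ⟨fun j => (Pi.single i {σ} : ∀ j : {i : Q.V // i ≠ 0}, Multiset (Q.Plucker j.1)) j + s j,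
      fun j => ?_, fun j τ hτ => ?_, ?_⟩
    · rcases eq_or_ne j i with rfl | hj
      · rw [Multiset.card_add, hs, Pi.add_apply, Pi.single_eq_same, Pi.single_eq_same,
          Multiset.card_singleton]
      · simp [hj, hs]
    · rcases Multiset.mem_add.1 hτ with hτ | hτ
      · rcases eq_or_ne j i with rfl | hj
        · rw [Pi.single_eq_same, Multiset.mem_singleton] at hτ
          rwa [hτ]
        · rw [Pi.single_eq_of_ne hj] at hτ
          exact absurd hτ (Multiset.notMem_zero _)
      · exact hsv j τ hτ
    · simp only [Multiset.map_add, Multiset.sum_add, Finset.sum_add_distrib]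
      rw [← hs2, Finset.sum_eq_single i]
      · simp
      · intro j _ hj
        simp [hj]
      · exact fun h => absurd (Finset.mem_univ _) h

/-- The Fano condition makes the exponents `s i - s'_i` positive, so that every projective space
really contributes; it also makes the truncated subtraction of natural numbers an honest one. -/
theorem isToricEmbedding (hQ : Q.IsFano) :
    IsToricEmbedding Q.arrowWeight (∑ a, Q.arrowWeight a) Q.horizontal
      (fun i : {i : Q.V // i ≠ 0} => Q.pathWeight i.1) (fun i => Q.s i.1 - Q.sOut i.1)
      (fun i (σ : Q.Plucker i.1) => IsValid σ) (fun i (σ : Q.Plucker i.1) => pluckerArrows σ) where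
  inj _ _ hw h := eq_of_horizontal_eq hw h
  weight_u i _ h := weight_pluckerArrows i.2 h
  decomp := exists_eq_sum_pluckerArrows
  w_eq := by
    rw [sum_weight_eq_sum_pathWeight, Finset.sum_subtype Q.nonSource fun v => mem_nonSource]
    refine Finset.sum_congr rfl fun i _ => ?_
    rw [← natCast_zsmul, Nat.cast_sub (hQ i.1 i.2).le]
  pos i := Nat.sub_pos_of_lt (hQ i.1 i.2)

end ToricEmbedding

end YShapedQuiver

theorem mainTheorem3 (Q : YShapedQuiver) (hQ : Q.IsFano) : Nonempty (Q.Y ≅ Q.X) := by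
  refine YShapedQuiver.nonempty_iso_of_isToricEmbedding Q (YShapedQuiver.isToricEmbedding hQ)
    (fun i _ h => YShapedQuiver.toLaurent_initialTerm i.2 h) fun i σ h => ?_
  obtain ⟨p, hp⟩ := not_forall.1 h
  exact YShapedQuiver.initialTerm_eq_zero (not_not.1 hp)
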